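/- **Proposition 5.3.** Let $G=\mathbb Z/r_1\mathbb Z\times\dots\times\mathbb Z/r_n\mathbb Z$ be non-trivial with $r_j\mid r_{j+1}$, let $q$ be a prime power with $q\equiv 1 \pmod{r_n}$, and for each $m\mid r_n$ let $\chi_m$ be a multiplicative character of $\mathbb F_q$ of exact order $m$, extended by $\chi_m(0)=0$. *Notation.* Let $\mathcal R'=\prod_j\{0,\dots,r_j-1\}$ and $\mathcal R=\mathcal R'\setminus\{0\}$. For $s=(s_1,\dots,s_n)$ with $s_j\mid r_j$ put $\ell(s)=\operatorname{lcm}(s_1,\dots,s_n)$ and $\Omega_s=\{\omega: 1\le\omega_j\le s_j,\ (\omega_j,s_j)=1\}$; below, $(s,\omega)$ runs over all pairs with $s_j\mid r_j$, $\omega\in\Omega_s$. For $\beta\in\mathcal R'$ let $$A_\beta=\Big\{(s,\omega):\ \sum_j \tfrac{\ell(s)}{s_j}\omega_j\beta_j\equiv 0 \bmod \ell(s)\Big\},\qquad e(\beta)=\operatorname*{lcm}_j\frac{r_j}{(r_j,\beta_j)},$$ and write $\beta\sim\beta'$ if $A_\beta=A_{\beta'}$, with classes $[\beta]$; $e(\beta)$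 depends only on $[\beta]$. For non-negative integers $d(\alpha)$, $\alpha\in\mathcal R$, let $\mathcal F_{d(\alpha)}$ be the set of tuples $(f_\alpha)_{\alpha\in\mathcal R}$ of monic, squarefree, pairwise coprime polynomials in $\mathbb F_q[X]$ with $\deg f_\alpha=d(\alpha)$. For $\beta\in\mathcal R$ let $\mathcal F^\beta_{d(\alpha)}$ be defined in the same way, with $\deg f_\beta=d(\beta)-1$ instead of $\deg f_\beta=d(\beta)$, and let $\mathcal F_{[d(\alpha)]}=\mathcal F_{d(\alpha)}\cup\bigcup_{\beta\in\mathcal R}\mathcal F_{d(\alpha)}^\beta$. For $c\in(\mathbb F_q^*)^n$ and a tuple $(f_\alpha)$ let $$F_{(s)}^{(\omega)}=c_{(s)}^{(\omega)}\prod_{\alpha\in\mathcal R} f_\alpha^{\,\sum_j\frac{\ell(s)}{s_j}\omega_j\alpha_j \bmod \ell(s)},\qquad c_{(s)}^{(\omega)}=\prod_j c_j^{\,\frac{\ell(s)}{s_j}\omega_j \bmod \ell(s)},$$ exponents being least non-negative residues; at the point at infinity put $F_{(s)}^{(\omega)}(\infty)=c_{(s)}^{(\omega)}$ if $\sum_j\frac{\ell(s)}{s_j}\omega_j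 d_j\equiv0\bmod\ell(s)$ and $0$ otherwise, where $d_j=\sum_\alpha\alpha_j\deg f_\alpha$. For $(f_\alpha)\in\mathcal F_{d(\alpha)}$ without specified $c$, all $c_j=1$. A family $(\epsilon_{s,\omega})$ is *admissible* if there are $c\in(\mathbb F_q^*)^n$, $(f_\alpha)\in\mathcal F_{[d(\alpha)]}$ and $x\in\mathbb P^1(\mathbb F_q)$ with $\epsilon_{s,\omega}=\chi_{\ell(s)}(F_{(s)}^{(\omega)}(x))$ for all $(s,\omega)$; it is *$[\beta]$-admissible* if moreover $\epsilon_{s,\omega}=0$ exactly when $(s,\omega)\notin A_\beta$. *Statement.* Let $0\le\ell\le q$, let $x_1,\dots,x_\ell\in\mathbb F_q$ be distinct, let $(\epsilon_{s,\omega,i})_{s,\omega}$ be admissible for each $1\le i\le\ell$, and let $m_{[\beta]}$ be the number of $i\le \ell$ for which it is $[\beta]$-admissible. Then $$\#\big\{(f_\alpha)\in\mathcal F_{d(\alpha)}:\ \chi_{\ell(s)}\big(F_{(s)}^{(\omega)}(x_i)\big)=\epsilon_{s,\omega,i}\ \text{ for all } (s,\omega) \text{ and } 1\le i\le\ell\big\}$$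 $$=\frac{L_{|G|-2}\,q^{\sum_\alpha d(\alpha)}}{\zeta_q(2)^{|G|-1}}\prod_{[\beta]\ne[0]}\left(\frac{\phi\big(e(\beta)^2\big)}{|G|(q+|G|-1)}\right)^{m_{[\beta]}}\left(\frac{q}{|G|(q+|G|-1)}\right)^{m_{[0]}}\Big(1+O\big(q^{-\min_\alpha d(\alpha)/2}\big)\Big),$$ where $\phi$ is Euler's function, $\zeta_q(t)=\sum_{f\ \mathrm{monic}}|f|^{-t}$ is the zeta function of $\mathbb F_q[X]$ with $|f|=q^{\deg f}$, $$L_m=\prod_{j=1}^{m}\prod_P\Big(1-\frac{j}{(|P|+1)(|P|+j)}\Big)$$ with $P$ running over the monic irreducible polynomials in $\mathbb F_q[X]$, and the implied constant depends only on $q$ and $(r_1,\dots,r_n)$. -/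

import Mathlib

open Polynomial Finset

namespace AbelianCovers

noncomputable section

/-! ### Index sets attached to the group `ℤ/r₁ × ⋯ × ℤ/rₙ` -/

section Indices

variable {n : ℕ} (r : Fin n → ℕ)

/-- The order `|G| = r₁ ⋯ rₙ` of `G = ℤ/r₁ × ⋯ × ℤ/rₙ`. -/
def groupOrder : ℕ := ∏ j, r j

/-- All integer vectors `(β₁, …, βₙ)` with `0 ≤ βⱼ ≤ rⱼ - 1`. -/
abbrev RFull : Type := (j : Fin n) → Fin (r j)

/-- The vectors of `RFull r` other than `(0, …, 0)`. -/
abbrev RNonzero : Type := {α : RFull r // ∃ j, (α j : ℕ) ≠ 0}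

/-- The vector `(0, …, 0)`. -/
def zeroVec (hr : ∀ j, 0 < r j) : RFull r := fun j => ⟨0, hr j⟩

/-- The vectors `s = (s₁, …, sₙ)` with `sⱼ ∣ rⱼ`. -/
def divisorVecs : Finset (Fin n → ℕ) := Fintype.piFinset fun j => (r j).divisors

/-- `ℓ(s) = lcm(s₁, …, sₙ)`. -/
def ell (s : Fin n → ℕ) : ℕ := univ.lcm s

/-- The vectors `ω` with `1 ≤ ωⱼ ≤ sⱼ` and `gcd(ωⱼ, sⱼ) = 1`. -/
def Omega (s : Fin n → ℕ) : Finset (Fin n → ℕ) :=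
  Fintype.piFinset fun j => (Finset.Icc 1 (s j)).filter fun w => Nat.Coprime w (s j)

/-- The type of pairs `(s, ω)` with `sⱼ ∣ rⱼ` and `ω ∈ Omega s`. -/
abbrev PairIndex : Type :=
  {p : (_ : Fin n → ℕ) × (Fin n → ℕ) // p ∈ (divisorVecs r).sigma Omega}

variable {r}

/-- The component `s` of a pair `(s, ω)`. -/
abbrev PairIndex.s (p : PairIndex r) : Fin n → ℕ := p.1.1

/-- The component `ω` of a pair `(s, ω)`. -/
abbrev PairIndex.w (p : PairIndex r) : Fin n → ℕ := p.1.2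

/-- The integer `∑ⱼ (ℓ(s) / sⱼ) ωⱼ vⱼ`. -/
def pairing (p : PairIndex r) (v : Fin n → ℕ) : ℕ :=
  ∑ j, ell p.s / p.s j * p.w j * v j

/-- `A_β`: the pairs `(s, ω)` with `∑ⱼ (ℓ(s) / sⱼ) ωⱼ βⱼ ≡ 0 mod ℓ(s)`. -/
def zeroSumPairs (β : RFull r) : Finset (PairIndex r) :=
  univ.filter fun p => pairing p (fun j => (β j : ℕ)) ≡ 0 [MOD ell p.s]

/-- `e(β) = lcmⱼ (rⱼ / gcd(rⱼ, βⱼ))`. -/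
def ramIndex (β : RFull r) : ℕ := univ.lcm fun j => r j / Nat.gcd (r j) (β j)

variable (r)

/-- `β ∼ β'` if and only if `A_β = A_β'`. -/
instance relSetoid : Setoid (RFull r) where
  r β γ := zeroSumPairs β = zeroSumPairs γ
  iseqv := ⟨fun _ => rfl, fun h => h.symm, fun h k => h.trans k⟩

instance relDecidable : DecidableRel ((· ≈ ·) : RFull r → RFull r → Prop) :=
  fun β γ => inferInstanceAs (Decidable (zeroSumPairs β = zeroSumPairs γ))

/-- The set of classes `[β]`. -/
abbrev RClass : Type := Quotient (relSetoid r)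

variable {r}

/-- Whether a divisor `t` of `rⱼ` divides `βⱼ` can be read off from `A_β`. -/
theorem dvd_iff_of_rel {β γ : RFull r} (h : zeroSumPairs β = zeroSumPairs γ)
    (hr : ∀ j, 0 < r j) (j : Fin n) {t : ℕ} (ht : t ∣ r j) :
    t ∣ (β j : ℕ) ↔ t ∣ (γ j : ℕ) := by
  have htp : 0 < t := Nat.pos_of_dvd_of_pos ht (hr j)
  let s : Fin n → ℕ := Function.update (fun _ => 1) j t
  have hsj : s j = t := Function.update_self ..
  have hsi : ∀ i, i ≠ j → s i = 1 := fun i hi => Function.update_of_ne hi ..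
  have hl : ell s = t := by
    apply Nat.dvd_antisymm
    · apply Finset.lcm_dvd
      intro i _
      by_cases hi : i = j
      · subst hi; rw [hsj]
      · rw [hsi i hi]; exact one_dvd _
    · have := Finset.dvd_lcm (f := s) (mem_univ j)
      rwa [hsj] at this
  have hmem : (⟨s, fun _ => 1⟩ : (_ : Fin n → ℕ) × (Fin n → ℕ)) ∈
      (divisorVecs r).sigma Omega := by
    simp only [Finset.mem_sigma, divisorVecs, Omega, Fintype.mem_piFinset, Nat.mem_divisors,
      Finset.mem_filter, Finset.mem_Icc]
    refine ⟨fun i => ⟨?_, (hr i).ne'⟩, fun i => ⟨⟨le_rfl, ?_⟩, Nat.coprime_one_left _⟩⟩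
    · by_cases hi : i = j
      · subst hi; rw [hsj]; exact ht
      · rw [hsi i hi]; exact one_dvd _
    · by_cases hi : i = j
      · subst hi; rw [hsj]; exact htp
      · rw [hsi i hi]
  have key : ∀ δ : RFull r, (⟨_, hmem⟩ : PairIndex r) ∈ zeroSumPairs δ ↔ t ∣ (δ j : ℕ) := by
    intro δ
    simp only [zeroSumPairs, Finset.mem_filter, mem_univ, true_and, pairing, Nat.modEq_zero_iff_dvd]
    rw [hl, ← Finset.add_sum_erase _ _ (mem_univ j)]
    change t ∣ t / s j * 1 * (δ j : ℕ) + ∑ i ∈ univ.erase j, t / s i * 1 * (δ i : ℕ) ↔ _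
    rw [hsj, Nat.div_self htp, Nat.dvd_add_left]
    · simp
    · apply Finset.dvd_sum
      intro i hi
      rw [hsi i (Finset.ne_of_mem_erase hi)]
      simp
  rw [← key β, ← key γ, h]

theorem ramIndex_eq_of_rel {β γ : RFull r} (h : β ≈ γ) : ramIndex β = ramIndex γ := by
  have hr : ∀ j, 0 < r j := fun j => Nat.lt_of_le_of_lt (Nat.zero_le _) (β j).isLt
  have hg : ∀ j, Nat.gcd (r j) (β j) = Nat.gcd (r j) (γ j) := fun j =>
    Nat.dvd_antisymm
      (Nat.dvd_gcd (Nat.gcd_dvd_left _ _)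
        ((dvd_iff_of_rel h hr j (Nat.gcd_dvd_left _ _)).1 (Nat.gcd_dvd_right _ _)))
      (Nat.dvd_gcd (Nat.gcd_dvd_left _ _)
        ((dvd_iff_of_rel h hr j (Nat.gcd_dvd_left _ _)).2 (Nat.gcd_dvd_right _ _)))
  simp only [ramIndex, hg]

/-- The common value of `e` on a class. -/
def classRamIndex (b : RClass r) : ℕ :=
  Quotient.lift ramIndex (fun _ _ h => ramIndex_eq_of_rel h) b

end Indices

/-! ### Tuples of polynomials and their values -/

section Tuples

variable {F : Type*} [Field F] {n : ℕ} {r : Fin n → ℕ}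

/-- Tuples `(f_α)` of monic, squarefree, pairwise coprime polynomials. -/
def IsGoodTuple (f : RNonzero r → F[X]) : Prop :=
  (∀ α, (f α).Monic ∧ Squarefree (f α)) ∧ ∀ α γ, α ≠ γ → IsCoprime (f α) (f γ)

/-- The set `𝓕_d` of such tuples with `deg f_α = d α` for all `α`. -/
def tuples (F : Type*) [Field F] (d : RNonzero r → ℕ) : Set (RNonzero r → F[X]) :=
  {f | IsGoodTuple f ∧ ∀ α, (f α).natDegree = d α}

/-- The set `𝓕_d^β` of such tuples with `deg f_β = d β - 1` (in particular `d β ≥ 1`) and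
`deg f_α = d α` for `α ≠ β`. -/
def tuplesDrop (F : Type*) [Field F] (d : RNonzero r → ℕ) (β : RNonzero r) :
    Set (RNonzero r → F[X]) :=
  {f | IsGoodTuple f ∧ (f β).natDegree + 1 = d β ∧ ∀ α, α ≠ β → (f α).natDegree = d α}

/-- The union `𝓕_[d]` of `𝓕_d` and all the `𝓕_d^β`. -/
def tuplesAll (F : Type*) [Field F] (d : RNonzero r → ℕ) : Set (RNonzero r → F[X]) :=
  tuples F d ∪ ⋃ β, tuplesDrop F d β

/-- `c_(s)^(ω) = ∏ⱼ cⱼ ^ ((ℓ(s) / sⱼ) ωⱼ mod ℓ(s))`. -/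
def twistCoeff (c : Fin n → Fˣ) (p : PairIndex r) : F :=
  ∏ j, (c j : F) ^ ((ell p.s / p.s j * p.w j) % ell p.s)

/-- `F_(s)^(ω) = c_(s)^(ω) ∏_α f_α ^ (∑ⱼ (ℓ(s) / sⱼ) ωⱼ αⱼ mod ℓ(s))`. -/
def twistPoly (c : Fin n → Fˣ) (f : RNonzero r → F[X]) (p : PairIndex r) : F[X] :=
  C (twistCoeff c p) * ∏ α : RNonzero r, f α ^ (pairing p (fun j => (α.1 j : ℕ)) % ell p.s)

/-- `dⱼ = ∑_α αⱼ deg f_α`. -/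
def totalDegree (f : RNonzero r → F[X]) (j : Fin n) : ℕ :=
  ∑ α : RNonzero r, (α.1 j : ℕ) * (f α).natDegree

/-- The value of `F_(s)^(ω)` at a point of `ℙ¹(F)`, where `none` is the point at infinity; there
the value is `c_(s)^(ω)` if `∑ⱼ (ℓ(s) / sⱼ) ωⱼ dⱼ ≡ 0 mod ℓ(s)`, and `0` otherwise. -/
def twistValue (c : Fin n → Fˣ) (f : RNonzero r → F[X]) (p : PairIndex r) : Option F → F
  | some x => (twistPoly c f p).eval x
  | none => if pairing p (totalDegree f) ≡ 0 [MOD ell p.s] then twistCoeff c p else 0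

/-- The prescription `ε` is admissible: it is the family of values `χ_ℓ(s) (F_(s)^(ω) (x))` for
some leading coefficients `c`, some tuple in `𝓕_[d]` and some point `x ∈ ℙ¹(F)`. -/
def IsAdmissible (χ : ℕ → MulChar F ℂ) (d : RNonzero r → ℕ) (ε : PairIndex r → ℂ) : Prop :=
  ∃ c : Fin n → Fˣ, ∃ f ∈ tuplesAll F d, ∃ x : Option F,
    ∀ p : PairIndex r, ε p = χ (ell p.s) (twistValue c f p x)

/-- `ε` is `[β]`-admissible: it is admissible and vanishes exactly outside `A_β`. -/
def IsClassAdmissible (χ : ℕ → MulChar F ℂ) (d : RNonzero r → ℕ) (ε : PairIndex r → ℂ)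
    (b : RClass r) : Prop :=
  IsAdmissible χ d ε ∧
    ∀ p : PairIndex r, ε p = 0 ↔
      p ∉ Quotient.lift (zeroSumPairs (r := r)) (fun _ _ h => h) b

/-- `m_[β]`: the number of indices `i` for which `ε i` is `[β]`-admissible. -/
def classCount (χ : ℕ → MulChar F ℂ) (d : RNonzero r → ℕ) {k : ℕ}
    (ε : Fin k → PairIndex r → ℂ) (b : RClass r) : ℕ :=
  Set.ncard {i : Fin k | IsClassAdmissible χ d (ε i) b}

/-- The tuples of `𝓕_d` (with all leading coefficients `cⱼ = 1`) that take the prescribed values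
`χ_ℓ(s) (F_(s)^(ω) (x i)) = ε i (s, ω)` at the points `x i`. -/
def valueSet (χ : ℕ → MulChar F ℂ) (d : RNonzero r → ℕ) {k : ℕ} (x : Fin k → F)
    (ε : Fin k → PairIndex r → ℂ) : Set (RNonzero r → F[X]) :=
  {f | f ∈ tuples F d ∧
    ∀ i, ∀ p : PairIndex r, χ (ell p.s) ((twistPoly 1 f p).eval (x i)) = ε i p}

end Tuples

/-! ### The constants -/

section Constants

variable (F : Type*) [Field F] [Fintype F]

/-- The norm `|f| = q ^ deg f` of a nonzero polynomial. -/
def polyNorm {F : Type*} [Field F] [Fintype F] (f : F[X]) : ℝ :=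
  (Fintype.card F : ℝ) ^ f.natDegree

/-- The zeta function of `F[X]`: the sum of `|f| ^ (-t)` over the monic polynomials. -/
def zetaPoly (t : ℝ) : ℝ := ∑' f : {f : F[X] // f.Monic}, polyNorm f.1 ^ (-t)

/-- The Euler factor `1 - j / ((|P| + 1) (|P| + j))`. -/
def eulerFactor {F : Type*} [Field F] [Fintype F] (j : ℕ) (P : F[X]) : ℝ :=
  1 - (j : ℝ) / ((polyNorm P + 1) * (polyNorm P + j))

/-- `L_m`: the product over `1 ≤ j ≤ m` and over the monic irreducible polynomials `P` of the
Euler factors. -/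
def eulerL (m : ℕ) : ℝ :=
  ∏ j ∈ Finset.Icc 1 m, ∏' P : {P : F[X] // P.Monic ∧ Irreducible P}, eulerFactor j P.1

/-- The series that defines `zetaPoly F t` converges for `t > 1`. -/
theorem summable_zetaPoly {t : ℝ} (ht : 1 < t) :
    Summable fun f : {f : F[X] // f.Monic} => polyNorm f.1 ^ (-t) := by
  have hq : (1 : ℝ) < Fintype.card F := by exact_mod_cast Fintype.one_lt_card
  let g : {f : F[X] // f.Monic} → ℕ := fun f => f.1.natDegree
  let φ : (m : ℕ) → {f // g f = m} → (Fin m → F) := fun m f i => f.1.1.coeff i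
  have hφ : ∀ m, Function.Injective (φ m) := by
    rintro m ⟨⟨f, hf⟩, hfm⟩ ⟨⟨h, hh⟩, hhm⟩ he
    simp only [Subtype.mk.injEq]
    ext i
    change f.natDegree = m at hfm
    change h.natDegree = m at hhm
    rcases lt_trichotomy i m with hi | hi | hi
    · exact congrFun he ⟨i, hi⟩
    · have h1 : f.coeff i = 1 := by rw [hi, ← hfm]; exact hf
      have h2 : h.coeff i = 1 := by rw [hi, ← hhm]; exact hh
      rw [h1, h2]
    · rw [coeff_eq_zero_of_natDegree_lt (by omega), coeff_eq_zero_of_natDegree_lt (by omega)]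
  have hfin : ∀ m, Finite {f // g f = m} := fun m => Finite.of_injective _ (hφ m)
  have hcard : ∀ m, (Nat.card {f // g f = m} : ℝ) ≤ (Fintype.card F : ℝ) ^ m := by
    intro m
    have := Nat.card_le_card_of_injective _ (hφ m)
    simp only [Nat.card_eq_fintype_card, Fintype.card_pi, prod_const, card_univ,
      Fintype.card_fin] at this
    exact_mod_cast this
  rw [← (Equiv.sigmaFiberEquiv g).summable_iff]
  rw [summable_sigma_of_nonneg (fun _ => by
    simp only [Function.comp, polyNorm]; positivity)]
  refine ⟨fun m => Summable.of_finite, ?_⟩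
  have hval : ∀ m (f : {f // g f = m}),
      ((fun f : {f : F[X] // f.Monic} => polyNorm f.1 ^ (-t)) ∘ (Equiv.sigmaFiberEquiv g)) ⟨m, f⟩
        = ((Fintype.card F : ℝ) ^ (-t)) ^ m := by
    rintro m ⟨f, rfl⟩
    simp only [Function.comp, Equiv.sigmaFiberEquiv, Equiv.coe_fn_mk, polyNorm, g]
    rw [← Real.rpow_natCast, ← Real.rpow_natCast, ← Real.rpow_mul (by positivity),
      ← Real.rpow_mul (by positivity), mul_comm]
  simp only [hval, tsum_const, nsmul_eq_mul]
  have hr : (Fintype.card F : ℝ) * (Fintype.card F : ℝ) ^ (-t) < 1 := by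
    have h0 : (0 : ℝ) < Fintype.card F := by linarith
    rw [← Real.rpow_one_add' h0.le (by linarith)]
    exact Real.rpow_lt_one_of_one_lt_of_neg hq (by linarith)
  refine Summable.of_nonneg_of_le (fun m => by positivity) (fun m => ?_)
    (summable_geometric_of_lt_one (by positivity) hr)
  rw [mul_pow]
  exact mul_le_mul_of_nonneg_right (hcard m) (by positivity)

/-- The products that define `eulerL` converge. -/
theorem multipliable_eulerFactor (j : ℕ) :
    Multipliable fun P : {P : F[X] // P.Monic ∧ Irreducible P} => eulerFactor j P.1 := by
  have hs : Summable fun P : {P : F[X] // P.Monic ∧ Irreducible P} =>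
      polyNorm P.1 ^ (-(2 : ℝ)) :=
    (summable_zetaPoly F one_lt_two).comp_injective
      (i := fun P : {P : F[X] // P.Monic ∧ Irreducible P} =>
        (⟨P.1, P.2.1⟩ : {f : F[X] // f.Monic}))
      (fun P Q h => Subtype.ext (by simpa using h))
  have hpos : ∀ f : F[X], 0 < polyNorm f := fun f => by
    have : (0 : ℝ) < Fintype.card F := by exact_mod_cast Fintype.card_pos
    simp only [polyNorm]; positivity
  have h2 : Summable fun P : {P : F[X] // P.Monic ∧ Irreducible P} =>
      -((j : ℝ) / ((polyNorm P.1 + 1) * (polyNorm P.1 + j))) := by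
    apply Summable.neg
    refine Summable.of_nonneg_of_le (fun P => ?_) (fun P => ?_) (hs.mul_left (j : ℝ))
    · have := hpos P.1; positivity
    · have := hpos P.1
      rw [div_eq_mul_inv, Real.rpow_neg this.le]
      gcongr
      norm_cast
      rw [sq]
      gcongr
      · linarith
      · have : (0 : ℝ) ≤ j := Nat.cast_nonneg j
        linarith
  have := multipliable_one_add_of_summable h2.norm
  simpa only [eulerFactor, sub_eq_add_neg] using this

/-- The main term. -/
def mainTerm {F : Type*} [Field F] [Fintype F] {n : ℕ} {r : Fin n → ℕ} (hr : ∀ j, 0 < r j)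
    (χ : ℕ → MulChar F ℂ) (d : RNonzero r → ℕ) {k : ℕ} (ε : Fin k → PairIndex r → ℂ) : ℝ :=
  eulerL F (groupOrder r - 2) * (Fintype.card F : ℝ) ^ (∑ α, d α)
      / zetaPoly F 2 ^ (groupOrder r - 1)
    * (∏ b ∈ (univ : Finset (RClass r)).erase (Quotient.mk _ (zeroVec r hr)),
        ((Nat.totient (classRamIndex b ^ 2) : ℝ)
          / (groupOrder r * (Fintype.card F + groupOrder r - 1))) ^ classCount χ d ε b)
    * ((Fintype.card F : ℝ) / (groupOrder r * (Fintype.card F + groupOrder r - 1)))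
        ^ classCount χ d ε (Quotient.mk _ (zeroVec r hr))

end Constants

end

end AbelianCovers

open AbelianCovers

/-!
Fix all degrees but one. By inclusion-exclusion over sets of primes, the density of the good tuples
with prescribed values changes by `O(q^(-D/2))` when the remaining degree goes from `D` to `D + 1`,
because a prime `P` of degree at least `2` excludes the multiples of `P` or of `P²`. Telescoping,
the density differs by `O(q^(-min d/2))` from its limit for degrees tending to infinity, which is
the product over all primes `P` of the local densities modulo `P²`.

The pairs `(s, ω)` are the characters of `G`, and `A_β` consists of those that are trivial on `β`.
Hence `ε` is `[β]`-admissible when it is given on `A_β` by an element `h` of `G`, determined up to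
the subgroup `⟨β⟩` of order `e(β)`, and vanishes elsewhere. There are `φ(e(β))` choices of `γ ∼ β`
for the entry that vanishes at `x`, and for each of them the values of the other entries are in the
right class with probability `e(β) / |G|`. This gives the local factor at `x`.
-/

namespace AbelianCovers

noncomputable section

/-! ### Averages over finite sets -/

section Averages

open scoped BigOperators

open Classical in
/-- The proportion of the elements of `s` that satisfy `p`; it is `0` if `s` is empty. -/
def proportion {α : Type*} (s : Finset α) (p : α → Prop) : ℝ := 𝔼 a ∈ s, if p a then 1 else 0

section Proportion

variable {α β : Type*} {s : Finset α} {p q : α → Prop}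

theorem proportion_eq_expect [DecidablePred p] :
    proportion s p = 𝔼 a ∈ s, if p a then 1 else 0 := by
  rw [proportion]
  congr!

theorem proportion_eq_card_div [DecidablePred p] :
    proportion s p = (#{a ∈ s | p a} : ℝ) / #s := by
  rw [proportion_eq_expect, expect_eq_sum_div_card, sum_boole]

theorem proportion_congr (h : ∀ a ∈ s, p a ↔ q a) : proportion s p = proportion s q := by
  classical
  simp only [proportion_eq_expect]
  exact expect_congr rfl fun a ha => by simp only [h a ha]

theorem proportion_nonneg : 0 ≤ proportion s p :=
  expect_nonneg fun _ _ => by split_ifs <;> norm_num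

theorem proportion_mono (h : ∀ a ∈ s, p a → q a) : proportion s p ≤ proportion s q :=
  expect_le_expect fun a ha => by
    by_cases hp : p a
    · simp [hp, h a ha hp]
    · simp only [hp, if_false]
      split_ifs <;> norm_num

theorem proportion_eq_zero (h : ∀ a ∈ s, ¬ p a) : proportion s p = 0 :=
  expect_eq_zero fun a ha => if_neg (h a ha)

theorem proportion_exists_le {ι : Type*} (I : Finset ι) (p : ι → α → Prop) :
    proportion s (fun a => ∃ i ∈ I, p i a) ≤ ∑ i ∈ I, proportion s (p i) := by
  classical
  simp only [proportion_eq_expect, ← expect_sum_comm]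
  refine expect_le_expect fun a _ => ?_
  have hnonneg : ∀ i ∈ I, (0 : ℝ) ≤ if p i a then 1 else 0 := fun i _ => by
    split_ifs <;> norm_num
  split_ifs with h
  · obtain ⟨i, hi, hp⟩ := h
    simpa only [hp, if_true] using single_le_sum hnonneg hi
  · exact sum_nonneg hnonneg

theorem abs_proportion_sub_le : |proportion s p - proportion s q| ≤
    proportion s fun a => ¬ (p a ↔ q a) := by
  rw [proportion, proportion, ← expect_sub_distrib]
  refine (abs_expect_le _ _).trans (expect_le_expect fun a _ => ?_)
  by_cases hp : p a <;> by_cases hq : q a <;> simp [hp, hq]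

theorem proportion_or (h : ∀ a ∈ s, ¬ (p a ∧ q a)) :
    proportion s (fun a => p a ∨ q a) = proportion s p + proportion s q := by
  rw [proportion, proportion, proportion, ← expect_add_distrib]
  refine expect_congr rfl fun a ha => ?_
  have := h a ha
  by_cases hp : p a <;> by_cases hq : q a <;> simp_all

theorem proportion_and [DecidablePred p] :
    proportion s (fun a => p a ∧ q a) = proportion s p * proportion {a ∈ s | p a} q := by
  classical
  rcases ({a ∈ s | p a} : Finset α).eq_empty_or_nonempty with h | h
  · have hp := filter_eq_empty_iff.1 h
    rw [proportion_eq_zero fun a ha hpq => hp ha hpq.1, proportion_eq_zero fun a ha => hp ha,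
      zero_mul]
  · have hcard : (#{a ∈ s | p a} : ℝ) ≠ 0 := Nat.cast_ne_zero.2 h.card_ne_zero
    rw [proportion_eq_card_div, proportion_eq_card_div, proportion_eq_card_div, filter_filter,
      mul_comm, div_mul_div_cancel₀ hcard]

theorem proportion_piFinset {ι : Type*} [Fintype ι] [DecidableEq ι] {β : ι → Type*}
    (s : ∀ i, Finset (β i)) (p : ∀ i, β i → Prop) :
    proportion (Fintype.piFinset s) (fun f => ∀ i, p i (f i)) = ∏ i, proportion (s i) (p i) := by
  classical
  simp only [proportion_eq_card_div, prod_div_distrib]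
  rw [Fintype.card_piFinset, ← Nat.cast_prod, ← Nat.cast_prod]
  congr 2
  rw [← Fintype.card_piFinset]
  congr 1
  refine Finset.ext fun f => ?_
  simp [forall_and]

theorem proportion_eq_sum_fiber {t : Finset β} {g : α → β}
    (hg : ∀ a ∈ s, g a ∈ t) :
    proportion s p = ∑ b ∈ t, proportion s fun a => g a = b ∧ p a := by
  classical
  simp only [proportion_eq_expect, ← expect_sum_comm]
  refine expect_congr rfl fun a ha => ?_
  by_cases hp : p a <;> simp [hp, hg a ha]

theorem proportion_forall_not_dvd {R ι : Type*} [CommRing R] (s : Finset R) (E : R → Prop)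
    {T : Finset ι} {μ : ι → R} (hμ : (T : Set ι).Pairwise (Function.onFun IsCoprime μ)) :
    proportion s (fun g => E g ∧ ∀ P ∈ T, ¬ μ P ∣ g) =
      ∑ S ∈ T.powerset, (-1) ^ #S * proportion s fun g => E g ∧ ∏ P ∈ S, μ P ∣ g := by
  classical
  simp only [proportion_eq_expect, mul_expect, ← expect_sum_comm]
  refine expect_congr rfl fun g _ => ?_
  by_cases hE : E g
  · calc (if E g ∧ ∀ P ∈ T, ¬ μ P ∣ g then (1 : ℝ) else 0)
        = ∏ P ∈ T, (1 + -if μ P ∣ g then (1 : ℝ) else 0) := by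
          simp only [hE, true_and]
          rw [← prod_const_one (s := T), ← prod_ite_zero]
          refine prod_congr rfl fun P _ => ?_
          split_ifs <;> simp_all
      _ = ∑ S ∈ T.powerset, (-1) ^ #S * if E g ∧ ∏ P ∈ S, μ P ∣ g then 1 else 0 := by
          rw [prod_one_add]
          refine sum_congr rfl fun S hS => ?_
          have hdvd : ∏ P ∈ S, μ P ∣ g ↔ ∀ P ∈ S, μ P ∣ g :=
            ⟨fun h P hP => (dvd_prod_of_mem μ hP).trans h, fun h =>
              prod_dvd_of_coprime (hμ.mono (by exact_mod_cast mem_powerset.1 hS)) h⟩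
          rw [prod_neg, prod_ite_zero, prod_const_one]
          simp only [hE, true_and, hdvd]
  · simp [hE]

end Proportion

/-- The map `g` sends the uniform distribution on `s` to the uniform distribution on `t`. -/
structure IsEquidistributed {α β : Type*} (g : α → β) (s : Finset α) (t : Finset β) : Prop where
  mapsTo : ∀ a ∈ s, g a ∈ t
  proportion_fiber : ∀ b ∈ t, proportion s (fun a => g a = b) = (#t : ℝ)⁻¹

namespace IsEquidistributed

theorem expect_comp {α β : Type*} {g : α → β} {s : Finset α} {t : Finset β}
    (h : IsEquidistributed g s t) (φ : β → ℝ) : 𝔼 a ∈ s, φ (g a) = 𝔼 b ∈ t, φ b := by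
  classical
  calc 𝔼 a ∈ s, φ (g a) = 𝔼 a ∈ s, ∑ b ∈ t, φ b * if g a = b then 1 else 0 :=
        expect_congr rfl fun a ha => by simp [h.mapsTo a ha]
    _ = ∑ b ∈ t, φ b * proportion s fun a => g a = b := by
        simp only [expect_sum_comm, ← mul_expect, proportion_eq_expect]
    _ = 𝔼 b ∈ t, φ b := by
        rw [sum_congr rfl fun b hb => by rw [h.proportion_fiber b hb], ← sum_mul,
          expect_eq_sum_div_card, div_eq_mul_inv]

theorem proportion_comp {α β : Type*} {g : α → β} {s : Finset α} {t : Finset β}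
    (h : IsEquidistributed g s t) (p : β → Prop) :
    proportion s (fun a => p (g a)) = proportion t p := by
  classical
  simp only [proportion_eq_expect]
  exact h.expect_comp fun b => if p b then 1 else 0

theorem of_card_fiber {α β : Type*} [DecidableEq β] {g : α → β} {s : Finset α} {t : Finset β}
    (hs : s.Nonempty) (hg : ∀ a ∈ s, g a ∈ t) {c : ℕ} (hc : ∀ b ∈ t, #{a ∈ s | g a = b} = c) :
    IsEquidistributed g s t where
  mapsTo := hg
  proportion_fiber b hb := by
    have hcard : #s = #t * c := by
      rw [card_eq_sum_card_fiberwise hg, sum_congr rfl hc, sum_const, smul_eq_mul]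
    have hc0 : (c : ℝ) ≠ 0 := by
      have := hs.card_ne_zero
      rw [hcard] at this
      exact_mod_cast right_ne_zero_of_mul this
    rw [proportion_eq_card_div, hc b hb, hcard, Nat.cast_mul, mul_comm,
      div_mul_cancel_left₀ hc0]

theorem of_surjective {G A : Type*} [Group G] [Fintype G] [AddGroup A] [Fintype A] {g : G → A}
    (hmul : ∀ a b, g (a * b) = g a + g b) (hg : Function.Surjective g) :
    IsEquidistributed g univ univ := by
  classical
  refine of_card_fiber univ_nonempty (fun _ _ => mem_univ _) (c := #{a | g a = 0}) fun b _ => ?_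
  obtain ⟨c, rfl⟩ := hg b
  refine (card_equiv (Equiv.mulLeft c) fun a => ?_).symm
  simp only [mem_filter_univ, Equiv.coe_mulLeft, hmul, add_eq_left]

theorem piFinset {ι : Type*} [Fintype ι] [DecidableEq ι] {α β : ι → Type*}
    {g : ∀ i, α i → β i} {s : ∀ i, Finset (α i)} {t : ∀ i, Finset (β i)}
    (h : ∀ i, IsEquidistributed (g i) (s i) (t i)) :
    IsEquidistributed (fun a i => g i (a i)) (Fintype.piFinset s) (Fintype.piFinset t) where
  mapsTo a ha := Fintype.mem_piFinset.2 fun i =>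
    (h i).mapsTo _ (Fintype.mem_piFinset.1 ha i)
  proportion_fiber b hb := by
    simp only [funext_iff]
    rw [proportion_piFinset s fun i a => g i a = b i, Fintype.card_piFinset, Nat.cast_prod,
      ← prod_inv_distrib]
    exact prod_congr rfl fun i _ => (h i).proportion_fiber _ (Fintype.mem_piFinset.1 hb i)

end IsEquidistributed

theorem proportion_sub_mem {A : Type*} [AddGroup A] [Fintype A] (H : AddSubgroup A) (h : A) :
    proportion univ (fun y => y - h ∈ H) = (Nat.card H : ℝ) / Fintype.card A := by
  classical
  rw [proportion_eq_card_div, card_univ, Nat.card_eq_fintype_card, Fintype.card_subtype]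
  congr 2
  exact card_equiv (Equiv.subRight h) fun y => by
    simp only [mem_filter_univ, Equiv.subRight_apply]

theorem expect_piFinset_prod {ι : Type*} [Fintype ι] [DecidableEq ι] {β : ι → Type*}
    (s : ∀ i, Finset (β i)) (φ : ∀ i, β i → ℝ) :
    𝔼 f ∈ Fintype.piFinset s, ∏ i, φ i (f i) = ∏ i, 𝔼 g ∈ s i, φ i g := by
  simp only [expect_eq_sum_div_card, prod_div_distrib, prod_univ_sum, Fintype.card_piFinset,
    Nat.cast_prod]

theorem expect_piFinset_update {ι : Type*} [Fintype ι] [DecidableEq ι] {β : ι → Type*}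
    {s : ∀ i, Finset (β i)} (hs : (Fintype.piFinset s).Nonempty) (i : ι)
    (t : Finset (β i)) (φ : (∀ i, β i) → ℝ) :
    𝔼 f ∈ Fintype.piFinset (Function.update s i t), φ f =
      𝔼 f ∈ Fintype.piFinset s, 𝔼 g ∈ t, φ (Function.update f i g) := by
  classical
  rcases t.eq_empty_or_nonempty with rfl | ht
  · have : Fintype.piFinset (Function.update s i ∅) = ∅ := by
      simpa [Fintype.piFinset_eq_empty] using ⟨i, Function.update_self i ∅ s⟩
    simp [this]
  rw [← expect_product' (Fintype.piFinset s) t fun f g => φ (Function.update f i g)]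
  refine (IsEquidistributed.of_card_fiber (c := #(s i))
    (g := fun p : (∀ i, β i) × β i => Function.update p.1 i p.2)
    (hs.product ht) ?_ ?_).expect_comp φ |>.symm
  · rintro ⟨f, g⟩ hfg
    rw [mem_product, Fintype.mem_piFinset] at hfg
    refine Fintype.mem_piFinset.2 fun j => ?_
    rcases eq_or_ne j i with rfl | hj
    · simpa using hfg.2
    · simpa [hj] using hfg.1 j
  · intro h hh
    have hh : ∀ j, h j ∈ Function.update s i t j := Fintype.mem_piFinset.1 hh
    symm
    refine card_bij (fun x _ => (Function.update h i x, h i)) (fun x hx => ?_)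
      (fun x _ y _ hxy => ?_) fun ⟨f, g⟩ hfg => ?_
    · rw [mem_filter, mem_product, Fintype.mem_piFinset]
      refine ⟨⟨fun j => ?_, by simpa using hh i⟩, by simp⟩
      rcases eq_or_ne j i with rfl | hj
      · simpa using hx
      · simpa [hj] using hh j
    · simpa using congrFun (congrArg Prod.fst hxy) i
    · simp only [mem_filter, mem_product, Fintype.mem_piFinset] at hfg
      obtain ⟨⟨hf, -⟩, rfl⟩ := hfg
      exact ⟨f i, hf i, by simp⟩

end Averages

/-! ### Polynomials over a finite field -/

section Polynomials

theorem isCoprime_of_monic_irreducible {F : Type*} [Field F] {P Q : F[X]} (hP : P.Monic)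
    (hQ : Q.Monic) (hPi : Irreducible P) (hQi : Irreducible Q) (h : P ≠ Q) : IsCoprime P Q :=
  hPi.coprime_iff_not_dvd.2 fun hd =>
    h (eq_of_monic_of_associated hP hQ (hPi.associated_of_dvd hQi hd))

theorem exists_congr_of_isCoprime {R : Type*} [CommRing R] {M N : R} (h : IsCoprime M N)
    (a b : R) : ∃ c, ∀ g, (M ∣ g - a ∧ N ∣ g - b) ↔ M * N ∣ g - c := by
  obtain ⟨u, v, huv⟩ := h
  have hMc : M ∣ a - (a * (v * N) + b * (u * M)) :=
    ⟨a * u - b * u, by linear_combination (-a) * huv⟩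
  have hNc : N ∣ b - (a * (v * N) + b * (u * M)) :=
    ⟨b * v - a * v, by linear_combination (-b) * huv⟩
  refine ⟨a * (v * N) + b * (u * M), fun g => ⟨fun ⟨h1, h2⟩ => ?_, fun h0 => ⟨?_, ?_⟩⟩⟩
  · refine IsCoprime.mul_dvd ⟨u, v, huv⟩ ?_ ?_
    · simpa using dvd_add h1 hMc
    · simpa using dvd_add h2 hNc
  · simpa using dvd_sub ((dvd_mul_right M N).trans h0) hMc
  · simpa using dvd_sub ((dvd_mul_left N M).trans h0) hNc

theorem mod_eq_mod_iff_dvd_sub {R : Type*} [CommRing R] {M f g : R[X]} (hM : M.Monic) :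
    f %ₘ M = g %ₘ M ↔ M ∣ f - g := by
  rw [← modByMonic_eq_zero_iff_dvd hM, sub_modByMonic, sub_eq_zero]

variable (F : Type*) [Field F] [Fintype F]

/-- The polynomials of degree less than `n`. -/
def lowDeg (n : ℕ) : Finset F[X] :=
  univ.map ⟨fun a : Fin n → F => ((degreeLTEquiv F n).symm a : F[X]),
    Subtype.val_injective.comp (degreeLTEquiv F n).symm.injective⟩

/-- The monic polynomials of degree `d`. -/
def monics (d : ℕ) : Finset F[X] := (lowDeg F d).map (addLeftEmbedding (X ^ d))

variable {F}

/-- The standard representatives of the residue classes modulo the monic polynomial `M`. -/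
def residues (M : F[X]) : Finset F[X] := lowDeg F M.natDegree

theorem mem_lowDeg {n : ℕ} {p : F[X]} : p ∈ lowDeg F n ↔ p.degree < n := by
  simp only [lowDeg, mem_map, mem_univ, true_and, Function.Embedding.coeFn_mk]
  refine ⟨?_, fun h => ⟨degreeLTEquiv F n ⟨p, mem_degreeLT.2 h⟩, by simp⟩⟩
  rintro ⟨a, rfl⟩
  exact mem_degreeLT.1 ((degreeLTEquiv F n).symm a).2

theorem card_lowDeg (n : ℕ) : #(lowDeg F n) = Fintype.card F ^ n := by simp [lowDeg]

theorem mem_monics {d : ℕ} {p : F[X]} : p ∈ monics F d ↔ p.Monic ∧ p.natDegree = d := by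
  simp only [monics, mem_map, mem_lowDeg, addLeftEmbedding_apply]
  constructor
  · rintro ⟨a, ha, rfl⟩
    refine ⟨monic_X_pow_add ha, ?_⟩
    rw [natDegree_add_eq_left_of_degree_lt (by rwa [degree_X_pow]), natDegree_X_pow]
  · rintro ⟨hp, rfl⟩
    refine ⟨p - X ^ p.natDegree, ?_, by ring⟩
    have h := degree_sub_lt_left (p := p) (q := X ^ p.natDegree)
      (by rw [degree_X_pow, degree_eq_natDegree hp.ne_zero]) hp.ne_zero (by simp [hp.leadingCoeff])
    rwa [degree_eq_natDegree hp.ne_zero] at h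

theorem card_monics (d : ℕ) : #(monics F d) = Fintype.card F ^ d := by
  rw [monics, card_map, card_lowDeg]

theorem monics_nonempty (d : ℕ) : (monics F d).Nonempty :=
  ⟨X ^ d, mem_monics.2 ⟨monic_X_pow d, natDegree_X_pow d⟩⟩

theorem card_pos_real (F : Type*) [Field F] [Fintype F] : (0 : ℝ) < Fintype.card F := by
  exact_mod_cast Fintype.card_pos

theorem one_lt_card_real (F : Type*) [Field F] [Fintype F] : (1 : ℝ) < Fintype.card F := by
  exact_mod_cast Fintype.one_lt_card

theorem polyNorm_pos (f : F[X]) : 0 < polyNorm f := pow_pos (card_pos_real F) _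

theorem one_lt_polyNorm {P : F[X]} (hP : Irreducible P) : 1 < polyNorm P :=
  one_lt_pow₀ (one_lt_card_real F) hP.natDegree_pos.ne'

theorem polyNorm_mul {f g : F[X]} (hf : f.Monic) (hg : g.Monic) :
    polyNorm (f * g) = polyNorm f * polyNorm g := by
  rw [polyNorm, hf.natDegree_mul hg, pow_add, polyNorm, polyNorm]

theorem polyNorm_pow (f : F[X]) (k : ℕ) : polyNorm (f ^ k) = polyNorm f ^ k := by
  rw [polyNorm, natDegree_pow, mul_comm, pow_mul, polyNorm]

theorem polyNorm_of_mem_monics {d : ℕ} {f : F[X]} (hf : f ∈ monics F d) :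
    polyNorm f = (Fintype.card F : ℝ) ^ d := by
  rw [polyNorm, (mem_monics.1 hf).2]

theorem mem_residues {M : F[X]} (hM : M.Monic) {p : F[X]} :
    p ∈ residues M ↔ p.degree < M.degree := by
  rw [residues, mem_lowDeg, degree_eq_natDegree hM.ne_zero]

theorem card_residues (M : F[X]) : (#(residues M) : ℝ) = polyNorm M := by
  rw [residues, card_lowDeg, polyNorm, Nat.cast_pow]

theorem mod_mem_residues {M : F[X]} (hM : M.Monic) (f : F[X]) : f %ₘ M ∈ residues M :=
  (mem_residues hM).2 (degree_modByMonic_lt f hM)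

open Classical in
theorem card_lowDeg_filter_dvd_sub {M : F[X]} (hM : M.Monic) (R : F[X]) {n : ℕ}
    (hn : M.natDegree ≤ n) :
    #{f ∈ lowDeg F n | M ∣ f - R} = Fintype.card F ^ (n - M.natDegree) := by
  have hR : (R %ₘ M).degree < n :=
    (degree_modByMonic_lt R hM).trans_le (degree_le_natDegree.trans (by exact_mod_cast hn))
  have hRM : M ∣ R %ₘ M - R := ⟨-(R /ₘ M), by linear_combination modByMonic_add_div R M⟩
  have hmul (h : F[X]) : h ∈ lowDeg F (n - M.natDegree) ↔ (M * h).degree < n := by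
    rcases eq_or_ne h 0 with rfl | h0
    · simp [mem_lowDeg]
    · rw [mem_lowDeg, degree_mul, degree_eq_natDegree hM.ne_zero, degree_eq_natDegree h0]
      norm_cast
      omega
  rw [← card_lowDeg (F := F)]
  refine (card_bij (fun h _ => M * h + R %ₘ M) (fun h hh => ?_) (fun a _ b _ hab => ?_)
    fun f hf => ?_).symm
  · rw [mem_filter, mem_lowDeg, add_sub_assoc]
    exact ⟨(degree_add_le _ _).trans_lt (max_lt ((hmul h).1 hh) hR),
      dvd_add (dvd_mul_right M h) hRM⟩
  · exact mul_left_cancel₀ hM.ne_zero (add_right_cancel hab)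
  · rw [mem_filter, mem_lowDeg] at hf
    obtain ⟨h, hh⟩ : M ∣ f - R %ₘ M := by simpa using dvd_sub hf.2 hRM
    refine ⟨h, (hmul h).2 ?_, by linear_combination -hh⟩
    rw [← hh]
    exact (degree_sub_le _ _).trans_lt (max_lt hf.1 hR)

theorem proportion_lowDeg_dvd_sub {M : F[X]} (hM : M.Monic) (R : F[X]) {n : ℕ}
    (hn : M.natDegree ≤ n) : proportion (lowDeg F n) (fun f => M ∣ f - R) = (polyNorm M)⁻¹ := by
  classical
  have hq := card_pos_real F
  rw [proportion_eq_card_div, card_lowDeg_filter_dvd_sub hM R hn, card_lowDeg, Nat.cast_pow,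
    Nat.cast_pow, pow_sub₀ _ hq.ne' hn, polyNorm, mul_div_cancel_left₀ _ (by positivity)]

theorem proportion_monics_dvd_sub {M : F[X]} (hM : M.Monic) (R : F[X]) {d : ℕ}
    (hd : M.natDegree ≤ d) : proportion (monics F d) (fun f => M ∣ f - R) = (polyNorm M)⁻¹ := by
  classical
  have hshift (f : F[X]) : X ^ d + f - R = f - (R - X ^ d) := by ring
  rw [← proportion_lowDeg_dvd_sub hM (R - X ^ d) hd]
  simp only [proportion_eq_expect, expect_eq_sum_div_card, monics, sum_map, card_map,
    addLeftEmbedding_apply, hshift]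

theorem mod_eq_iff_dvd_sub {M R : F[X]} (hM : M.Monic) (hR : R ∈ residues M) (f : F[X]) :
    f %ₘ M = R ↔ M ∣ f - R := by
  rw [← mod_eq_mod_iff_dvd_sub hM, (modByMonic_eq_self_iff hM).2 ((mem_residues hM).1 hR)]

theorem isEquidistributed_lowDeg_mod {M : F[X]} (hM : M.Monic) {n : ℕ} (hn : M.natDegree ≤ n) :
    IsEquidistributed (· %ₘ M) (lowDeg F n) (residues M) where
  mapsTo f _ := mod_mem_residues hM f
  proportion_fiber R hR := by
    rw [card_residues, ← proportion_lowDeg_dvd_sub hM R hn]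
    exact proportion_congr fun f _ => mod_eq_iff_dvd_sub hM hR f

theorem proportion_monics_dvd_sub_le {M : F[X]} (hM : M.Monic) (R : F[X]) {d : ℕ}
    (hd : d ≤ M.natDegree) : proportion (monics F d) (fun f => M ∣ f - R) ≤
      ((Fintype.card F : ℝ) ^ d)⁻¹ := by
  classical
  rw [proportion_eq_card_div, card_monics, Nat.cast_pow, div_eq_mul_inv]
  refine mul_le_of_le_one_left (by positivity) ?_
  rw [Nat.cast_le_one, card_le_one]
  intro a ha b hb
  rw [mem_filter, mem_monics] at ha hb
  have hdvd : M ∣ a - b := by simpa using dvd_sub ha.2 hb.2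
  have hdeg : (a - b).degree < M.degree := by
    refine (degree_sub_lt_left ?_ ha.1.1.ne_zero ?_).trans_le ?_
    · rw [degree_eq_natDegree ha.1.1.ne_zero, degree_eq_natDegree hb.1.1.ne_zero, ha.1.2, hb.1.2]
    · rw [ha.1.1.leadingCoeff, hb.1.1.leadingCoeff]
    · rw [degree_eq_natDegree ha.1.1.ne_zero, degree_eq_natDegree hM.ne_zero, ha.1.2]
      exact_mod_cast hd
  exact sub_eq_zero.1 (eq_zero_of_dvd_of_degree_lt hdvd hdeg)

theorem proportion_monics_dvd_eq_zero {M : F[X]} {d : ℕ} (hd : d < M.natDegree) :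
    proportion (monics F d) (M ∣ ·) = 0 :=
  proportion_eq_zero fun f hf hdvd => by
    have := natDegree_le_of_dvd hdvd (mem_monics.1 hf).1.ne_zero
    have := (mem_monics.1 hf).2
    omega

theorem proportion_monics_dvd_le {M : F[X]} (hM : M.Monic) (d : ℕ) :
    proportion (monics F d) (M ∣ ·) ≤ (polyNorm M)⁻¹ := by
  rcases le_or_gt M.natDegree d with h | h
  · simpa using (proportion_monics_dvd_sub hM 0 h).le
  · rw [proportion_monics_dvd_eq_zero h]
    exact (inv_pos.2 (polyNorm_pos M)).le

end Polynomials

/-! ### The sieve in one variable -/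

section OneVariable

theorem pairwise_isCoprime_of_monic_irreducible {F : Type*} [Field F] {T : Finset F[X]}
    (hT : ∀ P ∈ T, P.Monic ∧ Irreducible P) : (T : Set F[X]).Pairwise IsCoprime :=
  fun P hP Q hQ => isCoprime_of_monic_irreducible (hT P hP).1 (hT Q hQ).1 (hT P hP).2 (hT Q hQ).2

open Classical in
/-- The modulus `μ` for which, `P` being prime, `P ^ 2 ∣ g * h` if and only if `P ^ 2 ∣ h` or
`μ ∣ g`. -/
def sieveModulus {F : Type*} [Field F] (h P : F[X]) : F[X] := if P ∣ h then P else P ^ 2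

theorem sieveModulus_of_dvd {F : Type*} [Field F] {h P : F[X]} (hd : P ∣ h) :
    sieveModulus h P = P := if_pos hd

theorem sieveModulus_of_not_dvd {F : Type*} [Field F] {h P : F[X]} (hd : ¬ P ∣ h) :
    sieveModulus h P = P ^ 2 := if_neg hd

theorem sq_dvd_mul_iff {F : Type*} [Field F] {h P : F[X]} (hP : Irreducible P) (g : F[X]) :
    P ^ 2 ∣ g * h ↔ P ^ 2 ∣ h ∨ sieveModulus h P ∣ g := by
  by_cases hd : P ∣ h
  · rw [sieveModulus_of_dvd hd]
    refine ⟨fun hgh => ?_, ?_⟩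
    · by_contra! hn
      exact hn.1 (hP.prime.pow_dvd_of_dvd_mul_left 2 hn.2 hgh)
    · rintro (hh | hg)
      · exact hh.mul_left g
      · simpa only [sq] using mul_dvd_mul hg hd
  · rw [sieveModulus_of_not_dvd hd]
    refine ⟨fun hgh => Or.inr (hP.prime.pow_dvd_of_dvd_mul_right 2 hd hgh), ?_⟩
    rintro (hh | hg)
    · exact absurd ((dvd_pow_self P two_ne_zero).trans hh) hd
    · exact hg.mul_right h

theorem dvd_sieveModulus {F : Type*} [Field F] (h P : F[X]) : P ∣ sieveModulus h P := by
  by_cases hd : P ∣ h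
  · rw [sieveModulus_of_dvd hd]
  · rw [sieveModulus_of_not_dvd hd]
    exact dvd_pow_self P two_ne_zero

theorem monic_sieveModulus {F : Type*} [Field F] {P : F[X]} (h : F[X]) (hP : P.Monic) :
    (sieveModulus h P).Monic := by
  by_cases hd : P ∣ h
  · rwa [sieveModulus_of_dvd hd]
  · rw [sieveModulus_of_not_dvd hd]
    exact hP.pow 2

theorem isCoprime_sieveModulus_right {F : Type*} [Field F] {M P : F[X]} (h : F[X])
    (hMP : IsCoprime M P) : IsCoprime M (sieveModulus h P) := by
  by_cases hd : P ∣ h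
  · rwa [sieveModulus_of_dvd hd]
  · rw [sieveModulus_of_not_dvd hd]
    exact hMP.pow_right

open Classical in
/-- The product of the primes in `S` that divide `h` and the product of those that do not. -/
def splitProd {F : Type*} [Field F] (h : F[X]) (S : Finset F[X]) : F[X] × F[X] :=
  (∏ P ∈ S with P ∣ h, P, ∏ P ∈ S with ¬ P ∣ h, P)

open Classical in
theorem prod_sieveModulus {F : Type*} [Field F] (h : F[X]) (S : Finset F[X]) :
    ∏ P ∈ S, sieveModulus h P = (splitProd h S).1 * (splitProd h S).2 ^ 2 := by
  simp only [sieveModulus, prod_ite, prod_pow, splitProd]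

theorem splitProd_injOn {F : Type*} [Field F] {T : Finset F[X]}
    (hT : ∀ P ∈ T, P.Monic ∧ Irreducible P) (h : F[X]) :
    Set.InjOn (splitProd h) (T.powerset : Set (Finset F[X])) := by
  have hmem (S : Finset F[X]) (hS : S ⊆ T) (P : F[X]) :
      P ∈ S ↔ P ∈ T ∧ P ∣ (splitProd h S).1 * (splitProd h S).2 := by
    rw [splitProd, prod_filter_mul_prod_filter_not]
    refine ⟨fun hP => ⟨hS hP, dvd_prod_of_mem (fun P => P) hP⟩, fun ⟨hPT, hd⟩ => ?_⟩
    obtain ⟨Q, hQ, hPQ⟩ := ((hT P hPT).2.prime.dvd_finsetProd_iff _).1 hd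
    rwa [eq_of_monic_of_associated (hT P hPT).1 (hT Q (hS hQ)).1
      ((hT P hPT).2.associated_of_dvd (hT Q (hS hQ)).2 hPQ)]
  intro S hS S' hS' heq
  refine Finset.ext fun P => ?_
  rw [hmem S (mem_powerset.1 hS), hmem S' (mem_powerset.1 hS'), heq]

variable {F : Type*} [Field F] [Fintype F]

/-- The inverse square root of the cardinality of `F`. -/
def invSqrt (F : Type*) [Fintype F] : ℝ := (√(Fintype.card F : ℝ))⁻¹

theorem invSqrt_pos (F : Type*) [Field F] [Fintype F] : 0 < invSqrt F :=
  inv_pos.2 (Real.sqrt_pos.2 (card_pos_real F))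

theorem invSqrt_lt_one (F : Type*) [Field F] [Fintype F] : invSqrt F < 1 :=
  inv_lt_one_of_one_lt₀ (by simpa using Real.sqrt_lt_sqrt zero_le_one (one_lt_card_real F))

theorem invSqrt_sq (F : Type*) [Field F] [Fintype F] :
    invSqrt F ^ 2 = (Fintype.card F : ℝ)⁻¹ := by
  rw [invSqrt, inv_pow, Real.sq_sqrt (card_pos_real F).le]

variable (F) in
open Classical in
/-- The monic polynomials of degree at most `n`. -/
def monicsUpTo (n : ℕ) : Finset F[X] := (range (n + 1)).biUnion (monics F)

theorem mem_monicsUpTo {n : ℕ} {f : F[X]} : f ∈ monicsUpTo F n ↔ f.Monic ∧ f.natDegree ≤ n := by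
  simp only [monicsUpTo, mem_biUnion, mem_range, mem_monics, Nat.lt_succ_iff]
  exact ⟨fun ⟨n, hn, hf, hfn⟩ => ⟨hf, hfn.trans_le hn⟩, fun ⟨hf, hfn⟩ => ⟨_, hfn, hf, rfl⟩⟩

theorem sum_monicsUpTo {M : Type*} [AddCommMonoid M] (φ : F[X] → M) (n : ℕ) :
    ∑ f ∈ monicsUpTo F n, φ f = ∑ i ∈ range (n + 1), ∑ f ∈ monics F i, φ f := by
  classical
  rw [monicsUpTo, sum_biUnion]
  intro a _ b _ hab
  exact disjoint_left.2 fun f ha hb => hab ((mem_monics.1 ha).2.symm.trans (mem_monics.1 hb).2)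

theorem card_monicsUpTo_le (n : ℕ) : #(monicsUpTo F n) ≤ Fintype.card F ^ (n + 1) := by
  rw [card_eq_sum_ones, sum_monicsUpTo]
  simp only [← card_eq_sum_ones, card_monics]
  exact (Nat.geomSum_lt Fintype.one_lt_card fun k hk => mem_range.1 hk).le

open Classical in
/-- The monic divisors of `h`. -/
def monicDivisors (h : F[X]) : Finset F[X] := {D ∈ monicsUpTo F h.natDegree | D ∣ h}

theorem mem_monicDivisors {h : F[X]} (h0 : h ≠ 0) {D : F[X]} :
    D ∈ monicDivisors h ↔ D.Monic ∧ D ∣ h := by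
  simp only [monicDivisors, mem_filter, mem_monicsUpTo]
  exact ⟨fun ⟨⟨hD, _⟩, hDh⟩ => ⟨hD, hDh⟩, fun ⟨hD, hDh⟩ => ⟨⟨hD, natDegree_le_of_dvd hDh h0⟩, hDh⟩⟩

/-- The sum of `|D| ^ (-1/2)` over the monic divisors `D` of `h`. -/
def divisorSum (h : F[X]) : ℝ := ∑ D ∈ monicDivisors h, invSqrt F ^ D.natDegree

theorem divisorSum_nonneg (h : F[X]) : 0 ≤ divisorSum h :=
  sum_nonneg fun _ _ => pow_nonneg (invSqrt_pos F).le _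

theorem one_le_divisorSum {h : F[X]} (h0 : h ≠ 0) : 1 ≤ divisorSum h := by
  have h1 : (1 : F[X]) ∈ monicDivisors h := (mem_monicDivisors h0).2 ⟨monic_one, one_dvd h⟩
  calc (1 : ℝ) = invSqrt F ^ (1 : F[X]).natDegree := by rw [natDegree_one, pow_zero]
    _ ≤ divisorSum h := single_le_sum (f := fun D : F[X] => invSqrt F ^ D.natDegree)
        (fun _ _ => pow_nonneg (invSqrt_pos F).le _) h1

theorem divisorSum_one : divisorSum (1 : F[X]) = 1 := by
  have : monicDivisors (1 : F[X]) = {1} := by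
    refine Finset.ext fun D => ?_
    rw [mem_monicDivisors one_ne_zero, mem_singleton]
    refine ⟨fun h => h.1.eq_one_of_isUnit (isUnit_of_dvd_one h.2), ?_⟩
    rintro rfl
    exact ⟨monic_one, dvd_rfl⟩
  simp [divisorSum, this]

open Classical in
theorem monicDivisors_mul_subset {a b : F[X]} (ha : a.Monic) (hb : b.Monic) :
    monicDivisors (a * b) ⊆ (monicDivisors a ×ˢ monicDivisors b).image fun p => p.1 * p.2 := by
  intro D hD
  obtain ⟨hDm, hD⟩ := (mem_monicDivisors (ha.mul hb).ne_zero).1 hD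
  obtain ⟨u, v, hu, hv, huv⟩ := exists_dvd_and_dvd_of_dvd_mul hD
  have hu0 : u ≠ 0 := ne_zero_of_dvd_ne_zero ha.ne_zero hu
  have hv0 : v ≠ 0 := ne_zero_of_dvd_ne_zero hb.ne_zero hv
  refine mem_image.2 ⟨(normalize u, normalize v), ?_, ?_⟩
  · rw [mem_product, mem_monicDivisors ha.ne_zero, mem_monicDivisors hb.ne_zero]
    exact ⟨⟨monic_normalize hu0, by simpa using hu⟩, ⟨monic_normalize hv0, by simpa using hv⟩⟩
  · rw [← normalize_mul, ← huv, hDm.normalize_eq_self]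

theorem divisorSum_mul_le {a b : F[X]} (ha : a.Monic) (hb : b.Monic) :
    divisorSum (a * b) ≤ divisorSum a * divisorSum b := by
  classical
  have hpos : ∀ n, 0 ≤ invSqrt F ^ n := fun n => pow_nonneg (invSqrt_pos F).le n
  calc divisorSum (a * b)
      ≤ ∑ D ∈ (monicDivisors a ×ˢ monicDivisors b).image fun p => p.1 * p.2,
          invSqrt F ^ D.natDegree :=
        sum_le_sum_of_subset_of_nonneg (monicDivisors_mul_subset ha hb) fun _ _ _ => hpos _
    _ ≤ ∑ p ∈ monicDivisors a ×ˢ monicDivisors b, invSqrt F ^ (p.1 * p.2).natDegree :=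
        sum_image_le_of_nonneg fun _ _ => hpos _
    _ = divisorSum a * divisorSum b := by
        rw [divisorSum, divisorSum, sum_mul_sum, ← sum_product']
        refine sum_congr rfl fun p hp => ?_
        rw [mem_product, mem_monicDivisors ha.ne_zero, mem_monicDivisors hb.ne_zero] at hp
        rw [hp.1.1.natDegree_mul hp.2.1, pow_add]

theorem divisorSum_prod_le {ι : Type*} (s : Finset ι) {f : ι → F[X]}
    (hf : ∀ i ∈ s, (f i).Monic) : divisorSum (∏ i ∈ s, f i) ≤ ∏ i ∈ s, divisorSum (f i) :=
  le_prod_of_submultiplicative_on_pred_of_nonneg divisorSum Monic divisorSum_nonneg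
    divisorSum_one.le (fun _ _ => divisorSum_mul_le) (fun _ _ ha hb => ha.mul hb) s f hf

open scoped BigOperators in
theorem expect_divisorSum_le (d : ℕ) :
    𝔼 f ∈ monics F d, divisorSum f ≤ (1 - invSqrt F)⁻¹ := by
  classical
  have hs := (invSqrt_pos F).le
  have hexpand (f : F[X]) (hf : f ∈ monics F d) : divisorSum f =
      ∑ D ∈ monicsUpTo F d, invSqrt F ^ D.natDegree * if D ∣ f then 1 else 0 := by
    simp only [divisorSum, monicDivisors, (mem_monics.1 hf).2, sum_filter, mul_ite, mul_one,
      mul_zero]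
  calc 𝔼 f ∈ monics F d, divisorSum f
      = ∑ D ∈ monicsUpTo F d, invSqrt F ^ D.natDegree * proportion (monics F d) (D ∣ ·) := by
        simp only [expect_congr rfl hexpand, expect_sum_comm, ← mul_expect, proportion_eq_expect]
    _ ≤ ∑ D ∈ monicsUpTo F d, invSqrt F ^ D.natDegree * (polyNorm D)⁻¹ := by
        gcongr with D hD
        exact proportion_monics_dvd_le (mem_monicsUpTo.1 hD).1 d
    _ = ∑ i ∈ range (d + 1), invSqrt F ^ i := by
        rw [sum_monicsUpTo]
        refine sum_congr rfl fun i _ => ?_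
        have := card_pos_real F
        rw [sum_congr rfl fun D hD => by rw [polyNorm_of_mem_monics hD, (mem_monics.1 hD).2],
          sum_const, card_monics, nsmul_eq_mul, Nat.cast_pow]
        field_simp
    _ ≤ (1 - invSqrt F)⁻¹ := by
        rw [← tsum_geometric_of_lt_one hs (invSqrt_lt_one F)]
        exact (summable_geometric_of_lt_one hs (invSqrt_lt_one F)).sum_le_tsum _
          fun _ _ => by positivity

theorem abs_proportion_dvd_sub_succ_sub_le {M D : F[X]} (hM : M.Monic) (hD : D.Monic)
    (hMD : IsCoprime M D) (R : F[X]) (d : ℕ) :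
    |proportion (monics F (d + 1)) (fun g => M ∣ g - R ∧ D ∣ g) -
        proportion (monics F d) fun g => M ∣ g - R ∧ D ∣ g| ≤
      if D.natDegree ≤ d + 1 then ((Fintype.card F : ℝ) ^ d)⁻¹ else 0 := by
  split_ifs with h
  · obtain ⟨c, hc⟩ := exists_congr_of_isCoprime hMD R 0
    simp only [sub_zero] at hc
    simp only [hc]
    rcases le_or_gt (M * D).natDegree d with hle | hlt
    · rw [proportion_monics_dvd_sub (hM.mul hD) c hle,
        proportion_monics_dvd_sub (hM.mul hD) c (hle.trans d.le_succ), sub_self, abs_zero]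
      positivity
    · refine abs_sub_le_of_nonneg_of_le proportion_nonneg ?_ proportion_nonneg
        (proportion_monics_dvd_sub_le (hM.mul hD) c hlt.le)
      refine (proportion_monics_dvd_sub_le (hM.mul hD) c hlt).trans ?_
      gcongr
      · exact (one_lt_card_real F).le
      · exact d.le_succ
  · have hzero (e : ℕ) (he : e < D.natDegree) :
        proportion (monics F e) (fun g => M ∣ g - R ∧ D ∣ g) = 0 :=
      ((proportion_mono fun _ _ => And.right).trans_eq
        (proportion_monics_dvd_eq_zero he)).antisymm proportion_nonneg
    rw [hzero _ (by omega), hzero _ (by omega), sub_self, abs_zero]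

/-- The finite sets of primes in `T` for which the product of the sieve moduli has degree at
most `N`. -/
def sieveSupports (T : Finset F[X]) (h : F[X]) (N : ℕ) : Finset (Finset F[X]) :=
  {S ∈ T.powerset | (∏ P ∈ S, sieveModulus h P).natDegree ≤ N}

theorem abs_proportion_sieve_succ_sub_le {h M : F[X]} (hM : M.Monic) {T : Finset F[X]}
    (hT : ∀ P ∈ T, P.Monic ∧ Irreducible P) (hMT : ∀ P ∈ T, IsCoprime M P) (R : F[X]) (d : ℕ) :
    |proportion (monics F (d + 1)) (fun g => M ∣ g - R ∧ ∀ P ∈ T, ¬ sieveModulus h P ∣ g) -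
        proportion (monics F d) fun g => M ∣ g - R ∧ ∀ P ∈ T, ¬ sieveModulus h P ∣ g| ≤
      #(sieveSupports T h (d + 1)) * ((Fintype.card F : ℝ) ^ d)⁻¹ := by
  have hμ : (T : Set F[X]).Pairwise (Function.onFun IsCoprime (sieveModulus h)) :=
    fun P hP Q hQ hPQ => isCoprime_sieveModulus_right h
      (isCoprime_sieveModulus_right h
        (pairwise_isCoprime_of_monic_irreducible hT hP hQ hPQ).symm).symm
  rw [proportion_forall_not_dvd _ _ hμ, proportion_forall_not_dvd _ _ hμ, ← sum_sub_distrib]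
  refine (abs_sum_le_sum_abs _ _).trans ?_
  rw [sieveSupports, card_filter, Nat.cast_sum, sum_mul]
  refine sum_le_sum fun S hS => ?_
  have hST := mem_powerset.1 hS
  rw [← mul_sub, abs_mul, abs_pow, abs_neg, abs_one, one_pow, one_mul]
  refine (abs_proportion_dvd_sub_succ_sub_le hM
    (monic_prod_of_monic _ _ fun P hP => monic_sieveModulus h (hT P (hST hP)).1)
    (IsCoprime.prod_right fun P hP => isCoprime_sieveModulus_right h (hMT P (hST hP))) R d).trans_eq
    ?_
  split_ifs <;> simp

theorem card_sieveSupports_le_card {h : F[X]} (h0 : h ≠ 0) {T : Finset F[X]}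
    (hT : ∀ P ∈ T, P.Monic ∧ Irreducible P) (N : ℕ) :
    #(sieveSupports T h N) ≤ #(((monicDivisors h).filter fun E => E.natDegree ≤ N).sigma fun E =>
      monicsUpTo F ((N - E.natDegree) / 2)) := by
  classical
  refine card_le_card_of_injOn (fun S => ⟨(splitProd h S).1, (splitProd h S).2⟩) ?_ ?_
  · intro S hS
    obtain ⟨hST, hdeg⟩ := mem_filter.1 hS
    rw [mem_powerset] at hST
    have hS' : ∀ P ∈ S, P.Monic ∧ Irreducible P := fun P hP => hT P (hST hP)
    have hm1 : (splitProd h S).1.Monic :=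
      monic_prod_of_monic _ _ fun P hP => (hS' P (mem_filter.1 hP).1).1
    have hm2 : (splitProd h S).2.Monic :=
      monic_prod_of_monic _ _ fun P hP => (hS' P (mem_filter.1 hP).1).1
    have hdvd : (splitProd h S).1 ∣ h := by
      refine prod_dvd_of_coprime ?_ fun P hP => (mem_filter.1 hP).2
      exact (pairwise_isCoprime_of_monic_irreducible hS').mono (by exact_mod_cast filter_subset _ _)
    rw [prod_sieveModulus, hm1.natDegree_mul (hm2.pow 2), hm2.natDegree_pow] at hdeg
    simp only [mem_coe, mem_sigma, mem_filter, mem_monicDivisors h0, mem_monicsUpTo]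
    exact ⟨⟨⟨hm1, hdvd⟩, by omega⟩, hm2, by omega⟩
  · intro S hS S' hS' heq
    simp only [Sigma.mk.injEq, heq_eq_eq] at heq
    exact splitProd_injOn hT h (mem_filter.1 hS).1 (mem_filter.1 hS').1 (Prod.ext heq.1 heq.2)

theorem card_sieveSupports_le {h : F[X]} (h0 : h ≠ 0) {T : Finset F[X]}
    (hT : ∀ P ∈ T, P.Monic ∧ Irreducible P) (N : ℕ) :
    (#(sieveSupports T h N) : ℝ) ≤ Fintype.card F * (invSqrt F ^ N)⁻¹ * divisorSum h := by
  classical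
  have hs := invSqrt_pos F
  have hcofactor (n : ℕ) : (#(monicsUpTo F (n / 2)) : ℝ) ≤ Fintype.card F * (invSqrt F ^ n)⁻¹ :=
    calc (#(monicsUpTo F (n / 2)) : ℝ) ≤ (Fintype.card F : ℝ) ^ (n / 2 + 1) := by
          exact_mod_cast card_monicsUpTo_le (F := F) (n / 2)
      _ = Fintype.card F * (invSqrt F ^ (2 * (n / 2)))⁻¹ := by
          rw [pow_mul, invSqrt_sq, inv_pow, inv_inv, pow_succ, mul_comm]
      _ ≤ Fintype.card F * (invSqrt F ^ n)⁻¹ := by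
          gcongr _ * ?_
          exact inv_anti₀ (by positivity)
            (pow_le_pow_of_le_one hs.le (invSqrt_lt_one F).le (Nat.mul_div_le _ _))
  calc (#(sieveSupports T h N) : ℝ)
      ≤ ∑ E ∈ monicDivisors h with E.natDegree ≤ N,
          (#(monicsUpTo F ((N - E.natDegree) / 2)) : ℝ) := by
        rw [← Nat.cast_sum, ← card_sigma]
        exact_mod_cast card_sieveSupports_le_card h0 hT N
    _ ≤ ∑ E ∈ monicDivisors h with E.natDegree ≤ N,
          Fintype.card F * (invSqrt F ^ N)⁻¹ * invSqrt F ^ E.natDegree := by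
        refine sum_le_sum fun E hE => (hcofactor _).trans_eq ?_
        rw [pow_sub₀ _ hs.ne' (mem_filter.1 hE).2, mul_inv, inv_inv, mul_assoc]
    _ ≤ Fintype.card F * (invSqrt F ^ N)⁻¹ * divisorSum h := by
        rw [← mul_sum, divisorSum]
        gcongr
        exact filter_subset _ _

theorem abs_proportion_periodic_sieve_succ_sub_le {h M : F[X]} (h0 : h ≠ 0) (hM : M.Monic)
    {T : Finset F[X]} (hT : ∀ P ∈ T, P.Monic ∧ Irreducible P) (hMT : ∀ P ∈ T, IsCoprime M P)
    {E : F[X] → Prop} (hE : ∀ g R, M ∣ g - R → (E g ↔ E R)) (d : ℕ) :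
    |proportion (monics F (d + 1)) (fun g => E g ∧ ∀ P ∈ T, ¬ sieveModulus h P ∣ g) -
        proportion (monics F d) fun g => E g ∧ ∀ P ∈ T, ¬ sieveModulus h P ∣ g| ≤
      polyNorm M * (invSqrt F ^ 3)⁻¹ * invSqrt F ^ d * divisorSum h := by
  classical
  have hs := invSqrt_pos F
  have hsplit (e : ℕ) : proportion (monics F e) (fun g => E g ∧ ∀ P ∈ T, ¬ sieveModulus h P ∣ g) =
      ∑ R ∈ residues M with E R,
        proportion (monics F e) fun g => M ∣ g - R ∧ ∀ P ∈ T, ¬ sieveModulus h P ∣ g := by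
    rw [proportion_eq_sum_fiber fun g _ => mod_mem_residues hM g, sum_filter]
    refine sum_congr rfl fun R hR => ?_
    simp only [mod_eq_iff_dvd_sub hM hR]
    split_ifs with hER
    · exact proportion_congr fun g _ => and_congr_right fun hg => and_iff_right ((hE g R hg).2 hER)
    · exact proportion_eq_zero fun g _ hg => hER ((hE g R hg.1).1 hg.2.1)
  rw [hsplit, hsplit, ← sum_sub_distrib]
  refine (abs_sum_le_sum_abs _ _).trans ?_
  calc ∑ R ∈ residues M with E R, _
      ≤ ∑ R ∈ residues M with E R, (invSqrt F ^ 3)⁻¹ * invSqrt F ^ d * divisorSum h := by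
        refine sum_le_sum fun R _ => (abs_proportion_sieve_succ_sub_le hM hT hMT R d).trans ?_
        refine (mul_le_mul_of_nonneg_right (card_sieveSupports_le h0 hT (d + 1))
          (by positivity)).trans_eq ?_
        have hcard : (Fintype.card F : ℝ) = (invSqrt F ^ 2)⁻¹ := by rw [invSqrt_sq, inv_inv]
        rw [hcard, inv_pow, inv_inv, ← pow_mul]
        field_simp
        ring
    _ ≤ polyNorm M * ((invSqrt F ^ 3)⁻¹ * invSqrt F ^ d * divisorSum h) := by
        rw [sum_const, nsmul_eq_mul, ← card_residues]
        have := divisorSum_nonneg h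
        gcongr
        exact filter_subset _ _
    _ = _ := by ring

end OneVariable

/-! ### The sieve for tuples -/

section TupleSieve

variable {F : Type*} [Field F] {ι : Type*} [Fintype ι]

/-- The local condition at the prime `P`: the entries of the tuple `f` have a product that is
squarefree at `P` and, if `P` is the prime of a point `x` of `F`, values at `x` that satisfy the
prescribed condition `A x`. -/
def LocalCond (A : F → (ι → F) → Prop) (P : F[X]) (f : ι → F[X]) : Prop :=
  ¬ P ^ 2 ∣ ∏ α, f α ∧ ∀ x, P = X - C x → A x fun α => (f α).eval x

/-- The tuple `f` satisfies the local conditions at all primes. -/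
def IsSifted (A : F → (ι → F) → Prop) (f : ι → F[X]) : Prop :=
  ∀ P : F[X], P.Monic → Irreducible P → LocalCond A P f

theorem squarefree_iff_forall_sq_not_dvd {f : F[X]} (h0 : f ≠ 0) :
    Squarefree f ↔ ∀ P : F[X], P.Monic → Irreducible P → ¬ P ^ 2 ∣ f := by
  classical
  rw [squarefree_iff_irreducible_sq_not_dvd_of_ne_zero h0]
  refine ⟨fun h P _ hP => sq P ▸ h P hP, fun h P hP => ?_⟩
  have hassoc := normalize_associated P
  rw [← sq, ← (hassoc.pow_pow (n := 2)).dvd_iff_dvd_left]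
  exact h _ (monic_normalize hP.ne_zero) (hassoc.symm.irreducible hP)

theorem isSifted_iff {A : F → (ι → F) → Prop} {f : ι → F[X]} (hf : ∀ α, f α ≠ 0) :
    IsSifted A f ↔ Squarefree (∏ α, f α) ∧ ∀ x, A x fun α => (f α).eval x := by
  rw [squarefree_iff_forall_sq_not_dvd (prod_ne_zero_iff.2 fun α _ => hf α)]
  refine ⟨fun h => ⟨fun P hP hPi => (h P hP hPi).1, fun x =>
    (h _ (monic_X_sub_C x) (irreducible_X_sub_C x)).2 x rfl⟩, ?_⟩
  exact fun ⟨hsq, hA⟩ P hP hPi => ⟨hsq P hP hPi, fun x _ => hA x⟩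

theorem exists_eq_X_sub_C {P : F[X]} (hP : P.Monic) (h1 : P.natDegree = 1) :
    ∃ x, P = X - C x :=
  ⟨-P.coeff 0, by rw [C_neg, sub_neg_eq_add]; exact hP.eq_X_add_C h1⟩

theorem eval_eq_of_dvd_sub {x : F} {f g : F[X]} (h : (X - C x) ^ 2 ∣ f - g) :
    f.eval x = g.eval x := by
  rw [← sub_eq_zero, ← eval_sub, ← IsRoot.def, ← dvd_iff_isRoot]
  exact (dvd_pow_self _ two_ne_zero).trans h

theorem localCond_congr (A : F → (ι → F) → Prop) {P : F[X]} {f g : ι → F[X]}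
    (h : ∀ α, P ^ 2 ∣ f α - g α) : LocalCond A P f ↔ LocalCond A P g := by
  refine and_congr (not_congr (dvd_iff_dvd_of_dvd_sub ?_)) (forall_congr' fun x =>
    forall_congr' fun hP => ?_)
  · simp only [← Ideal.mem_span_singleton, ← Ideal.Quotient.eq, map_prod] at h ⊢
    exact prod_congr rfl fun α _ => h α
  · subst hP
    simp only [eval_eq_of_dvd_sub (h _)]

theorem localCond_iff_of_two_le (A : F → (ι → F) → Prop) {P : F[X]} (hP : 2 ≤ P.natDegree)
    (f : ι → F[X]) : LocalCond A P f ↔ ¬ P ^ 2 ∣ ∏ α, f α := by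
  refine and_iff_left fun x hx => ?_
  rw [hx, natDegree_X_sub_C] at hP
  omega

variable [Fintype F]

/-- The product of the squares of the monic linear polynomials. -/
def linModulus (F : Type*) [Field F] [Fintype F] : F[X] := ∏ x : F, (X - C x) ^ 2

theorem monic_linModulus : (linModulus F).Monic :=
  monic_prod_of_monic _ _ fun x _ => (monic_X_sub_C x).pow 2

theorem sq_dvd_linModulus (x : F) : (X - C x) ^ 2 ∣ linModulus F :=
  dvd_prod_of_mem (fun x : F => (X - C x) ^ 2) (mem_univ x)

theorem isCoprime_linModulus {P : F[X]} (hP : P.Monic) (hPi : Irreducible P)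
    (h2 : 2 ≤ P.natDegree) : IsCoprime (linModulus F) P := by
  refine IsCoprime.prod_left fun x _ => IsCoprime.pow_left ?_
  refine isCoprime_of_monic_irreducible (monic_X_sub_C x) hP (irreducible_X_sub_C x) hPi ?_
  rintro rfl
  rw [natDegree_X_sub_C] at h2
  omega

variable (F) in
open Classical in
/-- The monic irreducible polynomials of degree between `a` and `b`. -/
def primesIn (a b : ℕ) : Finset F[X] := {P ∈ monicsUpTo F b | Irreducible P ∧ a ≤ P.natDegree}

theorem mem_primesIn {a b : ℕ} {P : F[X]} :
    P ∈ primesIn F a b ↔ P.Monic ∧ Irreducible P ∧ a ≤ P.natDegree ∧ P.natDegree ≤ b := by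
  simp only [primesIn, mem_filter, mem_monicsUpTo]
  tauto

theorem monic_and_irreducible_of_mem_primesIn {a b : ℕ} :
    ∀ P ∈ primesIn F a b, P.Monic ∧ Irreducible P := fun _ hP =>
  ⟨(mem_primesIn.1 hP).1, (mem_primesIn.1 hP).2.1⟩

variable [DecidableEq ι]

theorem isSifted_update_iff (A : F → (ι → F) → Prop) (f : ι → F[X]) (α : ι) {D N : ℕ}
    (hDN : D ≤ N) {g : F[X]} (hg : g ∈ monics F D) :
    IsSifted A (Function.update f α g) ↔
      ((∀ P : F[X], P.Monic → Irreducible P → ¬ P ^ 2 ∣ ∏ β ∈ univ \ {α}, f β) ∧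
        ∀ x, LocalCond A (X - C x) (Function.update f α g)) ∧
      ∀ P ∈ primesIn F 2 N, ¬ sieveModulus (∏ β ∈ univ \ {α}, f β) P ∣ g := by
  have hcond (P : F[X]) (hPi : Irreducible P) (h2 : 2 ≤ P.natDegree) :
      LocalCond A P (Function.update f α g) ↔
        ¬ (P ^ 2 ∣ ∏ β ∈ univ \ {α}, f β ∨ sieveModulus (∏ β ∈ univ \ {α}, f β) P ∣ g) := by
    rw [localCond_iff_of_two_le A h2, prod_update_of_mem (mem_univ α), sq_dvd_mul_iff hPi]
  constructor
  · intro h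
    refine ⟨⟨fun P hP hPi hd => (h P hP hPi).1 ?_, fun x =>
      h _ (monic_X_sub_C x) (irreducible_X_sub_C x)⟩, fun P hP hd => ?_⟩
    · rw [prod_update_of_mem (mem_univ α)]
      exact hd.mul_left g
    · obtain ⟨hPm, hPi, h2, -⟩ := mem_primesIn.1 hP
      exact (hcond P hPi h2).1 (h P hPm hPi) (Or.inr hd)
  · rintro ⟨⟨hsq, hlin⟩, hsieve⟩ P hP hPi
    rcases (Nat.one_le_iff_ne_zero.2 hPi.natDegree_pos.ne').eq_or_lt with h1 | h2
    · obtain ⟨x, rfl⟩ := exists_eq_X_sub_C hP h1.symm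
      exact hlin x
    · refine (hcond P hPi h2).2 (not_or_intro (hsq P hP hPi) fun hd => ?_)
      refine hsieve P (mem_primesIn.2 ⟨hP, hPi, h2, ?_⟩) hd
      obtain ⟨hgm, rfl⟩ := mem_monics.1 hg
      exact (natDegree_le_of_dvd ((dvd_sieveModulus _ P).trans hd) hgm.ne_zero).trans hDN

theorem abs_proportion_isSifted_update_succ_sub_le (A : F → (ι → F) → Prop) {f : ι → F[X]}
    (hf : ∀ β, (f β).Monic) (α : ι) (D : ℕ) :
    |proportion (monics F (D + 1)) (fun g => IsSifted A (Function.update f α g)) -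
        proportion (monics F D) fun g => IsSifted A (Function.update f α g)| ≤
      polyNorm (linModulus F) * (invSqrt F ^ 3)⁻¹ * invSqrt F ^ D * ∏ β, divisorSum (f β) := by
  have hs := invSqrt_pos F
  have hT := monic_and_irreducible_of_mem_primesIn (F := F) (a := 2) (b := D + 1)
  have h0 : ∏ β ∈ univ \ {α}, f β ≠ 0 := prod_ne_zero_iff.2 fun β _ => (hf β).ne_zero
  have hperiodic (g R : F[X]) (hgR : linModulus F ∣ g - R) :
      ((∀ P : F[X], P.Monic → Irreducible P → ¬ P ^ 2 ∣ ∏ β ∈ univ \ {α}, f β) ∧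
        ∀ x, LocalCond A (X - C x) (Function.update f α g)) ↔
      (∀ P : F[X], P.Monic → Irreducible P → ¬ P ^ 2 ∣ ∏ β ∈ univ \ {α}, f β) ∧
        ∀ x, LocalCond A (X - C x) (Function.update f α R) := by
    refine and_congr_right fun _ => forall_congr' fun x => localCond_congr A fun β => ?_
    rcases eq_or_ne β α with rfl | hβ
    · simpa only [Function.update_self] using (sq_dvd_linModulus x).trans hgR
    · simp only [Function.update_of_ne hβ, sub_self, dvd_zero]
  have hprod : divisorSum (∏ β ∈ univ \ {α}, f β) ≤ ∏ β, divisorSum (f β) := by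
    refine (divisorSum_prod_le _ fun β _ => hf β).trans ?_
    rw [← prod_sdiff (subset_univ {α}), prod_singleton]
    exact le_mul_of_one_le_right (prod_nonneg fun β _ => divisorSum_nonneg _)
      (one_le_divisorSum (hf α).ne_zero)
  rw [proportion_congr fun g hg => isSifted_update_iff A f α le_rfl hg,
    proportion_congr fun g hg => isSifted_update_iff A f α D.le_succ hg]
  refine (abs_proportion_periodic_sieve_succ_sub_le h0 monic_linModulus hT (fun P hP =>
    isCoprime_linModulus (hT P hP).1 (hT P hP).2 (mem_primesIn.1 hP).2.2.1) hperiodic D).trans ?_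
  have := polyNorm_pos (linModulus F)
  gcongr

/-- The proportion of sifted tuples among the tuples of monic polynomials of degrees `d`. -/
def sieveDensity (A : F → (ι → F) → Prop) (d : ι → ℕ) : ℝ :=
  proportion (Fintype.piFinset fun α => monics F (d α)) (IsSifted A)

/-- The constant in the bound for the increments of `sieveDensity` for tuples of length `m`. -/
def incrementConst (F : Type*) [Field F] [Fintype F] (m : ℕ) : ℝ :=
  polyNorm (linModulus F) * (invSqrt F ^ 3)⁻¹ * (1 - invSqrt F)⁻¹ ^ m

theorem incrementConst_nonneg (m : ℕ) : 0 ≤ incrementConst F m := by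
  have := invSqrt_pos F
  have := polyNorm_pos (linModulus F)
  have : 0 < 1 - invSqrt F := sub_pos.2 (invSqrt_lt_one F)
  rw [incrementConst]
  positivity

open scoped BigOperators in
theorem sieveDensity_update (A : F → (ι → F) → Prop) (d : ι → ℕ) (α : ι) (D : ℕ) :
    sieveDensity A (Function.update d α D) =
      𝔼 f ∈ Fintype.piFinset fun β => monics F (d β),
        proportion (monics F D) fun g => IsSifted A (Function.update f α g) := by
  classical
  have hupd : (fun β => monics F (Function.update d α D β)) =
      Function.update (fun β => monics F (d β)) α (monics F D) :=
    Function.comp_update (monics F) d α D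
  rw [sieveDensity, hupd]
  simp only [proportion_eq_expect]
  exact expect_piFinset_update (Fintype.piFinset_nonempty.2 fun β => monics_nonempty _) α _ _

open scoped BigOperators in
theorem abs_sieveDensity_succ_sub_le (A : F → (ι → F) → Prop) (d : ι → ℕ) (α : ι) (D : ℕ) :
    |sieveDensity A (Function.update d α (D + 1)) - sieveDensity A (Function.update d α D)| ≤
      incrementConst F (Fintype.card ι) * invSqrt F ^ D := by
  have hs := invSqrt_pos F
  have hN := polyNorm_pos (linModulus F)
  rw [sieveDensity_update, sieveDensity_update, ← expect_sub_distrib]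
  calc |𝔼 f ∈ Fintype.piFinset fun β => monics F (d β), _|
      ≤ 𝔼 f ∈ Fintype.piFinset fun β => monics F (d β),
          polyNorm (linModulus F) * (invSqrt F ^ 3)⁻¹ * invSqrt F ^ D * ∏ β, divisorSum (f β) :=
        (abs_expect_le _ _).trans <| expect_le_expect fun f hf =>
          abs_proportion_isSifted_update_succ_sub_le A
            (fun β => (mem_monics.1 (Fintype.mem_piFinset.1 hf β)).1) α D
    _ = polyNorm (linModulus F) * (invSqrt F ^ 3)⁻¹ * invSqrt F ^ D *
          ∏ β, 𝔼 g ∈ monics F (d β), divisorSum g := by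
        rw [← mul_expect, expect_piFinset_prod]
    _ ≤ polyNorm (linModulus F) * (invSqrt F ^ 3)⁻¹ * invSqrt F ^ D *
          ∏ _β : ι, (1 - invSqrt F)⁻¹ := by
        gcongr with β
        · exact fun β _ => expect_nonneg fun g _ => divisorSum_nonneg g
        · exact expect_divisorSum_le (d β)
    _ = incrementConst F (Fintype.card ι) * invSqrt F ^ D := by
        rw [prod_const, card_univ, incrementConst]
        ring

theorem abs_sieveDensity_update_sub_le (A : F → (ι → F) → Prop) (d : ι → ℕ) (α : ι) {D : ℕ}
    (hD : d α ≤ D) : |sieveDensity A (Function.update d α D) - sieveDensity A d| ≤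
      incrementConst F (Fintype.card ι) * (1 - invSqrt F)⁻¹ * invSqrt F ^ d α := by
  have hincr (k : ℕ) : dist (sieveDensity A (Function.update d α k))
      (sieveDensity A (Function.update d α (k + 1))) ≤
        incrementConst F (Fintype.card ι) * invSqrt F ^ k := by
    rw [dist_comm, Real.dist_eq]
    exact abs_sieveDensity_succ_sub_le A d α k
  calc |sieveDensity A (Function.update d α D) - sieveDensity A d|
      = dist (sieveDensity A (Function.update d α (d α)))
          (sieveDensity A (Function.update d α D)) := by
        rw [Function.update_eq_self, dist_comm, Real.dist_eq]
    _ ≤ ∑ k ∈ Finset.Ico (d α) D, incrementConst F (Fintype.card ι) * invSqrt F ^ k :=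
        dist_le_Ico_sum_of_dist_le (f := fun k => sieveDensity A (Function.update d α k)) hD
          fun {k} _ _ => hincr k
    _ ≤ incrementConst F (Fintype.card ι) * (invSqrt F ^ d α / (1 - invSqrt F)) := by
        rw [← mul_sum]
        exact mul_le_mul_of_nonneg_left (geom_sum_Ico_le_of_lt_one (invSqrt_pos F).le
          (invSqrt_lt_one F)) (incrementConst_nonneg _)
    _ = _ := by ring

theorem abs_sub_le_of_update {X : Type*} {Φ : (ι → X) → ℝ} {d d' : ι → X} {K : ℝ}
    (h : ∀ α e, e α = d α → |Φ (Function.update e α (d' α)) - Φ e| ≤ K) :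
    |Φ d' - Φ d| ≤ Fintype.card ι * K := by
  have hpartial (s : Finset ι) : |Φ (s.piecewise d' d) - Φ d| ≤ #s * K := by
    induction s using Finset.induction_on with
    | empty => simp
    | insert α s hα ih =>
      rw [piecewise_insert, card_insert_of_notMem hα]
      have hstep := h α (s.piecewise d' d) (piecewise_eq_of_notMem s d' d hα)
      push_cast
      linarith [abs_sub_le (Φ (Function.update (s.piecewise d' d) α (d' α)))
        (Φ (s.piecewise d' d)) (Φ d)]
  simpa only [piecewise_univ, card_univ] using hpartial univ

/-- The constant in the bound for the distance of `sieveDensity` from its limit for tuples of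
length `m`. -/
def errorConst (F : Type*) [Field F] [Fintype F] (m : ℕ) : ℝ :=
  m * (incrementConst F m * (1 - invSqrt F)⁻¹)

theorem errorConst_nonneg (m : ℕ) : 0 ≤ errorConst F m :=
  mul_nonneg m.cast_nonneg <| mul_nonneg (incrementConst_nonneg _) <|
    inv_nonneg.2 (sub_nonneg.2 (invSqrt_lt_one F).le)

theorem abs_sieveDensity_sub_le (A : F → (ι → F) → Prop) {d d' : ι → ℕ} (hd : ∀ α, d α ≤ d' α)
    {N : ℕ} (hN : ∀ α, N ≤ d α) : |sieveDensity A d' - sieveDensity A d| ≤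
      errorConst F (Fintype.card ι) * invSqrt F ^ N := by
  have hs := invSqrt_pos F
  have hs1 := sub_pos.2 (invSqrt_lt_one F)
  have hK := incrementConst_nonneg (F := F) (Fintype.card ι)
  rw [errorConst, mul_assoc]
  refine abs_sub_le_of_update fun α e he => ?_
  refine (abs_sieveDensity_update_sub_le A e α (he ▸ hd α)).trans ?_
  exact mul_le_mul_of_nonneg_left (pow_le_pow_of_le_one hs.le (invSqrt_lt_one F).le (he ▸ hN α))
    (by positivity)

end TupleSieve

/-! ### Local densities -/

section LocalDensities

theorem exists_congr_of_pairwise_isCoprime {R κ : Type*} [CommRing R] {s : Finset κ} {μ : κ → R}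
    (hμ : (s : Set κ).Pairwise (Function.onFun IsCoprime μ)) (a : κ → R) :
    ∃ c, ∀ g, (∀ k ∈ s, μ k ∣ g - a k) ↔ ∏ k ∈ s, μ k ∣ g - c := by
  classical
  induction s using Finset.induction_on with
  | empty => exact ⟨0, by simp⟩
  | insert k s hk ih =>
    obtain ⟨c, hc⟩ := ih (hμ.mono (by simp))
    have hk_coprime : IsCoprime (μ k) (∏ j ∈ s, μ j) := IsCoprime.prod_right fun j hj =>
      hμ (mem_insert_self k s) (mem_insert_of_mem hj) fun h => hk (h ▸ hj)
    obtain ⟨c', hc'⟩ := exists_congr_of_isCoprime hk_coprime (a k) c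
    exact ⟨c', fun g => by rw [prod_insert hk, forall_mem_insert, hc, hc']⟩

variable {F : Type*} [Field F] [Fintype F] {ι : Type*} [Fintype ι] [DecidableEq ι]

theorem isEquidistributed_piFinset_mod {κ : Type*} [Fintype κ] [DecidableEq κ] {μ : κ → F[X]}
    (hμ : ∀ k, (μ k).Monic) (hcop : Pairwise (Function.onFun IsCoprime μ)) {d : ι → ℕ}
    (hd : ∀ α, ∑ k, (μ k).natDegree ≤ d α) :
    IsEquidistributed (fun f k α => f α %ₘ μ k) (Fintype.piFinset fun α => monics F (d α))
      (Fintype.piFinset fun k => Fintype.piFinset fun _ : ι => residues (μ k)) where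
  mapsTo f _ := Fintype.mem_piFinset.2 fun k => Fintype.mem_piFinset.2 fun α =>
    mod_mem_residues (hμ k) (f α)
  proportion_fiber b hb := by
    have hM : (∏ k, μ k).Monic := monic_prod_of_monic _ _ fun k _ => hμ k
    choose c hc using fun α =>
      exists_congr_of_pairwise_isCoprime (s := univ) (hcop.set_pairwise _) fun k => b k α
    have hfiber (f : ι → F[X]) : (fun k α => f α %ₘ μ k) = b ↔ ∀ α, ∏ k, μ k ∣ f α - c α := by
      simp only [funext_iff, ← hc, mem_univ, true_imp_iff]
      rw [forall_comm]
      exact forall₂_congr fun α k => mod_eq_iff_dvd_sub (hμ k)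
        (Fintype.mem_piFinset.1 (Fintype.mem_piFinset.1 hb k) α) (f α)
    rw [proportion_congr fun f _ => hfiber f, proportion_piFinset _ fun α g => _ ∣ g - c α,
      prod_congr rfl fun α _ => proportion_monics_dvd_sub hM (c α)
        ((natDegree_prod_of_monic _ _ fun k _ => hμ k).trans_le (hd α))]
    simp only [Fintype.card_piFinset, prod_const, Nat.cast_prod, Nat.cast_pow, card_residues,
      card_univ, inv_pow, polyNorm, prod_pow_eq_pow_sum, ← pow_mul, ← sum_mul,
      natDegree_prod_of_monic _ _ fun k _ => hμ k]

/-- The proportion of tuples of residue classes modulo `P ^ 2` that satisfy the local condition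
at `P`. -/
def localDensity (A : F → (ι → F) → Prop) (P : F[X]) : ℝ :=
  proportion (Fintype.piFinset fun _ => residues (P ^ 2)) (LocalCond A P)

theorem proportion_forall_localCond (A : F → (ι → F) → Prop) {T : Finset F[X]}
    (hT : ∀ P ∈ T, P.Monic ∧ Irreducible P) {d : ι → ℕ}
    (hd : ∀ α, ∑ P ∈ T, (P ^ 2).natDegree ≤ d α) :
    proportion (Fintype.piFinset fun α => monics F (d α)) (fun f => ∀ P ∈ T, LocalCond A P f) =
      ∏ P ∈ T, localDensity A P := by
  classical
  have hmonic (P : T) : (P.1 ^ 2).Monic := (hT P P.2).1.pow 2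
  have hcop : Pairwise (Function.onFun IsCoprime fun P : T => P.1 ^ 2) := fun P Q hPQ =>
    (pairwise_isCoprime_of_monic_irreducible hT P.2 Q.2 (Subtype.coe_injective.ne hPQ)).pow
  have hequi := isEquidistributed_piFinset_mod hmonic hcop (d := d) fun α => by
    rw [sum_coe_sort T fun P => (P ^ 2).natDegree]
    exact hd α
  have hmod (f : ι → F[X]) (P : T) : LocalCond A P f ↔
      LocalCond A P fun α => f α %ₘ P.1 ^ 2 := by
    refine localCond_congr A fun α => ⟨f α /ₘ P.1 ^ 2, ?_⟩
    linear_combination -modByMonic_add_div (f α) (P.1 ^ 2)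
  calc proportion (Fintype.piFinset fun α => monics F (d α)) (fun f => ∀ P ∈ T, LocalCond A P f)
      = proportion (Fintype.piFinset fun α => monics F (d α))
          fun f => ∀ P : T, LocalCond A P fun α => f α %ₘ P.1 ^ 2 :=
        proportion_congr fun f _ => ⟨fun h P => (hmod f P).1 (h P P.2), fun h P hP =>
          (hmod f ⟨P, hP⟩).2 (h ⟨P, hP⟩)⟩
    _ = ∏ P : T, localDensity A P :=
        (hequi.proportion_comp fun b => ∀ P : T, LocalCond A P (b P)).trans
          (proportion_piFinset _ fun P : T => LocalCond A P)
    _ = ∏ P ∈ T, localDensity A P := prod_coe_sort T (localDensity A)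

theorem exists_mulSingle_dvd_of_sq_dvd_prod {R : Type*} [CommMonoidWithZero R]
    [IsCancelMulZero R] {P : R} (hP : Prime P) {f : ι → R} (h : P ^ 2 ∣ ∏ α, f α) :
    ∃ α β, ∀ γ, (Pi.mulSingle α P * Pi.mulSingle β P : ι → R) γ ∣ f γ := by
  obtain ⟨α, -, g, hg⟩ := (hP.dvd_finsetProd_iff f).1 ((dvd_pow_self P two_ne_zero).trans h)
  have hsplit : ∏ γ, f γ = P * ∏ γ, Function.update f α g γ := by
    rw [prod_update_of_mem (mem_univ α), ← mul_assoc, ← hg, sdiff_singleton_eq_erase,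
      mul_prod_erase _ _ (mem_univ α)]
  rw [sq, hsplit, mul_dvd_mul_iff_left hP.ne_zero] at h
  obtain ⟨β, -, hβ⟩ := (hP.dvd_finsetProd_iff _).1 h
  refine ⟨α, β, fun γ => ?_⟩
  rw [Pi.mul_apply]
  have hsingle : (Pi.mulSingle β P : ι → R) γ ∣ Function.update f α g γ := by
    rcases eq_or_ne γ β with rfl | hγ
    · rwa [Pi.mulSingle_eq_same]
    · rw [Pi.mulSingle_eq_of_ne hγ]
      exact one_dvd _
  rcases eq_or_ne γ α with rfl | hγ
  · rw [Function.update_self] at hsingle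
    rw [Pi.mulSingle_eq_same, hg]
    exact mul_dvd_mul_left P hsingle
  · rwa [Pi.mulSingle_eq_of_ne hγ, one_mul, ← Function.update_of_ne hγ g f]

theorem proportion_forall_dvd_le {D : ι → F[X]} (hD : ∀ α, (D α).Monic) (d : ι → ℕ) :
    proportion (Fintype.piFinset fun α => monics F (d α)) (fun f => ∀ α, D α ∣ f α) ≤
      (∏ α, polyNorm (D α))⁻¹ := by
  rw [proportion_piFinset _ fun α g => D α ∣ g, ← prod_inv_distrib]
  exact prod_le_prod (fun α _ => proportion_nonneg) fun α _ =>
    proportion_monics_dvd_le (hD α) (d α)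

theorem proportion_sq_dvd_prod_le {P : F[X]} (hP : P.Monic) (hPi : Irreducible P) (d : ι → ℕ) :
    proportion (Fintype.piFinset fun α => monics F (d α)) (fun f => P ^ 2 ∣ ∏ α, f α) ≤
      Fintype.card ι ^ 2 * (polyNorm P ^ 2)⁻¹ := by
  have hmonic (α γ : ι) : ((Pi.mulSingle α P : ι → F[X]) γ).Monic := by
    rw [Pi.mulSingle_apply]
    split_ifs
    exacts [hP, monic_one]
  have hnorm (α : ι) : ∏ γ, polyNorm ((Pi.mulSingle α P : ι → F[X]) γ) = polyNorm P := by
    rw [prod_eq_single α (fun γ _ hγ => by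
      rw [Pi.mulSingle_eq_of_ne hγ, polyNorm, natDegree_one, pow_zero]) (by simp),
      Pi.mulSingle_eq_same]
  set D : ι × ι → ι → F[X] := fun αβ => Pi.mulSingle αβ.1 P * Pi.mulSingle αβ.2 P
  have hD (αβ : ι × ι) : ∏ γ, polyNorm (D αβ γ) = polyNorm P ^ 2 := by
    calc ∏ γ, polyNorm (D αβ γ)
        = ∏ γ, polyNorm ((Pi.mulSingle αβ.1 P : ι → F[X]) γ) *
            polyNorm ((Pi.mulSingle αβ.2 P : ι → F[X]) γ) :=
          prod_congr rfl fun γ _ => polyNorm_mul (hmonic αβ.1 γ) (hmonic αβ.2 γ)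
      _ = polyNorm P ^ 2 := by rw [prod_mul_distrib, hnorm, hnorm, sq]
  calc proportion (Fintype.piFinset fun α => monics F (d α)) (fun f => P ^ 2 ∣ ∏ α, f α)
      ≤ proportion (Fintype.piFinset fun α => monics F (d α))
          (fun f => ∃ αβ ∈ univ, ∀ γ, D αβ γ ∣ f γ) :=
        proportion_mono fun f _ h => by
          obtain ⟨α, β, hαβ⟩ := exists_mulSingle_dvd_of_sq_dvd_prod hPi.prime h
          exact ⟨(α, β), mem_univ _, hαβ⟩
    _ ≤ ∑ αβ : ι × ι, (∏ γ, polyNorm (D αβ γ))⁻¹ :=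
        (proportion_exists_le _ _).trans <| sum_le_sum fun αβ _ => proportion_forall_dvd_le
          (fun γ => (hmonic αβ.1 γ).mul (hmonic αβ.2 γ)) d
    _ = Fintype.card ι ^ 2 * (polyNorm P ^ 2)⁻¹ := by
        simp only [hD, sum_const, card_univ, Fintype.card_prod, nsmul_eq_mul, Nat.cast_mul,
          sq (Fintype.card ι : ℝ)]

theorem sum_inv_sq_polyNorm_primesIn_le (T N : ℕ) :
    ∑ P ∈ primesIn F (T + 1) N, (polyNorm P ^ 2)⁻¹ ≤ (Fintype.card F : ℝ)⁻¹ ^ T := by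
  classical
  have hq2 : (2 : ℝ) ≤ Fintype.card F := by exact_mod_cast Fintype.one_lt_card (α := F)
  have hinv : (Fintype.card F : ℝ)⁻¹ ≤ 2⁻¹ := inv_anti₀ two_pos hq2
  have hdeg (n : ℕ) : ∑ P ∈ monics F n, (polyNorm P ^ 2)⁻¹ = (Fintype.card F : ℝ)⁻¹ ^ n := by
    rw [sum_congr rfl fun P hP => by rw [polyNorm_of_mem_monics hP], sum_const, card_monics,
      nsmul_eq_mul, Nat.cast_pow, inv_pow]
    field_simp
  have hsub : primesIn F (T + 1) N ⊆ (Finset.Ico (T + 1) (N + 1)).biUnion (monics F) := by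
    intro P hP
    obtain ⟨hPm, -, h1, h2⟩ := mem_primesIn.1 hP
    exact mem_biUnion.2 ⟨P.natDegree, Finset.mem_Ico.2 ⟨h1, by omega⟩, mem_monics.2 ⟨hPm, rfl⟩⟩
  calc ∑ P ∈ primesIn F (T + 1) N, (polyNorm P ^ 2)⁻¹
      ≤ ∑ n ∈ Finset.Ico (T + 1) (N + 1), (Fintype.card F : ℝ)⁻¹ ^ n := by
        refine (sum_le_sum_of_subset_of_nonneg hsub fun P _ _ => by positivity).trans ?_
        rw [sum_biUnion fun a _ b _ hab => disjoint_left.2 fun P ha hb =>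
          hab ((mem_monics.1 ha).2.symm.trans (mem_monics.1 hb).2)]
        exact (sum_congr rfl fun n _ => hdeg n).le
    _ ≤ (Fintype.card F : ℝ)⁻¹ ^ (T + 1) / (1 - (Fintype.card F : ℝ)⁻¹) :=
        geom_sum_Ico_le_of_lt_one (by positivity) (by linarith)
    _ ≤ (Fintype.card F : ℝ)⁻¹ ^ T := by
        rw [div_le_iff₀ (by linarith), pow_succ]
        gcongr
        linarith

omit [DecidableEq ι] in
theorem isSifted_of_forall_localCond {A : F → (ι → F) → Prop} {T : ℕ} (hT : 1 ≤ T)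
    {f : ι → F[X]} (hf : ∀ α, f α ≠ 0) (hlocal : ∀ P ∈ primesIn F 1 T, LocalCond A P f)
    (hsq : ∀ P ∈ primesIn F (T + 1) (∑ α, (f α).natDegree), ¬ P ^ 2 ∣ ∏ α, f α) :
    IsSifted A f := by
  intro P hP hPi
  rcases le_or_gt P.natDegree T with h | h
  · exact hlocal P (mem_primesIn.2 ⟨hP, hPi, hPi.natDegree_pos, h⟩)
  · refine (localCond_iff_of_two_le A (by omega) f).2 fun hd => hsq P ?_ hd
    refine mem_primesIn.2 ⟨hP, hPi, h, ?_⟩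
    rw [← natDegree_prod _ _ fun α _ => hf α]
    exact natDegree_le_of_dvd ((dvd_pow_self P two_ne_zero).trans hd)
      (prod_ne_zero_iff.2 fun α _ => hf α)

theorem abs_sieveDensity_sub_prod_le (A : F → (ι → F) → Prop) {T : ℕ} (hT : 1 ≤ T) {d : ι → ℕ}
    (hd : ∀ α, ∑ P ∈ primesIn F 1 T, (P ^ 2).natDegree ≤ d α) :
    |sieveDensity A d - ∏ P ∈ primesIn F 1 T, localDensity A P| ≤
      Fintype.card ι ^ 2 * (Fintype.card F : ℝ)⁻¹ ^ T := by
  have hbad : ∀ f ∈ Fintype.piFinset fun α => monics F (d α),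
      ¬ (IsSifted A f ↔ ∀ P ∈ primesIn F 1 T, LocalCond A P f) →
        ∃ P ∈ primesIn F (T + 1) (∑ α, d α), P ^ 2 ∣ ∏ α, f α := by
    intro f hf hne
    have hf := fun α => mem_monics.1 (Fintype.mem_piFinset.1 hf α)
    by_contra! hsq
    refine hne ⟨fun h P hP => ?_, fun h => isSifted_of_forall_localCond hT
      (fun α => (hf α).1.ne_zero) h ?_⟩
    · exact h P (monic_and_irreducible_of_mem_primesIn P hP).1
        (monic_and_irreducible_of_mem_primesIn P hP).2
    · rwa [sum_congr rfl fun α _ => (hf α).2]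
  rw [← proportion_forall_localCond A monic_and_irreducible_of_mem_primesIn hd, sieveDensity]
  calc _ ≤ _ := abs_proportion_sub_le
    _ ≤ _ := proportion_mono hbad
    _ ≤ ∑ P ∈ primesIn F (T + 1) (∑ α, d α), Fintype.card ι ^ 2 * (polyNorm P ^ 2)⁻¹ :=
        (proportion_exists_le _ _).trans <| sum_le_sum fun P hP =>
          proportion_sq_dvd_prod_le (mem_primesIn.1 hP).1 (mem_primesIn.1 hP).2.1 d
    _ ≤ Fintype.card ι ^ 2 * (Fintype.card F : ℝ)⁻¹ ^ T := by
        rw [← mul_sum]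
        exact mul_le_mul_of_nonneg_left (sum_inv_sq_polyNorm_primesIn_le T _) (by positivity)

open Filter Topology in
theorem abs_sieveDensity_sub_le_of_tendsto {A : F → (ι → F) → Prop} {c : ℝ}
    (hc : Tendsto (fun T => ∏ P ∈ primesIn F 1 T, localDensity A P) atTop (𝓝 c)) {d : ι → ℕ}
    {N : ℕ} (hN : ∀ α, N ≤ d α) : |sieveDensity A d - c| ≤
      errorConst F (Fintype.card ι) * invSqrt F ^ N := by
  set e : ℕ → ι → ℕ := fun T α => d α + ∑ P ∈ primesIn F 1 T, (P ^ 2).natDegree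
  have htail : Tendsto (fun T : ℕ => Fintype.card ι ^ 2 * (Fintype.card F : ℝ)⁻¹ ^ T) atTop
      (𝓝 0) := by
    rw [← mul_zero ((Fintype.card ι : ℝ) ^ 2)]
    exact (tendsto_pow_atTop_nhds_zero_of_lt_one (inv_nonneg.2 (card_pos_real F).le)
      (inv_lt_one_of_one_lt₀ (one_lt_card_real F))).const_mul _
  have hsub : Tendsto (fun T => sieveDensity A (e T) - ∏ P ∈ primesIn F 1 T, localDensity A P)
      atTop (𝓝 0) :=
    squeeze_zero_norm' ((eventually_ge_atTop 1).mono fun T hT =>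
      abs_sieveDensity_sub_prod_le A hT fun α => Nat.le_add_left _ _) htail
  have hlim : Tendsto (fun T => sieveDensity A (e T)) atTop (𝓝 c) := by
    simpa using hsub.add hc
  rw [abs_sub_comm]
  exact le_of_tendsto (hlim.sub_const _).abs (.of_forall fun T =>
    abs_sieveDensity_sub_le A (fun α => Nat.le_add_right _ _) hN)

end LocalDensities

section ValueDensity

open scoped BigOperators

theorem proportion_and_forall {ι α κ : Type*} [Fintype ι] [DecidableEq ι] {s : Finset α}
    {t : Finset κ} {g : α → κ} (hg : ∀ a ∈ s, g a ∈ t) (p : α → Prop) {w : κ → ℝ}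
    (hw : ∀ b ∈ t, proportion s (fun a => g a = b ∧ p a) = w b / #t) (E : (ι → κ) → Prop)
    [DecidablePred E] :
    proportion (Fintype.piFinset fun _ : ι => s) (fun f => E (fun i => g (f i)) ∧ ∀ i, p (f i)) =
      𝔼 b ∈ Fintype.piFinset fun _ : ι => t, if E b then ∏ i, w (b i) else 0 := by
  classical
  rw [proportion_eq_sum_fiber (t := Fintype.piFinset fun _ : ι => t)
    (g := fun (f : ι → α) i => g (f i)) fun f hf =>
      Fintype.mem_piFinset.2 fun i => hg _ (Fintype.mem_piFinset.1 hf i),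
    expect_eq_sum_div_card, sum_div]
  refine sum_congr rfl fun b hb => ?_
  split_ifs with hE
  · rw [proportion_congr (q := fun f => ∀ i, g (f i) = b i ∧ p (f i)) fun f _ =>
        ⟨fun h i => ⟨congrFun h.1 i, h.2.2 i⟩, fun h => ?_⟩,
      proportion_piFinset _ fun i a => g a = b i ∧ p a,
      prod_congr rfl fun i _ => hw _ (Fintype.mem_piFinset.1 hb i), prod_div_distrib,
      Fintype.card_piFinset, Nat.cast_prod]
    have hfb : (fun i => g (f i)) = b := funext fun i => (h i).1
    exact ⟨hfb, hfb ▸ hE, fun i => (h i).2⟩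
  · rw [zero_div]
    exact proportion_eq_zero fun f _ h => hE (h.1 ▸ h.2.1)

theorem proportion_eq_elem {κ : Type*} {t : Finset κ} {c : κ} (hc : c ∈ t) :
    proportion t (· = c) = (#t : ℝ)⁻¹ := by
  classical
  rw [proportion_eq_card_div, filter_eq' t c, if_pos hc, card_singleton, Nat.cast_one, one_div]

theorem proportion_ne_elem {κ : Type*} {t : Finset κ} {c : κ} (hc : c ∈ t) :
    proportion t (· ≠ c) = 1 - (#t : ℝ)⁻¹ := by
  classical
  have ht : (#t : ℝ) ≠ 0 := Nat.cast_ne_zero.2 (card_ne_zero_of_mem hc)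
  rw [proportion_eq_card_div, filter_ne' t c, card_erase_of_mem hc,
    Nat.cast_sub (card_pos.2 ⟨c, hc⟩), Nat.cast_one, sub_div, div_self ht, one_div]

variable {ι κ : Type*} [Fintype ι] [DecidableEq ι] [Zero κ]

/-- The proportion of vectors with entries in `t` and at most one vanishing entry that satisfy `B`,
a vector with a vanishing entry being weighted by the probability that this entry remains nonzero
at the next level of precision. -/
def valueDensity (t : Finset κ) (B : (ι → κ) → Prop) : ℝ :=
  proportion (Fintype.piFinset fun _ => t) (fun b => (∀ α, b α ≠ 0) ∧ B b) +
    (1 - (#t : ℝ)⁻¹) * ∑ γ, proportion (Fintype.piFinset fun _ => t) fun b =>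
      (∀ α, b α = 0 ↔ α = γ) ∧ B b

omit [Fintype ι] [DecidableEq ι] in
theorem subsingleton_zeros_iff {b : ι → κ} : {α | b α = 0}.Subsingleton ↔
    (∀ α, b α ≠ 0) ∨ ∃ γ, ∀ α, b α = 0 ↔ α = γ := by
  rw [Set.subsingleton_iff_eq_empty_or_singleton, Set.eq_empty_iff_forall_notMem]
  simp only [Set.ext_iff, Set.mem_singleton_iff, Set.mem_ofPred_eq, ne_eq]

open Classical in
theorem prod_weight_of_subsingleton_zeros (b : ι → κ) (u : ℝ) :
    (if {α | b α = 0}.Subsingleton then ∏ α, if b α = 0 then u else 1 else 0) =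
      (if ∀ α, b α ≠ 0 then 1 else 0) + u * ∑ γ, if ∀ α, b α = 0 ↔ α = γ then 1 else 0 := by
  have hsub := subsingleton_zeros_iff (b := b)
  by_cases hnone : ∀ α, b α ≠ 0
  · have hγ (γ : ι) : ¬ ∀ α, b α = 0 ↔ α = γ := fun h => hnone γ ((h γ).2 rfl)
    rw [if_pos (hsub.2 (.inl hnone)), if_pos hnone, prod_eq_one fun α _ => if_neg (hnone α),
      sum_eq_zero fun γ _ => if_neg (hγ γ), mul_zero, add_zero]
  by_cases hone : ∃ γ, ∀ α, b α = 0 ↔ α = γ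
  · obtain ⟨γ, hγ⟩ := hone
    have hδ (δ : ι) : (∀ α, b α = 0 ↔ α = δ) ↔ δ = γ :=
      ⟨fun h => (hγ δ).1 ((h δ).2 rfl), fun h => h ▸ hγ⟩
    rw [if_pos (hsub.2 (.inr ⟨γ, hγ⟩)), if_neg hnone, zero_add]
    simp only [hδ, sum_ite_eq', mem_univ, if_true, mul_one]
    simp only [hγ, prod_ite_eq', mem_univ, if_true]
  · rw [if_neg fun h => (hsub.1 h).elim hnone hone, if_neg hnone,
      sum_eq_zero fun γ _ => if_neg (not_exists.1 hone γ), mul_zero, add_zero]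

open Classical in
theorem expect_prod_weight (t : Finset κ) (B : (ι → κ) → Prop) :
    𝔼 b ∈ Fintype.piFinset fun _ : ι => t, (if {α | b α = 0}.Subsingleton ∧ B b then
      ∏ α, if b α = 0 then 1 - (#t : ℝ)⁻¹ else 1 else 0) = valueDensity t B := by
  simp only [valueDensity, proportion_eq_expect, ← expect_sum_comm, mul_expect,
    ← expect_add_distrib]
  refine expect_congr rfl fun b _ => ?_
  by_cases hB : B b
  · simpa only [hB, and_true] using prod_weight_of_subsingleton_zeros b (1 - (#t : ℝ)⁻¹)
  · simp only [hB, and_false, if_false, sum_const_zero, mul_zero, add_zero]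

/-- The density of the tuples of length `m` that are squarefree at a prime of norm `Q`. -/
def goodDensity (m : ℕ) (Q : ℝ) : ℝ := (1 - Q⁻¹) ^ m * (1 + m / Q)

theorem proportion_forall_ne_zero {t : Finset κ} (h0 : (0 : κ) ∈ t) :
    proportion (Fintype.piFinset fun _ : ι => t) (fun b => ∀ α, b α ≠ 0) =
      (1 - (#t : ℝ)⁻¹) ^ Fintype.card ι := by
  rw [proportion_piFinset _ fun _ a => a ≠ 0, prod_const, proportion_ne_elem h0, card_univ]

theorem proportion_forall_eq_zero_iff {t : Finset κ} (h0 : (0 : κ) ∈ t) (γ : ι) :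
    (1 - (#t : ℝ)⁻¹) * proportion (Fintype.piFinset fun _ => t) (fun b => ∀ α, b α = 0 ↔ α = γ) =
      (1 - (#t : ℝ)⁻¹) ^ Fintype.card ι * (#t : ℝ)⁻¹ := by
  rw [proportion_piFinset _ fun α a => a = 0 ↔ α = γ, ← mul_prod_erase univ _ (mem_univ γ),
    prod_congr rfl fun α hα => proportion_congr (q := (· ≠ 0)) fun a _ => by
      simp only [ne_of_mem_erase hα, iff_false, ne_eq],
    prod_const, proportion_ne_elem h0, card_erase_of_mem (mem_univ γ), card_univ,
    ← mul_pow_sub_one (Fintype.card_pos_iff.2 ⟨γ⟩).ne' (1 - (#t : ℝ)⁻¹)]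
  simp only [iff_true, proportion_eq_elem h0]
  ring

theorem valueDensity_true {t : Finset κ} (h0 : (0 : κ) ∈ t) :
    valueDensity t (fun _ : ι → κ => True) = goodDensity (Fintype.card ι) #t := by
  simp only [valueDensity, and_true, proportion_forall_ne_zero h0, mul_sum,
    proportion_forall_eq_zero_iff h0, sum_const, card_univ, nsmul_eq_mul, goodDensity]
  ring

variable {F : Type*} [Field F] [Fintype F]

theorem zero_mem_residues {M : F[X]} (hM : M.Monic) : 0 ∈ residues M :=
  (mem_residues hM).2 (by
    rw [degree_zero]
    exact bot_lt_iff_ne_bot.2 (degree_ne_bot.2 hM.ne_zero))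

theorem proportion_residues_dvd {M N : F[X]} (hM : M.Monic) (h : M.natDegree ≤ N.natDegree) :
    proportion (residues N) (M ∣ ·) = (polyNorm M)⁻¹ := by
  rw [← proportion_lowDeg_dvd_sub hM 0 h, residues]
  simp only [sub_zero]

omit [Fintype F] in
theorem natDegree_le_natDegree_sq (P : F[X]) : P.natDegree ≤ (P ^ 2).natDegree := by
  rw [natDegree_pow]
  omega

omit [Fintype F] [DecidableEq ι] in
theorem not_sq_dvd_prod_iff {P : F[X]} (hP : Irreducible P) {f : ι → F[X]} :
    ¬ P ^ 2 ∣ ∏ α, f α ↔ {α | P ∣ f α}.Subsingleton ∧ ∀ α, ¬ P ^ 2 ∣ f α := by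
  classical
  constructor
  · refine fun h => ⟨fun α hα β hβ => ?_, fun α hα => h (hα.trans (dvd_prod_of_mem f (mem_univ α)))⟩
    by_contra hne
    rw [sq] at h
    exact h ((mul_dvd_mul hα hβ).trans (prod_pair hne (f := f) ▸
      prod_dvd_prod_of_subset _ _ f (subset_univ {α, β})))
  · rintro ⟨hsub, hsq⟩ h
    obtain ⟨α, β, hαβ⟩ := exists_mulSingle_dvd_of_sq_dvd_prod hP.prime h
    have hα := hαβ α
    have hβ := hαβ β
    rw [Pi.mul_apply, Pi.mulSingle_eq_same] at hα hβ
    obtain rfl : α = β := hsub (dvd_of_mul_right_dvd hα) (dvd_of_mul_left_dvd hβ)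
    rw [Pi.mulSingle_eq_same, ← sq] at hα
    exact hsq α hα

theorem proportion_residues_sq_dvd_and_not_sq_dvd {P : F[X]} (hP : P.Monic) :
    proportion (residues (P ^ 2)) (fun f => P ∣ f ∧ ¬ P ^ 2 ∣ f) =
      (polyNorm P)⁻¹ * (1 - (polyNorm P)⁻¹) := by
  have hsplit := proportion_or (s := residues (P ^ 2)) (p := fun f => P ∣ f ∧ ¬ P ^ 2 ∣ f)
    (q := fun f => P ^ 2 ∣ f) fun f _ h => h.1.2 h.2
  rw [proportion_congr (q := fun f => P ∣ f) fun f _ => ⟨fun h => h.elim And.left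
    (dvd_pow_self P two_ne_zero).trans, fun h => or_iff_not_imp_right.2 fun h2 => ⟨h, h2⟩⟩]
    at hsplit
  rw [proportion_residues_dvd hP (natDegree_le_natDegree_sq P),
    proportion_residues_dvd (hP.pow 2) le_rfl, polyNorm_pow] at hsplit
  linear_combination -hsplit + inv_pow (polyNorm P) 2

theorem localDensity_eq_valueDensity (A : F → (ι → F) → Prop) {P : F[X]} (hP : P.Monic)
    (hPi : Irreducible P) {t : Finset κ} {g : F[X] → κ}
    (hg : IsEquidistributed g (residues (P ^ 2)) t) (hzero : ∀ f, g f = 0 ↔ P ∣ f)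
    {B : (ι → κ) → Prop}
    (hB : ∀ f : ι → F[X], (∀ x, P = X - C x → A x fun α => (f α).eval x) ↔ B fun α => g (f α)) :
    localDensity A P = valueDensity t B := by
  classical
  have h0 : (0 : κ) ∈ t := by
    rw [← (hzero 0).2 (dvd_zero P)]
    exact hg.mapsTo 0 (zero_mem_residues (hP.pow 2))
  have hcard : (#t : ℝ) = polyNorm P := by
    rw [← inv_inj, ← hg.proportion_fiber 0 h0, proportion_congr fun f _ => hzero f]
    exact proportion_residues_dvd hP (natDegree_le_natDegree_sq P)
  have hw : ∀ b ∈ t, proportion (residues (P ^ 2)) (fun f => g f = b ∧ ¬ P ^ 2 ∣ f) =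
      (if b = 0 then 1 - (#t : ℝ)⁻¹ else 1) / #t := by
    intro b hb
    split_ifs with hb0
    · rw [proportion_congr (q := fun f => P ∣ f ∧ ¬ P ^ 2 ∣ f) fun f _ => by rw [hb0, hzero],
        proportion_residues_sq_dvd_and_not_sq_dvd hP, hcard, div_eq_inv_mul]
    · rw [one_div, ← hg.proportion_fiber b hb]
      refine proportion_congr fun f _ => and_iff_left_of_imp fun h h2 => hb0 ?_
      rw [← h, hzero]
      exact (dvd_pow_self P two_ne_zero).trans h2
  rw [localDensity, ← expect_prod_weight, ← proportion_and_forall hg.mapsTo _ hw]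
  refine proportion_congr fun f _ => ?_
  rw [LocalCond, not_sq_dvd_prod_iff hPi, hB]
  simp only [hzero]
  exact and_right_comm

theorem localDensity_of_two_le (A : F → (ι → F) → Prop) {P : F[X]} (hP : P.Monic)
    (hPi : Irreducible P) (h2 : 2 ≤ P.natDegree) :
    localDensity A P = goodDensity (Fintype.card ι) (polyNorm P) := by
  have hequi := isEquidistributed_lowDeg_mod hP (natDegree_le_natDegree_sq P)
  rw [localDensity_eq_valueDensity A hP hPi hequi (fun _ => modByMonic_eq_zero_iff_dvd hP)
    (B := fun _ => True), valueDensity_true (zero_mem_residues hP), card_residues]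
  refine fun f => iff_true_intro fun x hx => ?_
  rw [hx, natDegree_X_sub_C] at h2
  omega

theorem isEquidistributed_eval (x : F) :
    IsEquidistributed (eval x) (residues ((X - C x) ^ 2)) univ where
  mapsTo _ _ := mem_univ _
  proportion_fiber c _ := by
    have hiff (f : F[X]) : f.eval x = c ↔ X - C x ∣ f - C c := by
      rw [dvd_iff_isRoot, IsRoot.def, eval_sub, eval_C, sub_eq_zero]
    rw [proportion_congr fun f _ => hiff f, residues,
      proportion_lowDeg_dvd_sub (monic_X_sub_C x) _ (natDegree_le_natDegree_sq _), polyNorm,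
      natDegree_X_sub_C, pow_one, card_univ]

theorem localDensity_X_sub_C (A : F → (ι → F) → Prop) (x : F) :
    localDensity A (X - C x) = valueDensity univ (A x) :=
  localDensity_eq_valueDensity A (monic_X_sub_C x) (irreducible_X_sub_C x)
    (isEquidistributed_eval x) (fun _ => dvd_iff_isRoot.symm) fun _ =>
      ⟨fun h => h x rfl, fun h _ hy => C_injective (sub_right_injective hy) ▸ h⟩

end ValueDensity

/-! ### Euler products -/

section EulerProducts

open Filter Topology

variable {F : Type*} [Field F]

/-- The monic polynomials without a divisor in `T`. -/
def coprimeMonics (T : Finset F[X]) : Set F[X] := {f | f.Monic ∧ ∀ P ∈ T, ¬ P ∣ f}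

theorem coprimeMonics_eq_union [DecidableEq F[X]] {T : Finset F[X]}
    (hT : ∀ Q ∈ T, Q.Monic ∧ Irreducible Q) {P : F[X]} (hP : P.Monic) (hPi : Irreducible P)
    (hPT : P ∉ T) :
    coprimeMonics T = coprimeMonics (insert P T) ∪ (P * ·) '' coprimeMonics T := by
  have hmul (f : F[X]) (Q : F[X]) (hQ : Q ∈ T) : Q ∣ P * f ↔ Q ∣ f := by
    have hcop : IsCoprime Q P := isCoprime_of_monic_irreducible (hT Q hQ).1 hP (hT Q hQ).2 hPi
      (ne_of_mem_of_not_mem hQ hPT)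
    exact ⟨hcop.dvd_of_dvd_mul_left, fun h => h.mul_left P⟩
  ext f
  simp only [coprimeMonics, forall_mem_insert, Set.mem_union, Set.mem_image, Set.mem_ofPred_eq]
  constructor
  · rintro ⟨hf, hfT⟩
    by_cases hPf : P ∣ f
    · obtain ⟨g, rfl⟩ := hPf
      exact Or.inr ⟨g, ⟨hP.of_mul_monic_left hf, fun Q hQ hd => hfT Q hQ (hd.mul_left P)⟩, rfl⟩
    · exact Or.inl ⟨hf, hPf, hfT⟩
  · rintro (⟨hf, -, hfT⟩ | ⟨g, ⟨hg, hgT⟩, rfl⟩)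
    · exact ⟨hf, hfT⟩
    · exact ⟨hP.mul hg, fun Q hQ hd => hgT Q hQ ((hmul g Q hQ).1 hd)⟩

variable [Fintype F]

theorem summable_polyNorm_rpow_neg_two {S : Set F[X]} (hS : S ⊆ {f | f.Monic}) :
    Summable fun f : S => polyNorm f.1 ^ (-(2 : ℝ)) :=
  (summable_zetaPoly F one_lt_two).comp_injective (i := Set.inclusion hS)
    (Set.inclusion_injective hS)

/-- The part of `ζ(2)` that comes from the polynomials without a divisor in `T`. -/
def zetaCoprime (T : Finset F[X]) : ℝ := ∑' f : coprimeMonics T, polyNorm f.1 ^ (-(2 : ℝ))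

theorem polyNorm_rpow_neg_two (f : F[X]) : polyNorm f ^ (-(2 : ℝ)) = (polyNorm f ^ 2)⁻¹ := by
  rw [Real.rpow_neg (polyNorm_pos f).le, Real.rpow_two]

theorem zetaCoprime_insert [DecidableEq F[X]] {T : Finset F[X]}
    (hT : ∀ Q ∈ T, Q.Monic ∧ Irreducible Q) {P : F[X]} (hP : P.Monic) (hPi : Irreducible P)
    (hPT : P ∉ T) :
    zetaCoprime (insert P T) = (1 - (polyNorm P ^ 2)⁻¹) * zetaCoprime T := by
  have hdisj : Disjoint (coprimeMonics (insert P T)) ((P * ·) '' coprimeMonics T) := by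
    refine Set.disjoint_left.2 ?_
    rintro _ hf ⟨g, -, rfl⟩
    exact hf.2 P (mem_insert_self P T) (dvd_mul_right P g)
  have himage : ∑' f : (P * ·) '' coprimeMonics T, polyNorm f.1 ^ (-(2 : ℝ)) =
      (polyNorm P ^ 2)⁻¹ * zetaCoprime T := by
    rw [tsum_image (fun f => polyNorm f ^ (-(2 : ℝ))) (mul_right_injective₀ hP.ne_zero).injOn,
      zetaCoprime, ← tsum_mul_left]
    refine tsum_congr fun f => ?_
    rw [polyNorm_mul hP f.2.1, Real.mul_rpow (polyNorm_pos _).le (polyNorm_pos _).le,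
      polyNorm_rpow_neg_two P]
  have hsplit : zetaCoprime T = zetaCoprime (insert P T) + (polyNorm P ^ 2)⁻¹ * zetaCoprime T := by
    rw [← himage]
    conv_lhs => rw [zetaCoprime, coprimeMonics_eq_union hT hP hPi hPT]
    refine Summable.tsum_union_disjoint (f := fun f => polyNorm f ^ (-(2 : ℝ))) hdisj
      (summable_polyNorm_rpow_neg_two fun f hf => hf.1) (summable_polyNorm_rpow_neg_two ?_)
    rintro _ ⟨g, hg, rfl⟩
    exact hP.mul hg.1
  linear_combination -hsplit

theorem zetaCoprime_eq {T : Finset F[X]} (hT : ∀ P ∈ T, P.Monic ∧ Irreducible P) :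
    zetaCoprime T = (∏ P ∈ T, (1 - (polyNorm P ^ 2)⁻¹)) * zetaPoly F 2 := by
  classical
  induction T using Finset.induction_on with
  | empty =>
    rw [prod_empty, one_mul, zetaPoly, zetaCoprime]
    exact (Equiv.subtypeEquivRight fun f => by simp [coprimeMonics]).tsum_eq
      fun f : {f : F[X] // f.Monic} => polyNorm f.1 ^ (-(2 : ℝ))
  | insert P T hPT ih =>
    have hP := hT P (mem_insert_self P T)
    have hT' : ∀ Q ∈ T, Q.Monic ∧ Irreducible Q := fun Q hQ => hT Q (mem_insert_of_mem hQ)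
    rw [zetaCoprime_insert hT' hP.1 hP.2 hPT, ih hT', prod_insert hPT, mul_assoc]

theorem mem_coprimeMonics_primesIn_iff {T : ℕ} {f : F[X]} (hT : f.natDegree ≤ T) :
    f ∈ coprimeMonics (primesIn F 1 T) ↔ f = 1 := by
  constructor
  · rintro ⟨hf, hfT⟩
    by_contra hne
    obtain ⟨P, hP, hPi, hPf⟩ := exists_monic_irreducible_factor f
      fun h => hne (hf.eq_one_of_isUnit h)
    exact hfT P (mem_primesIn.2 ⟨hP, hPi, hPi.natDegree_pos,
      (natDegree_le_of_dvd hPf hf.ne_zero).trans hT⟩) hPf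
  · rintro rfl
    exact ⟨monic_one, fun P hP hd =>
      (mem_primesIn.1 hP).2.1.not_isUnit (isUnit_of_dvd_one hd)⟩

theorem tendsto_zetaCoprime :
    Tendsto (fun T => zetaCoprime (primesIn F 1 T)) atTop (𝓝 1) := by
  have hone : ∑' f, Set.indicator {1} (fun f : F[X] => polyNorm f ^ (-(2 : ℝ))) f = 1 := by
    rw [← _root_.tsum_subtype, tsum_singleton 1 fun f : F[X] => polyNorm f ^ (-(2 : ℝ)), polyNorm,
      natDegree_one, pow_zero, Real.one_rpow]
  have hsummable :
      Summable (Set.indicator {f : F[X] | f.Monic} fun f => polyNorm f ^ (-(2 : ℝ))) :=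
    summable_subtype_iff_indicator.1 (summable_zetaPoly F one_lt_two)
  simp only [zetaCoprime,
    _root_.tsum_subtype (coprimeMonics _) fun f : F[X] => polyNorm f ^ (-(2 : ℝ))]
  rw [← hone]
  refine tendsto_tsum_of_dominated_convergence hsummable (fun f => ?_) (.of_forall fun T f => ?_)
  · refine tendsto_const_nhds.congr' ((eventually_ge_atTop f.natDegree).mono fun T hT => ?_)
    have hmem := mem_coprimeMonics_primesIn_iff hT
    beta_reduce
    by_cases hf : f = 1
    · rw [Set.indicator_of_mem (Set.mem_singleton_iff.2 hf), Set.indicator_of_mem (hmem.2 hf)]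
    · rw [Set.indicator_of_notMem (mt Set.mem_singleton_iff.1 hf),
        Set.indicator_of_notMem (mt hmem.1 hf)]
  · have hnonneg (f : F[X]) : 0 ≤ polyNorm f ^ (-(2 : ℝ)) := Real.rpow_nonneg (polyNorm_pos f).le _
    rw [Real.norm_of_nonneg (Set.indicator_nonneg (fun f _ => hnonneg f) f)]
    exact Set.indicator_le_indicator_of_subset (fun f hf => hf.1) (fun f => hnonneg f) f

theorem zetaPoly_two_pos : 0 < zetaPoly F 2 :=
  (summable_zetaPoly F one_lt_two).tsum_pos (fun f => Real.rpow_nonneg (polyNorm_pos f.1).le _)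
    ⟨1, monic_one⟩ (Real.rpow_pos_of_pos (polyNorm_pos _) _)

theorem tendsto_prod_one_sub_inv_sq :
    Tendsto (fun T => ∏ P ∈ primesIn F 1 T, (1 - (polyNorm P ^ 2)⁻¹)) atTop
      (𝓝 (zetaPoly F 2)⁻¹) := by
  have hlim := (tendsto_zetaCoprime (F := F)).mul_const (zetaPoly F 2)⁻¹
  rw [one_mul] at hlim
  refine hlim.congr fun T => ?_
  rw [zetaCoprime_eq monic_and_irreducible_of_mem_primesIn, mul_assoc,
    mul_inv_cancel₀ zetaPoly_two_pos.ne', mul_one]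

theorem tendsto_prod_eulerFactor (j : ℕ) :
    Tendsto (fun T => ∏ P ∈ primesIn F 1 T, eulerFactor j P) atTop
      (𝓝 (∏' P : {P : F[X] // P.Monic ∧ Irreducible P}, eulerFactor j P.1)) := by
  classical
  have hexhaust : Tendsto (fun T => (primesIn F 1 T).subtype fun P => P.Monic ∧ Irreducible P)
      atTop atTop := by
    refine tendsto_atTop_finset_of_monotone (fun a b hab P hP => ?_) fun P => ?_
    · rw [mem_subtype, mem_primesIn] at hP ⊢
      exact ⟨hP.1, hP.2.1, hP.2.2.1, hP.2.2.2.trans hab⟩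
    · refine ⟨P.1.natDegree, ?_⟩
      rw [mem_subtype, mem_primesIn]
      exact ⟨P.2.1, P.2.2, P.2.2.natDegree_pos, le_rfl⟩
  exact ((multipliable_eulerFactor F j).hasProd.comp hexhaust).congr fun T =>
    prod_subtype_of_mem (eulerFactor j) monic_and_irreducible_of_mem_primesIn

theorem one_sub_inv_sq_pow_le_eulerFactor (j : ℕ) {P : F[X]} (hP : Irreducible P) :
    (1 - (polyNorm P ^ 2)⁻¹) ^ j ≤ eulerFactor j P := by
  have hQ : 1 < polyNorm P := one_lt_polyNorm hP
  have hinv : (polyNorm P ^ 2)⁻¹ < 1 := inv_lt_one_of_one_lt₀ (one_lt_pow₀ hQ two_ne_zero)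
  have hform (i : ℕ) : eulerFactor i P =
      polyNorm P * (polyNorm P + 1 + i) / ((polyNorm P + 1) * (polyNorm P + i)) := by
    have : polyNorm P + i ≠ 0 := by positivity
    rw [eulerFactor]
    field_simp
    ring
  induction j with
  | zero => simp [eulerFactor]
  | succ j ih =>
    have hratio : eulerFactor (j + 1) P =
        eulerFactor j P * (1 - ((polyNorm P + 1 + j) ^ 2)⁻¹) := by
      have h0 : polyNorm P + j ≠ 0 := by positivity
      have h1 : polyNorm P + (j + 1) ≠ 0 := by positivity
      have h2 : polyNorm P + 1 + j ≠ 0 := by positivity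
      rw [hform, hform]
      push_cast
      field_simp
      ring
    rw [hratio, pow_succ]
    have hle : (polyNorm P : ℝ) ≤ polyNorm P + 1 + j := by linarith [j.cast_nonneg (α := ℝ)]
    refine mul_le_mul ih (sub_le_sub_left (inv_anti₀ (by positivity) (by gcongr)) 1)
      (sub_nonneg.2 hinv.le) ((pow_nonneg (sub_nonneg.2 hinv.le) j).trans ih)

theorem eulerL_pos (m : ℕ) : 0 < eulerL F m :=
  prod_pos fun j _ => (pow_pos (inv_pos.2 zetaPoly_two_pos) j).trans_le <|
    le_of_tendsto_of_tendsto' ((tendsto_prod_one_sub_inv_sq (F := F)).pow j)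
      (tendsto_prod_eulerFactor j) fun T => by
        rw [← prod_pow]
        refine prod_le_prod (fun P hP => pow_nonneg (sub_nonneg.2 ?_) j) fun P hP =>
          one_sub_inv_sq_pow_le_eulerFactor j (mem_primesIn.1 hP).2.1
        exact inv_le_one_of_one_le₀
          (one_le_pow₀ (one_lt_polyNorm (mem_primesIn.1 hP).2.1).le)

theorem goodDensity_polyNorm_eq (m : ℕ) (P : F[X]) :
    goodDensity m (polyNorm P) =
      (∏ j ∈ Finset.Icc 1 (m - 1), eulerFactor j P) * (1 - (polyNorm P ^ 2)⁻¹) ^ m := by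
  have hQ := polyNorm_pos P
  rcases m with _ | m
  · simp [goodDensity]
  rw [Nat.add_sub_cancel]
  induction m with
  | zero =>
    rw [Finset.Icc_eq_empty_of_lt one_pos, prod_empty, goodDensity, zero_add, pow_one, pow_one,
      Nat.cast_one]
    field_simp
    ring
  | succ m ih =>
    have hratio : goodDensity (m + 1 + 1) (polyNorm P) = goodDensity (m + 1) (polyNorm P) *
        (eulerFactor (m + 1) P * (1 - (polyNorm P ^ 2)⁻¹)) := by
      have hm : 0 < polyNorm P + ((m + 1 : ℕ) : ℝ) := by positivity
      simp only [goodDensity, eulerFactor, pow_succ (1 - (polyNorm P)⁻¹) (m + 1)]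
      push_cast at hm ⊢
      field_simp
      ring
    rw [prod_Icc_succ_top (by omega), pow_succ (1 - (polyNorm P ^ 2)⁻¹) (m + 1), hratio, ih]
    ring

theorem goodDensity_pos (m : ℕ) {Q : ℝ} (hQ : 1 < Q) : 0 < goodDensity m Q := by
  have : 0 < 1 - Q⁻¹ := sub_pos.2 (inv_lt_one_of_one_lt₀ hQ)
  unfold goodDensity
  positivity

variable (F) in
/-- The product of `goodDensity m (polyNorm P)` over all primes `P`, that is, the limit density of
the tuples of length `m` whose product is squarefree. -/
def limitDensity (m : ℕ) : ℝ := eulerL F (m - 1) / zetaPoly F 2 ^ m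

theorem limitDensity_pos (m : ℕ) : 0 < limitDensity F m :=
  div_pos (eulerL_pos _) (pow_pos zetaPoly_two_pos _)

theorem tendsto_prod_goodDensity (m : ℕ) :
    Tendsto (fun T => ∏ P ∈ primesIn F 1 T, goodDensity m (polyNorm P)) atTop
      (𝓝 (limitDensity F m)) := by
  rw [limitDensity, div_eq_mul_inv, ← inv_pow]
  have heuler := tendsto_finsetProd (Finset.Icc 1 (m - 1)) fun j _ =>
    tendsto_prod_eulerFactor (F := F) j
  refine (heuler.mul ((tendsto_prod_one_sub_inv_sq (F := F)).pow m)).congr fun T => ?_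
  rw [Finset.prod_comm, ← prod_pow, ← prod_mul_distrib]
  exact prod_congr rfl fun P _ => (goodDensity_polyNorm_eq m P).symm

variable {ι : Type*} [Fintype ι] [DecidableEq ι]

theorem prod_localDensity_div_goodDensity (A : F → (ι → F) → Prop) {T : ℕ} (hT : 1 ≤ T) :
    ∏ P ∈ primesIn F 1 T, localDensity A P / goodDensity (Fintype.card ι) (polyNorm P) =
      ∏ x, valueDensity univ (A x) / goodDensity (Fintype.card ι) (Fintype.card F) := by
  classical
  have hsub : univ.image (fun x : F => X - C x) ⊆ primesIn F 1 T := by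
    rintro _ hP
    obtain ⟨x, -, rfl⟩ := mem_image.1 hP
    exact mem_primesIn.2 ⟨monic_X_sub_C x, irreducible_X_sub_C x, by simp, by simpa using hT⟩
  rw [← prod_subset hsub fun P hP hlin => ?_, prod_image fun x _ y _ h =>
    C_injective (sub_right_injective h)]
  · refine prod_congr rfl fun x _ => ?_
    rw [localDensity_X_sub_C, polyNorm, natDegree_X_sub_C, pow_one]
  · obtain ⟨hPm, hPi, h1, -⟩ := mem_primesIn.1 hP
    rcases h1.eq_or_lt with h1 | h2
    · obtain ⟨x, rfl⟩ := exists_eq_X_sub_C hPm h1.symm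
      exact absurd (mem_image_of_mem _ (mem_univ x)) hlin
    · rw [localDensity_of_two_le A hPm hPi h2,
        div_self (goodDensity_pos _ (one_lt_polyNorm hPi)).ne']

theorem tendsto_prod_localDensity (A : F → (ι → F) → Prop) :
    Tendsto (fun T => ∏ P ∈ primesIn F 1 T, localDensity A P) atTop
      (𝓝 (limitDensity F (Fintype.card ι) *
        ∏ x, valueDensity univ (A x) / goodDensity (Fintype.card ι) (Fintype.card F))) := by
  refine ((tendsto_prod_goodDensity (F := F) (Fintype.card ι)).mul_const _).congr'
    ((eventually_ge_atTop 1).mono fun T hT => ?_)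
  rw [← prod_localDensity_div_goodDensity A hT, ← prod_mul_distrib]
  exact prod_congr rfl fun P hP =>
    mul_div_cancel₀ _ (goodDensity_pos _ (one_lt_polyNorm (mem_primesIn.1 hP).2.1)).ne'

end EulerProducts

/-! ### The pairs `(s, ω)` as characters of `G` -/

section Duality

theorem addChar_map_sum {A M ι : Type*} [AddCommMonoid A] [CommMonoid M] (ψ : AddChar A M)
    (t : Finset ι) (x : ι → A) : ψ (∑ i ∈ t, x i) = ∏ i ∈ t, ψ (x i) :=
  map_prod (AddChar.toMonoidHomEquiv ψ) (fun i => Multiplicative.ofAdd (x i)) t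

theorem exists_coprime_pow_eq {R : Type*} [CommRing R] [IsDomain R] {ζ z : R} {s : ℕ}
    (hs : 0 < s) (hζ : IsPrimitiveRoot ζ s) (hz : IsPrimitiveRoot z s) :
    ∃ w ∈ Finset.Icc 1 s, Nat.Coprime w s ∧ ζ ^ w = z := by
  have : NeZero s := ⟨hs.ne'⟩
  obtain ⟨i, hi, hcop, hpow⟩ := hζ.isPrimitiveRoot_iff.1 hz
  rcases i.eq_zero_or_pos with rfl | hpos
  · obtain rfl := s.coprime_zero_left.1 hcop
    refine ⟨1, mem_Icc.2 ⟨le_rfl, le_rfl⟩, Nat.coprime_one_right 1, ?_⟩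
    rw [pow_one, IsPrimitiveRoot.one_right_iff.1 hζ, ← hpow, pow_zero]
  · exact ⟨i, mem_Icc.2 ⟨hpos, hi.le⟩, hcop, hpow⟩

theorem mem_zmultiples_iff_forall_addChar {A : Type*} [AddCommGroup A] [Finite A] {x y : A} :
    y ∈ AddSubgroup.zmultiples x ↔ ∀ ψ : AddChar A ℂ, ψ x = 1 → ψ y = 1 := by
  refine ⟨?_, fun h => ?_⟩
  · rintro ⟨k, rfl⟩ ψ hx
    simp only [AddChar.map_zsmul_eq_zpow, hx, one_zpow]
  · by_contra hy
    have hne : (y : A ⧸ AddSubgroup.zmultiples x) ≠ 0 := by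
      rwa [ne_eq, QuotientAddGroup.eq_zero_iff]
    obtain ⟨ψ, hψ⟩ := AddChar.exists_apply_ne_zero.2 hne
    refine hψ (h (ψ.compAddMonoidHom (QuotientAddGroup.mk' _)) ?_)
    rw [AddChar.compAddMonoidHom_apply, QuotientAddGroup.mk'_apply,
      (QuotientAddGroup.eq_zero_iff _).2 (AddSubgroup.mem_zmultiples _), AddChar.map_zero_eq_one]

theorem card_filter_zmultiples_eq {A : Type*} [AddCommGroup A] [Fintype A] (x : A)
    [DecidablePred fun y : A => AddSubgroup.zmultiples y = AddSubgroup.zmultiples x] :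
    #{y : A | AddSubgroup.zmultiples y = AddSubgroup.zmultiples x} =
      Nat.totient (addOrderOf x) := by
  classical
  have h := IsAddCyclic.card_addOrderOf_eq_totient (α := AddSubgroup.zmultiples x)
    (d := addOrderOf x) (by rw [← Nat.card_eq_fintype_card, Nat.card_zmultiples])
  rw [← h]
  refine (Finset.card_bij (fun (y : AddSubgroup.zmultiples x) _ => (y : A)) (fun y hy => ?_)
    (fun _ _ _ _ => Subtype.ext) fun y hy => ?_).symm
  · rw [mem_filter_univ] at hy ⊢
    refine AddSubgroup.eq_of_le_of_card_ge (AddSubgroup.zmultiples_le.2 y.2) ?_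
    rw [Nat.card_zmultiples, Nat.card_zmultiples, ← hy, AddSubgroup.addOrderOf_coe]
  · rw [mem_filter_univ] at hy
    refine ⟨⟨y, hy ▸ AddSubgroup.mem_zmultiples y⟩, (mem_filter_univ _).2 ?_, rfl⟩
    rw [← AddSubgroup.addOrderOf_coe, ← Nat.card_zmultiples, hy, Nat.card_zmultiples]

variable {n : ℕ} {r : Fin n → ℕ}

/-- The group `G = ℤ/r₁ × ⋯ × ℤ/rₙ`. -/
abbrev CoverGroup (r : Fin n → ℕ) : Type := (j : Fin n) → ZMod (r j)

/-- The class in `G` of an integer vector. -/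
def castVec (r : Fin n → ℕ) (v : Fin n → ℕ) : CoverGroup r := fun j => (v j : ZMod (r j))

/-- The element of `G` represented by `β`. -/
abbrev vecElt (β : RFull r) : CoverGroup r := castVec r fun j => (β j : ℕ)

theorem vecElt_bijective [∀ j, NeZero (r j)] :
    Function.Bijective (vecElt : RFull r → CoverGroup r) := by
  refine ⟨fun α β h => funext fun j => Fin.ext ?_,
    fun y => ⟨fun j => ⟨(y j).val, ZMod.val_lt _⟩, funext fun _ => ZMod.natCast_zmod_val _⟩⟩
  have hmod := (ZMod.natCast_eq_natCast_iff' _ _ _).1 (congrFun h j)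
  rwa [Nat.mod_eq_of_lt (α j).2, Nat.mod_eq_of_lt (β j).2] at hmod

theorem addOrderOf_vecElt [∀ j, NeZero (r j)] (β : RFull r) :
    addOrderOf (vecElt β) = ramIndex β := by
  simp only [Pi.addOrderOf, ramIndex, castVec, ZMod.addOrderOf_coe _ (NeZero.ne _)]

theorem castVec_eq_sum_nsmul_single (v : Fin n → ℕ) :
    castVec r v = ∑ j, v j • (Pi.single j 1 : CoverGroup r) := by
  rw [← Finset.univ_sum_single (castVec r v)]
  exact Finset.sum_congr rfl fun j _ => by rw [← Pi.single_smul, castVec, nsmul_one]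

theorem PairIndex.s_dvd (p : PairIndex r) (j : Fin n) : p.s j ∣ r j :=
  Nat.dvd_of_mem_divisors (Fintype.mem_piFinset.1 (Finset.mem_sigma.1 p.2).1 j)

theorem dvd_ell (s : Fin n → ℕ) (j : Fin n) : s j ∣ ell s := Finset.dvd_lcm (mem_univ j)

theorem ell_ne_zero {s : Fin n → ℕ} (hs : ∀ j, 0 < s j) : ell s ≠ 0 := by
  simpa only [ell, ne_eq, Finset.lcm_eq_zero_iff, mem_univ, true_and, not_exists]
    using fun j => (hs j).ne'

theorem PairIndex.ell_dvd (p : PairIndex r) : ell p.s ∣ ell r :=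
  Finset.lcm_dvd fun j _ => (p.s_dvd j).trans (dvd_ell r j)

theorem pairing_single (p : PairIndex r) (j : Fin n) :
    pairing p (Pi.single j 1) = ell p.s / p.s j * p.w j := by
  simp [pairing, Pi.single_apply]

theorem mem_zeroSumPairs {β : RFull r} {p : PairIndex r} :
    p ∈ zeroSumPairs β ↔ ell p.s ∣ pairing p fun j => (β j : ℕ) := by
  rw [zeroSumPairs, mem_filter_univ, Nat.modEq_zero_iff_dvd]

theorem pow_weight_pow_eq_one (p : PairIndex r) {ζ : ℂ} (hζ : ζ ^ ell p.s = 1) (j : Fin n) :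
    (ζ ^ (ell p.s / p.s j * p.w j)) ^ r j = 1 := by
  obtain ⟨t, ht⟩ := p.s_dvd j
  have hexp : ell p.s / p.s j * p.w j * r j = ell p.s * (p.w j * t) := by
    conv_rhs => rw [← Nat.div_mul_cancel (dvd_ell p.s j)]
    rw [ht]
    ring
  rw [← pow_mul, hexp, pow_mul, hζ, one_pow]

variable [∀ j, NeZero (r j)]

/-- The character `v ↦ ζ ^ ∑ⱼ (ℓ(s) / sⱼ) ωⱼ vⱼ` of `G`, for an `ℓ(s)`-th root of unity `ζ`. -/
def pairChar (p : PairIndex r) {ζ : ℂ} (hζ : ζ ^ ell p.s = 1) : AddChar (CoverGroup r) ℂ :=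
  ∏ j, (AddChar.zmodChar (r j) (pow_weight_pow_eq_one p hζ j)).compAddMonoidHom
    (Pi.evalAddMonoidHom _ j)

theorem pairChar_castVec (p : PairIndex r) {ζ : ℂ} (hζ : ζ ^ ell p.s = 1) (v : Fin n → ℕ) :
    pairChar p hζ (castVec r v) = ζ ^ pairing p v := by
  rw [pairChar, AddChar.prod_apply, pairing, ← Finset.prod_pow_eq_pow_sum]
  refine Finset.prod_congr rfl fun j _ => ?_
  rw [AddChar.compAddMonoidHom_apply, Pi.evalAddMonoidHom_apply, castVec, AddChar.zmodChar_apply',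
    ← pow_mul]

theorem exists_addChar_eq_one_iff (p : PairIndex r) :
    ∃ ψ : AddChar (CoverGroup r) ℂ, ∀ v, ψ (castVec r v) = 1 ↔ ell p.s ∣ pairing p v := by
  have hζ := Complex.isPrimitiveRoot_exp (ell p.s)
    (ell_ne_zero fun j => Nat.pos_of_dvd_of_pos (p.s_dvd j) (NeZero.pos _))
  exact ⟨pairChar p hζ.pow_eq_one, fun v => by rw [pairChar_castVec, hζ.pow_eq_one_iff_dvd]⟩

theorem exists_pairIndex_eq_one_iff (ψ : AddChar (CoverGroup r) ℂ) :
    ∃ p : PairIndex r, ∀ v, ψ (castVec r v) = 1 ↔ ell p.s ∣ pairing p v := by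
  let s : Fin n → ℕ := fun j => orderOf (ψ (Pi.single j 1))
  have hsr : ∀ j, s j ∣ r j := fun j => orderOf_dvd_of_pow_eq_one <| by
    rw [← AddChar.map_nsmul_eq_pow, ← Pi.single_smul, nsmul_one, ZMod.natCast_self, Pi.single_zero,
      AddChar.map_zero_eq_one]
  have hs : ∀ j, 0 < s j := fun j => Nat.pos_of_dvd_of_pos (hsr j) (NeZero.pos _)
  have hζ := Complex.isPrimitiveRoot_exp (ell s) (ell_ne_zero hs)
  set ζ := Complex.exp (2 * Real.pi * Complex.I / (ell s : ℕ))
  have hroot := fun j => exists_coprime_pow_eq (hs j)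
    (hζ.pow (ell_ne_zero hs).bot_lt (Nat.div_mul_cancel (dvd_ell s j)).symm)
    (IsPrimitiveRoot.orderOf (ψ (Pi.single j 1)))
  choose w hw hcop hpow using hroot
  have hmem : (⟨s, w⟩ : (_ : Fin n → ℕ) × (Fin n → ℕ)) ∈ (divisorVecs r).sigma Omega := by
    simp only [Finset.mem_sigma, divisorVecs, Omega, Fintype.mem_piFinset, Nat.mem_divisors,
      Finset.mem_filter]
    exact ⟨fun j => ⟨hsr j, NeZero.ne _⟩, fun j => ⟨hw j, hcop j⟩⟩
  refine ⟨⟨⟨s, w⟩, hmem⟩, fun v => ?_⟩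
  rw [castVec_eq_sum_nsmul_single, addChar_map_sum, ← hζ.pow_eq_one_iff_dvd, pairing,
    ← Finset.prod_pow_eq_pow_sum]
  simp only [AddChar.map_nsmul_eq_pow, pow_mul, hpow]

theorem vecElt_mem_zmultiples_iff {β γ : RFull r} :
    vecElt γ ∈ AddSubgroup.zmultiples (vecElt β) ↔ zeroSumPairs β ⊆ zeroSumPairs γ := by
  simp only [mem_zmultiples_iff_forall_addChar, Finset.subset_iff, mem_zeroSumPairs]
  refine ⟨fun h p => ?_, fun h ψ => ?_⟩
  · obtain ⟨ψ, hψ⟩ := exists_addChar_eq_one_iff p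
    simpa only [hψ] using h ψ
  · obtain ⟨p, hp⟩ := exists_pairIndex_eq_one_iff ψ
    simpa only [hp] using @h p

theorem zeroSumPairs_eq_iff {β γ : RFull r} :
    zeroSumPairs β = zeroSumPairs γ ↔
      AddSubgroup.zmultiples (vecElt β) = AddSubgroup.zmultiples (vecElt γ) := by
  rw [Finset.Subset.antisymm_iff, le_antisymm_iff, AddSubgroup.zmultiples_le,
    AddSubgroup.zmultiples_le, vecElt_mem_zmultiples_iff, vecElt_mem_zmultiples_iff, and_comm]

theorem card_filter_zeroSumPairs_eq (β : RFull r) :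
    #{γ : RFull r | zeroSumPairs γ = zeroSumPairs β} = Nat.totient (ramIndex β) := by
  classical
  rw [← addOrderOf_vecElt, ← card_filter_zmultiples_eq]
  refine Finset.card_bijective vecElt vecElt_bijective fun γ => ?_
  rw [mem_filter_univ, mem_filter_univ, zeroSumPairs_eq_iff]

end Duality

/-! ### Character values of tuples -/

section CharacterSystems

variable {F : Type*} [Field F] {n : ℕ} {r : Fin n → ℕ}

/-- A discrete logarithm on `Fˣ` with values in the multiples of the identity of `G`, and for each
pair `(s, ω)` the character of `G` through which `χ_ℓ(s)` of a value of `F_(s)^(ω)` factors. -/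
structure CharacterSystem (r : Fin n → ℕ) (χ : ℕ → MulChar F ℂ) where
  log : Additive Fˣ →+ AddMonoid.End (CoverGroup r)
  exists_log_eq_one : ∃ g, log (.ofMul g) = 1
  char : PairIndex r → AddChar (CoverGroup r) ℂ
  char_castVec_eq_one_iff (p : PairIndex r) (v : Fin n → ℕ) :
    char p (castVec r v) = 1 ↔ ell p.s ∣ pairing p v
  mulChar_pow (p : PairIndex r) (u : Fˣ) (v : Fin n → ℕ) :
    χ (ell p.s) ((u : F) ^ (pairing p v % ell p.s)) = char p (log (.ofMul u) (castVec r v))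

theorem isPrimitiveRoot_mulChar {g : Fˣ} (hg : ∀ u : Fˣ, u ∈ Subgroup.zpowers g)
    (χ : MulChar F ℂ) : IsPrimitiveRoot (χ g) (orderOf χ) := by
  have horder : orderOf (χ (g : F)) = orderOf χ := orderOf_eq_orderOf_iff.2 fun k => by
    rw [MulChar.eq_iff hg, MulChar.pow_apply_coe, MulChar.one_apply_coe]
  exact horder ▸ IsPrimitiveRoot.orderOf _

theorem exists_log [Fintype F] (hq : ∀ j, Fintype.card F ≡ 1 [MOD r j]) {g : Fˣ}
    (hg : ∀ u : Fˣ, u ∈ Subgroup.zpowers g) :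
    ∃ log : Additive Fˣ →+ AddMonoid.End (CoverGroup r), log (.ofMul g) = 1 := by
  have hdvd : addOrderOf (1 : AddMonoid.End (CoverGroup r)) ∣ addOrderOf (Additive.ofMul g) := by
    rw [addOrderOf_ofMul_eq_orderOf, orderOf_eq_card_of_forall_mem_zpowers hg,
      Nat.card_units, Nat.card_eq_fintype_card, addOrderOf_dvd_iff_nsmul_eq_zero]
    ext v j
    have hj : ((Fintype.card F - 1 : ℕ) : ZMod (r j)) = 0 :=
      (ZMod.natCast_eq_zero_iff _ _).2 ((Nat.modEq_iff_dvd' Fintype.card_pos).1 (hq j).symm)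
    simp [hj]
  exact ⟨addMonoidHomOfForallMemZMultiples hg hdvd, addMonoidHomOfForallMemZMultiples_apply_gen _ _⟩

theorem nonempty_characterSystem [Fintype F] [∀ j, NeZero (r j)]
    (hq : ∀ j, Fintype.card F ≡ 1 [MOD r j]) {χ : ℕ → MulChar F ℂ}
    (hχ : ∀ m, m ∣ ell r → orderOf (χ m) = m) : Nonempty (CharacterSystem r χ) := by
  obtain ⟨g, hg⟩ := IsCyclic.exists_generator (α := Fˣ)
  obtain ⟨log, hlog⟩ := exists_log hq hg
  have hζ (p : PairIndex r) : IsPrimitiveRoot (χ (ell p.s) g) (ell p.s) := by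
    conv => arg 2; rw [← hχ _ p.ell_dvd]
    exact isPrimitiveRoot_mulChar hg _
  refine ⟨log, ⟨g, hlog⟩, fun p => pairChar p (hζ p).pow_eq_one, fun p v => ?_, fun p u v => ?_⟩
  · rw [pairChar_castVec, (hζ p).pow_eq_one_iff_dvd]
  · obtain ⟨k, rfl⟩ := mem_powers_iff_mem_zpowers.2 (hg u)
    rw [ofMul_pow, map_nsmul, hlog]
    change _ = pairChar p _ (k • castVec r v)
    rw [AddChar.map_nsmul_eq_pow, pairChar_castVec, Units.val_pow_eq_pow_val, map_pow, map_pow,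
      pow_right_comm, ← pow_eq_pow_mod _ (hζ p).pow_eq_one]

/-- `χ_ℓ(s)` of the value of `F_(s)^(ω)` at a point where the tuple takes the values `a`. -/
def charValue (χ : ℕ → MulChar F ℂ) (a : RNonzero r → F) (p : PairIndex r) : ℂ :=
  χ (ell p.s) (∏ α : RNonzero r, a α ^ (pairing p (fun j => (α.1 j : ℕ)) % ell p.s))

/-- The values `u`, with the one indexed by `γ` (if any) replaced by `0`. -/
def maskZero (γ : RFull r) (u : RNonzero r → Fˣ) (α : RNonzero r) : F :=
  if α.1 = γ then 0 else u α

theorem maskZero_eq_zero_iff {γ : RFull r} {u : RNonzero r → Fˣ} {α : RNonzero r} :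
    maskZero γ u α = 0 ↔ α.1 = γ := by
  rw [maskZero, ite_eq_left_iff, imp_iff_not_or, not_not, or_iff_left (u α).ne_zero]

theorem exists_maskZero_eq {a : RNonzero r → F} {γ : RFull r} (ha : ∀ α, a α = 0 ↔ α.1 = γ) :
    ∃ u, maskZero γ u = a := by
  classical
  refine ⟨fun α => if h : a α = 0 then 1 else Units.mk0 (a α) h, funext fun α => ?_⟩
  by_cases h : a α = 0
  · rw [h, maskZero_eq_zero_iff, ← ha, h]
  · rw [maskZero, if_neg (mt (ha α).2 h), dif_neg h, Units.val_mk0]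

theorem exists_eq_zero_iff [∀ j, NeZero (r j)] {a : RNonzero r → F}
    (ha : ∀ α γ, a α = 0 → a γ = 0 → α = γ) : ∃ γ : RFull r, ∀ α, a α = 0 ↔ α.1 = γ := by
  by_cases hzero : ∃ γ, a γ = 0
  · obtain ⟨γ, hγ⟩ := hzero
    exact ⟨γ.1, fun α => ⟨fun hα => congrArg _ (ha α γ hα hγ), fun hα => Subtype.ext hα ▸ hγ⟩⟩
  · refine ⟨zeroVec r fun j => NeZero.pos _, fun α => iff_of_false (fun h => hzero ⟨α, h⟩) ?_⟩
    obtain ⟨j, hj⟩ := α.2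
    exact fun h => hj (congrArg Fin.val (congrFun h j))

theorem isGoodTuple_of_mem_tuplesAll {d : RNonzero r → ℕ} {f : RNonzero r → F[X]}
    (hf : f ∈ tuplesAll F d) : IsGoodTuple f :=
  hf.elim And.left fun h => (Set.mem_iUnion.1 h).elim fun _ => And.left

theorem eval_twistPoly (c : Fin n → Fˣ) (f : RNonzero r → F[X]) (p : PairIndex r) (x : F) :
    (twistPoly c f p).eval x = twistCoeff c p *
      ∏ α : RNonzero r, (f α).eval x ^ (pairing p (fun j => (α.1 j : ℕ)) % ell p.s) := by
  simp only [twistPoly, eval_mul, eval_C, eval_prod, eval_pow]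

namespace CharacterSystem

variable {χ : ℕ → MulChar F ℂ} (D : CharacterSystem r χ)

theorem mem_zeroSumPairs_iff {β : RFull r} {p : PairIndex r} :
    p ∈ zeroSumPairs β ↔ D.char p (vecElt β) = 1 := by
  rw [mem_zeroSumPairs, D.char_castVec_eq_one_iff]

/-- The element of `G` attached to the nonzero values of a tuple. -/
def logSum (u : RNonzero r → Fˣ) : CoverGroup r := ∑ α, D.log (.ofMul (u α)) (vecElt α.1)

theorem mem_zmultiples_vecElt_iff [∀ j, NeZero (r j)] {γ : RFull r} {y : CoverGroup r} :
    y ∈ AddSubgroup.zmultiples (vecElt γ) ↔ ∀ p ∈ zeroSumPairs γ, D.char p y = 1 := by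
  obtain ⟨δ, rfl⟩ := vecElt_bijective.2 y
  simp only [vecElt_mem_zmultiples_iff, Finset.subset_iff, D.mem_zeroSumPairs_iff]

theorem charValue_maskZero (γ : RFull r) (u : RNonzero r → Fˣ) (p : PairIndex r) :
    charValue χ (maskZero γ u) p = if p ∈ zeroSumPairs γ then D.char p (D.logSum u) else 0 := by
  split_ifs with hp
  · rw [charValue, map_prod, logSum, addChar_map_sum]
    refine Finset.prod_congr rfl fun α _ => ?_
    rw [← D.mulChar_pow, maskZero]
    split_ifs with hα
    · rw [hα, Nat.mod_eq_zero_of_dvd (mem_zeroSumPairs.1 hp), pow_zero, pow_zero]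
    · rfl
  · rw [mem_zeroSumPairs] at hp
    have hγ : ∃ j, (γ j : ℕ) ≠ 0 := by
      by_contra! h
      exact hp (by simp [pairing, h])
    rw [charValue, Finset.prod_eq_zero (mem_univ ⟨γ, hγ⟩), MulChar.map_zero]
    rw [(maskZero_eq_zero_iff (γ := γ)).2 rfl, zero_pow fun h => hp (Nat.dvd_of_mod_eq_zero h)]

/-- The element of `G` attached to the leading coefficients `c`. -/
def twistSum (c : Fin n → Fˣ) : CoverGroup r :=
  ∑ j, D.log (.ofMul (c j)) (castVec r (Pi.single j 1))

theorem mulChar_twistCoeff (c : Fin n → Fˣ) (p : PairIndex r) :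
    χ (ell p.s) (twistCoeff c p) = D.char p (D.twistSum c) := by
  rw [twistCoeff, map_prod, twistSum, addChar_map_sum]
  exact Finset.prod_congr rfl fun j _ => by rw [← D.mulChar_pow, pairing_single]

/-- The prescription `ε` vanishes outside `A_β` and is given by the element `h` of `G` on `A_β`. -/
def HasStandardForm (ε : PairIndex r → ℂ) (β : RFull r) (h : CoverGroup r) : Prop :=
  ∀ p, ε p = if p ∈ zeroSumPairs β then D.char p h else 0

variable {D}

theorem HasStandardForm.eq_zero_iff {ε : PairIndex r → ℂ} {β : RFull r} {h : CoverGroup r}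
    (hε : D.HasStandardForm ε β h) (p : PairIndex r) : ε p = 0 ↔ p ∉ zeroSumPairs β := by
  rw [hε p]
  split_ifs with hp
  · exact iff_of_false (((D.char p).val_isUnit h).ne_zero) (not_not_intro hp)
  · exact iff_of_true rfl hp

theorem HasStandardForm.isClassAdmissible_iff {d : RNonzero r → ℕ} {ε : PairIndex r → ℂ}
    {β : RFull r} {h : CoverGroup r} (hε : D.HasStandardForm ε β h) (ha : IsAdmissible χ d ε)
    (b : RClass r) : IsClassAdmissible χ d ε b ↔ ⟦β⟧ = b := by
  induction b using Quotient.inductionOn with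
  | h γ =>
    simp only [IsClassAdmissible, ha, true_and, Quotient.lift_mk, hε.eq_zero_iff, not_iff_not,
      Quotient.eq]
    exact Finset.ext_iff.symm

theorem HasStandardForm.charValue_maskZero_eq_iff [∀ j, NeZero (r j)] {ε : PairIndex r → ℂ}
    {β : RFull r} {h : CoverGroup r} (hε : D.HasStandardForm ε β h) (γ : RFull r)
    (u : RNonzero r → Fˣ) :
    (∀ p, charValue χ (maskZero γ u) p = ε p) ↔ zeroSumPairs γ = zeroSumPairs β ∧
      D.logSum u - h ∈ AddSubgroup.zmultiples (vecElt γ) := by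
  have hform : D.HasStandardForm (charValue χ (maskZero γ u)) γ (D.logSum u) :=
    D.charValue_maskZero γ u
  by_cases hγβ : zeroSumPairs γ = zeroSumPairs β
  · rw [D.mem_zmultiples_vecElt_iff]
    simp only [hγβ, true_and]
    refine forall_congr' fun p => ?_
    rw [hform p, hε p, hγβ, AddChar.map_sub_eq_div,
      div_eq_one_iff_eq ((D.char p).val_isUnit h).ne_zero]
    by_cases hp : p ∈ zeroSumPairs β <;> simp [hp]
  · simp only [hγβ, false_and, iff_false]
    refine fun heq => hγβ (Finset.ext fun p => ?_)
    rw [← not_iff_not, ← hform.eq_zero_iff, ← hε.eq_zero_iff, heq p]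

variable (D) in
theorem exists_hasStandardForm [∀ j, NeZero (r j)]
    {d : RNonzero r → ℕ} {ε : PairIndex r → ℂ} (ha : IsAdmissible χ d ε) :
    ∃ β h, D.HasStandardForm ε β h := by
  obtain ⟨c, f, hf, x, hε⟩ := ha
  cases x with
  | some x =>
    have hdisjoint : ∀ α γ, (f α).eval x = 0 → (f γ).eval x = 0 → α = γ := by
      intro α γ hα hγ
      by_contra hne
      obtain ⟨a, b, hab⟩ := (isGoodTuple_of_mem_tuplesAll hf).2 α γ hne
      simpa [hα, hγ] using congrArg (eval x) hab
    obtain ⟨γ, hγ⟩ := exists_eq_zero_iff hdisjoint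
    obtain ⟨u, hu⟩ := exists_maskZero_eq hγ
    refine ⟨γ, D.twistSum c + D.logSum u, fun p => ?_⟩
    have hval : ε p = χ (ell p.s) (twistCoeff c p) * charValue χ (maskZero γ u) p := by
      rw [hε p, hu, twistValue, eval_twistPoly, _root_.map_mul, charValue]
    rw [hval, D.mulChar_twistCoeff, D.charValue_maskZero, mul_ite, mul_zero,
      ← AddChar.map_add_eq_mul]
  | none =>
    obtain ⟨β, hβ⟩ := vecElt_bijective.2 (castVec r (totalDegree f))
    refine ⟨β, D.twistSum c, fun p => ?_⟩
    have hmem : pairing p (totalDegree f) ≡ 0 [MOD ell p.s] ↔ p ∈ zeroSumPairs β := by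
      rw [D.mem_zeroSumPairs_iff, hβ, D.char_castVec_eq_one_iff, Nat.modEq_zero_iff_dvd]
    simp only [hε p, twistValue, hmem, apply_ite (χ (ell p.s)), MulChar.map_zero,
      D.mulChar_twistCoeff]

end CharacterSystem

end CharacterSystems

/-! ### Local densities at the prescribed points -/

section PointDensities

variable {n : ℕ} {r : Fin n → ℕ}

theorem totient_sq (m : ℕ) : Nat.totient (m ^ 2) = m * Nat.totient m := by
  rcases m.eq_zero_or_pos with rfl | hm
  · rfl
  · have h := Nat.totient_gcd_mul_totient_mul m m
    rw [Nat.gcd_self, mul_assoc, ← sq, mul_comm _ m] at h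
    exact Nat.eq_of_mul_eq_mul_left (Nat.totient_pos.2 hm) h

theorem exists_ne_zero_iff (hr : ∀ j, 0 < r j) {β : RFull r} :
    (∃ j, (β j : ℕ) ≠ 0) ↔ β ≠ zeroVec r hr := by
  rw [ne_eq, funext_iff, not_forall]
  exact exists_congr fun j => by rw [Fin.ext_iff, zeroVec]

theorem groupOrder_pos (hr : ∀ j, 0 < r j) : 0 < groupOrder r :=
  Finset.prod_pos fun j _ => hr j

theorem card_RFull : Fintype.card (RFull r) = groupOrder r := by
  simp only [Fintype.card_pi, Fintype.card_fin, groupOrder]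

theorem card_RNonzero (hr : ∀ j, 0 < r j) : Fintype.card (RNonzero r) = groupOrder r - 1 := by
  rw [Fintype.card_congr (Equiv.subtypeEquivRight fun _ => exists_ne_zero_iff hr),
    Fintype.card_subtype_compl, card_RFull, Fintype.card_subtype_eq]

theorem zeroSumPairs_eq_zeroVec_iff (hr : ∀ j, 0 < r j) {β : RFull r} :
    zeroSumPairs β = zeroSumPairs (zeroVec r hr) ↔ β = zeroVec r hr := by
  refine ⟨fun h => funext fun j => Fin.ext ?_, fun h => h ▸ rfl⟩
  exact Nat.eq_zero_of_dvd_of_lt ((dvd_iff_of_rel h hr j dvd_rfl).2 (dvd_zero _)) (β j).2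

theorem ramIndex_zeroVec (hr : ∀ j, 0 < r j) : ramIndex (zeroVec r hr) = 1 := by
  refine Nat.dvd_one.1 (Finset.lcm_dvd fun j _ => ?_)
  rw [zeroVec, Nat.gcd_zero_right, Nat.div_self (hr j)]

theorem card_filter_RNonzero_zeroSumPairs_eq (hr : ∀ j, 0 < r j) {β : RFull r}
    (hβ : β ≠ zeroVec r hr) :
    #{γ : RNonzero r | zeroSumPairs γ.1 = zeroSumPairs β} = Nat.totient (ramIndex β) := by
  have (j : Fin n) : NeZero (r j) := ⟨(hr j).ne'⟩
  rw [← card_filter_zeroSumPairs_eq]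
  refine card_bij (fun γ _ => γ.1) (fun γ hγ => ?_) (fun _ _ _ _ => Subtype.ext) fun γ hγ => ?_
  · rwa [mem_filter_univ] at hγ ⊢
  · rw [mem_filter_univ] at hγ
    refine ⟨⟨γ, (exists_ne_zero_iff hr).2 ?_⟩, (mem_filter_univ _).2 hγ, rfl⟩
    rintro rfl
    exact hβ ((zeroSumPairs_eq_zeroVec_iff hr).1 hγ.symm)

variable {F : Type*} [Field F] [Fintype F] [DecidableEq F]

theorem isEquidistributed_units_val :
    IsEquidistributed (Units.val : Fˣ → F) univ {a | a ≠ 0} := by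
  refine .of_card_fiber univ_nonempty (fun u _ => (mem_filter_univ _).2 u.ne_zero) (c := 1) ?_
  intro a ha
  rw [mem_filter_univ] at ha
  exact card_eq_one.2 ⟨Units.mk0 a ha, Finset.ext fun u => by
    rw [mem_filter_univ, mem_singleton, Units.ext_iff, Units.val_mk0]⟩

theorem isEquidistributed_maskZero (γ : RFull r) :
    IsEquidistributed (maskZero γ : (RNonzero r → Fˣ) → RNonzero r → F) univ
      {a | ∀ α, a α = 0 ↔ α.1 = γ} := by
  have hentry (α : RNonzero r) : IsEquidistributed (fun u : Fˣ => if α.1 = γ then 0 else (u : F))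
      univ {a | a = 0 ↔ α.1 = γ} := by
    by_cases hα : α.1 = γ
    · simp only [hα, if_true, iff_true]
      exact .of_card_fiber univ_nonempty (by simp) (c := Fintype.card Fˣ) (by simp)
    · simpa only [hα, if_false, iff_false] using isEquidistributed_units_val
  have hpi := IsEquidistributed.piFinset hentry
  have hpattern : Fintype.piFinset (fun α : RNonzero r => ({a | a = 0 ↔ α.1 = γ} : Finset F)) =
      ({a | ∀ α, a α = 0 ↔ α.1 = γ} : Finset (RNonzero r → F)) := by
    ext a
    simp only [Fintype.mem_piFinset, mem_filter_univ]
  rwa [Fintype.piFinset_univ, hpattern] at hpi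

theorem proportion_zeros_and (γ : RFull r) (B : (RNonzero r → F) → Prop) :
    proportion univ (fun a => (∀ α, a α = 0 ↔ α.1 = γ) ∧ B a) =
      proportion univ (fun a : RNonzero r → F => ∀ α, a α = 0 ↔ α.1 = γ) *
        proportion univ fun u : RNonzero r → Fˣ => B (maskZero γ u) := by
  classical
  rw [proportion_and, (isEquidistributed_maskZero γ).proportion_comp B]

theorem valueDensity_univ_eq (hr : ∀ j, 0 < r j) (B : (RNonzero r → F) → Prop) :
    valueDensity univ B = (1 - (Fintype.card F : ℝ)⁻¹) ^ Fintype.card (RNonzero r) *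
      (proportion univ (fun u : RNonzero r → Fˣ => B (maskZero (zeroVec r hr) u)) +
        (Fintype.card F : ℝ)⁻¹ * ∑ γ : RNonzero r,
          proportion univ fun u : RNonzero r → Fˣ => B (maskZero γ.1 u)) := by
  classical
  have hnone := proportion_forall_ne_zero (ι := RNonzero r) (mem_univ (0 : F))
  have hone (γ : RNonzero r) := proportion_forall_eq_zero_iff (mem_univ (0 : F)) γ
  have hzero (a : RNonzero r → F) :
      (∀ α, a α ≠ 0) ↔ ∀ α, a α = 0 ↔ α.1 = zeroVec r hr :=
    forall_congr' fun α => (iff_false_right ((exists_ne_zero_iff hr).1 α.2)).symm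
  simp only [Fintype.piFinset_univ, card_univ, hzero, Subtype.ext_iff] at hnone hone
  simp only [valueDensity, Fintype.piFinset_univ, card_univ, hzero, Subtype.ext_iff,
    proportion_zeros_and, hnone, mul_sum, ← mul_assoc, hone, mul_add]

namespace CharacterSystem

variable {χ : ℕ → MulChar F ℂ} {D : CharacterSystem r χ}

variable (D) in
theorem isEquidistributed_logSum [∀ j, NeZero (r j)] :
    IsEquidistributed D.logSum univ univ := by
  classical
  refine .of_surjective (fun u v => ?_) fun y => ?_
  · refine (sum_congr rfl fun α _ => ?_).trans sum_add_distrib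
    rw [Pi.mul_apply, ofMul_mul, map_add]
    rfl
  · obtain ⟨g, hg⟩ := D.exists_log_eq_one
    obtain ⟨γ, rfl⟩ := vecElt_bijective.2 y
    by_cases hγ : ∃ j, (γ j : ℕ) ≠ 0
    · refine ⟨Pi.mulSingle ⟨γ, hγ⟩ g, (sum_eq_single ⟨γ, hγ⟩ (fun α _ hα => ?_) ?_).trans ?_⟩
      · rw [Pi.mulSingle_eq_of_ne hα, ofMul_one, map_zero]
        rfl
      · exact fun h => absurd (mem_univ _) h
      · rw [Pi.mulSingle_eq_same, hg, AddMonoid.End.one_apply]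
    · push Not at hγ
      refine ⟨1, funext fun j => ?_⟩
      simp [logSum, castVec, hγ]

theorem HasStandardForm.proportion_charValue_maskZero {ε : PairIndex r → ℂ} {β : RFull r}
    {h : CoverGroup r} (hr : ∀ j, 0 < r j) (hε : D.HasStandardForm ε β h) (γ : RFull r) :
    proportion univ (fun u : RNonzero r → Fˣ => ∀ p, charValue χ (maskZero γ u) p = ε p) =
      if zeroSumPairs γ = zeroSumPairs β then (ramIndex β : ℝ) / groupOrder r else 0 := by
  have (j : Fin n) : NeZero (r j) := ⟨(hr j).ne'⟩
  simp only [hε.charValue_maskZero_eq_iff]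
  split_ifs with hγβ
  · simp only [hγβ, true_and]
    rw [D.isEquidistributed_logSum.proportion_comp
      fun y => y - h ∈ AddSubgroup.zmultiples (vecElt γ), proportion_sub_mem, Nat.card_zmultiples,
      addOrderOf_vecElt, ramIndex_eq_of_rel (show γ ≈ β from hγβ),
      ← Fintype.card_of_bijective vecElt_bijective, card_RFull]
  · exact proportion_eq_zero fun u _ hu => hγβ hu.1

omit [DecidableEq F] in
theorem HasStandardForm.valueDensity_charValue {ε : PairIndex r → ℂ} {β : RFull r}
    {h : CoverGroup r} (hr : ∀ j, 0 < r j) (hε : D.HasStandardForm ε β h) :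
    valueDensity univ (fun a => ∀ p, charValue χ a p = ε p) =
      (1 - (Fintype.card F : ℝ)⁻¹) ^ Fintype.card (RNonzero r) *
        (if β = zeroVec r hr then 1 / (groupOrder r : ℝ)
        else (Fintype.card F : ℝ)⁻¹ * (Nat.totient (ramIndex β ^ 2) / groupOrder r)) := by
  classical
  rw [valueDensity_univ_eq hr]
  congr 1
  simp only [hε.proportion_charValue_maskZero hr, sum_ite, sum_const_zero, add_zero, sum_const,
    nsmul_eq_mul, eq_comm (a := zeroSumPairs (zeroVec r hr)), zeroSumPairs_eq_zeroVec_iff hr]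
  split_ifs with hβ
  · have hempty : #{γ : RNonzero r | γ.1 = zeroVec r hr} = 0 :=
      card_filter_eq_zero_iff.2 fun γ _ => (exists_ne_zero_iff hr).1 γ.2
    simp only [hβ, zeroSumPairs_eq_zeroVec_iff hr, hempty, ramIndex_zeroVec, Nat.cast_zero,
      Nat.cast_one, zero_mul, mul_zero, add_zero]
  · rw [card_filter_RNonzero_zeroSumPairs_eq hr hβ, totient_sq, zero_add, Nat.cast_mul,
      mul_comm (ramIndex β : ℝ), mul_div_assoc]

end CharacterSystem

/-- The factor of the main term that belongs to a point of class `b`. -/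
def classFactor (F : Type*) [Field F] [Fintype F] (hr : ∀ j, 0 < r j) (b : RClass r) : ℝ :=
  if b = ⟦zeroVec r hr⟧ then
    (Fintype.card F : ℝ) / (groupOrder r * (Fintype.card F + groupOrder r - 1))
  else (Nat.totient (classRamIndex b ^ 2) : ℝ) /
    (groupOrder r * (Fintype.card F + groupOrder r - 1))

omit [DecidableEq F] in
theorem CharacterSystem.HasStandardForm.valueDensity_div_goodDensity {χ : ℕ → MulChar F ℂ}
    {D : CharacterSystem r χ} {ε : PairIndex r → ℂ} {β : RFull r} {h : CoverGroup r}
    (hr : ∀ j, 0 < r j) (hε : D.HasStandardForm ε β h) :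
    valueDensity univ (fun a => ∀ p, charValue χ a p = ε p) /
      goodDensity (Fintype.card (RNonzero r)) (Fintype.card F) = classFactor F hr ⟦β⟧ := by
  have hQ := card_pos_real F
  have hu : (1 - (Fintype.card F : ℝ)⁻¹) ^ Fintype.card (RNonzero r) ≠ 0 :=
    (pow_pos (sub_pos.2 (inv_lt_one_of_one_lt₀ (one_lt_card_real F))) _).ne'
  have hclass : (⟦β⟧ : RClass r) = ⟦zeroVec r hr⟧ ↔ β = zeroVec r hr :=
    Quotient.eq.trans (zeroSumPairs_eq_zeroVec_iff hr)
  have hgood : 1 + (Fintype.card (RNonzero r) : ℝ) / Fintype.card F =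
      (Fintype.card F + groupOrder r - 1) / Fintype.card F := by
    rw [card_RNonzero hr, Nat.cast_pred (groupOrder_pos hr), one_add_div hQ.ne',
      add_sub_assoc]
  rw [hε.valueDensity_charValue hr, goodDensity, mul_div_mul_left _ _ hu, hgood]
  simp only [classFactor, hclass]
  split_ifs
  · rw [div_div_div_eq, one_mul]
  · change _ = (Nat.totient (ramIndex β ^ 2) : ℝ) / _
    rw [← div_eq_inv_mul, div_div_div_cancel_right₀ hQ.ne', div_div]

end PointDensities

/-! ### The main term -/

section MainTerm

theorem isGoodTuple_iff {F : Type*} [Field F] {n : ℕ} {r : Fin n → ℕ} (f : RNonzero r → F[X]) :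
    IsGoodTuple f ↔ (∀ α, (f α).Monic) ∧ Squarefree (∏ α, f α) := by
  classical
  constructor
  · rintro ⟨hf, hcop⟩
    exact ⟨fun α => (hf α).1, squarefree_prod_of_pairwise_isCoprime
      (fun α _ β _ h => (hcop α β h).isRelPrime) fun α _ => (hf α).2⟩
  · rintro ⟨hm, hsq⟩
    refine ⟨fun α => ⟨hm α, hsq.squarefree_of_dvd (dvd_prod_of_mem f (mem_univ α))⟩,
      fun α β hαβ => ?_⟩
    have hdvd : f α * f β ∣ ∏ γ, f γ := by
      rw [← mul_prod_erase univ f (mem_univ α)]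
      exact mul_dvd_mul_left _ (dvd_prod_of_mem f (mem_erase.2 ⟨hαβ.symm, mem_univ β⟩))
    exact (squarefree_mul_iff.1 (hsq.squarefree_of_dvd hdvd)).1.isCoprime

variable {F : Type*} [Field F] {n : ℕ} {r : Fin n → ℕ}

/-- The condition on the values of a tuple at `y` that makes its characters take the values
`ε i` at those `x i` that are equal to `y`. -/
def Prescription (χ : ℕ → MulChar F ℂ) {k : ℕ} (x : Fin k → F) (ε : Fin k → PairIndex r → ℂ)
    (y : F) (a : RNonzero r → F) : Prop :=
  ∀ i, x i = y → ∀ p, charValue χ a p = ε i p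

theorem mulChar_eval_twistPoly_one (χ : ℕ → MulChar F ℂ) (f : RNonzero r → F[X])
    (p : PairIndex r) (x : F) :
    χ (ell p.s) ((twistPoly 1 f p).eval x) = charValue χ (fun α => (f α).eval x) p := by
  rw [eval_twistPoly, charValue, twistCoeff]
  simp only [Pi.one_apply, Units.val_one, one_pow, prod_const_one, one_mul]

theorem classCount_eq {χ : ℕ → MulChar F ℂ} {d : RNonzero r → ℕ} {k : ℕ}
    {ε : Fin k → PairIndex r → ℂ} {b : Fin k → RClass r}
    (hb : ∀ i c, IsClassAdmissible χ d (ε i) c ↔ b i = c) (c : RClass r) :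
    classCount χ d ε c = #{i | b i = c} := by
  simp only [classCount, hb]
  rw [← Set.ncard_coe_finset, coe_filter_univ]

variable [Fintype F]

theorem mem_valueSet_iff {χ : ℕ → MulChar F ℂ} {d : RNonzero r → ℕ} {k : ℕ} {x : Fin k → F}
    {ε : Fin k → PairIndex r → ℂ} {f : RNonzero r → F[X]} :
    f ∈ valueSet χ d x ε ↔
      f ∈ Fintype.piFinset (fun α => monics F (d α)) ∧ IsSifted (Prescription χ x ε) f := by
  rw [Fintype.mem_piFinset]
  simp only [mem_monics, forall_and, valueSet, tuples, Set.mem_ofPred_eq, isGoodTuple_iff]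
  constructor
  · rintro ⟨⟨⟨hm, hsq⟩, hd⟩, hv⟩
    refine ⟨⟨hm, hd⟩, (isSifted_iff fun α => (hm α).ne_zero).2 ⟨hsq, fun y i hi p => ?_⟩⟩
    rw [← hi, ← hv i p, mulChar_eval_twistPoly_one]
  · rintro ⟨⟨hm, hd⟩, hf⟩
    obtain ⟨hsq, hv⟩ := (isSifted_iff fun α => (hm α).ne_zero).1 hf
    exact ⟨⟨⟨hm, hsq⟩, hd⟩, fun i p =>
      (mulChar_eval_twistPoly_one χ f p (x i)).trans (hv (x i) i rfl p)⟩

theorem ncard_valueSet (χ : ℕ → MulChar F ℂ) (d : RNonzero r → ℕ) {k : ℕ} (x : Fin k → F)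
    (ε : Fin k → PairIndex r → ℂ) :
    ((valueSet χ d x ε).ncard : ℝ) =
      sieveDensity (Prescription χ x ε) d * (Fintype.card F : ℝ) ^ ∑ α, d α := by
  classical
  have hset : valueSet χ d x ε =
      ({f ∈ Fintype.piFinset (fun α => monics F (d α)) | IsSifted (Prescription χ x ε) f} :
        Finset (RNonzero r → F[X])) := by
    ext f
    rw [mem_valueSet_iff, mem_coe, mem_filter]
  have hcard : (#(Fintype.piFinset fun α => monics F (d α)) : ℝ) =
      (Fintype.card F : ℝ) ^ ∑ α, d α := by
    simp only [Fintype.card_piFinset, card_monics, prod_pow_eq_pow_sum, Nat.cast_pow]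
  rw [hset, Set.ncard_coe_finset, sieveDensity, proportion_eq_card_div, hcard,
    div_mul_cancel₀ _ (pow_pos (card_pos_real F) _).ne']

theorem prod_classFactor_eq (hr : ∀ j, 0 < r j) {χ : ℕ → MulChar F ℂ} {d : RNonzero r → ℕ} {k : ℕ}
    {ε : Fin k → PairIndex r → ℂ} {b : Fin k → RClass r}
    (hb : ∀ i c, IsClassAdmissible χ d (ε i) c ↔ b i = c) :
    ∏ i, classFactor F hr (b i) = ∏ c, classFactor F hr c ^ classCount χ d ε c := by
  classical
  simp only [classCount_eq hb, ← prod_const]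
  exact (prod_fiberwise' univ b (classFactor F hr)).symm

theorem mainTerm_eq (hr : ∀ j, 0 < r j) {χ : ℕ → MulChar F ℂ} {d : RNonzero r → ℕ} {k : ℕ}
    {ε : Fin k → PairIndex r → ℂ} {b : Fin k → RClass r}
    (hb : ∀ i c, IsClassAdmissible χ d (ε i) c ↔ b i = c) :
    mainTerm hr χ d ε = limitDensity F (Fintype.card (RNonzero r)) *
      (∏ i, classFactor F hr (b i)) * (Fintype.card F : ℝ) ^ ∑ α, d α := by
  classical
  have hzero : classFactor F hr ⟦zeroVec r hr⟧ =
      (Fintype.card F : ℝ) / (groupOrder r * (Fintype.card F + groupOrder r - 1)) := if_pos rfl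
  have hprod : ∏ c ∈ univ.erase ⟦zeroVec r hr⟧, classFactor F hr c ^ classCount χ d ε c =
      ∏ c ∈ univ.erase ⟦zeroVec r hr⟧, ((Nat.totient (classRamIndex c ^ 2) : ℝ) /
        (groupOrder r * (Fintype.card F + groupOrder r - 1))) ^ classCount χ d ε c :=
    prod_congr rfl fun c hc => by rw [classFactor, if_neg (ne_of_mem_erase hc)]
  rw [prod_classFactor_eq hr hb, ← prod_erase_mul _ _ (mem_univ ⟦zeroVec r hr⟧), hprod, hzero,
    limitDensity, card_RNonzero hr, mainTerm, Nat.sub_sub]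
  ring

theorem ramIndex_pos (hr : ∀ j, 0 < r j) (β : RFull r) : 0 < ramIndex β := by
  refine Nat.pos_of_ne_zero fun h => ?_
  obtain ⟨j, -, hj⟩ := Finset.lcm_eq_zero_iff.1 h
  exact (Nat.div_pos (Nat.gcd_le_left _ (hr j)) (Nat.gcd_pos_of_pos_left _ (hr j))).ne' hj

/-- A positive lower bound for the factors `classFactor F hr b` that does not depend on `b`. -/
def minClassFactor (F : Type*) [Fintype F] {n : ℕ} (r : Fin n → ℕ) : ℝ :=
  1 / (groupOrder r * (Fintype.card F + groupOrder r - 1))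

theorem one_le_classFactor_denominator (hr : ∀ j, 0 < r j) :
    (1 : ℝ) ≤ groupOrder r * (Fintype.card F + groupOrder r - 1) := by
  have hG : (1 : ℝ) ≤ groupOrder r := Nat.one_le_cast.2 (groupOrder_pos hr)
  exact one_le_mul_of_one_le_of_one_le hG (by linarith [one_lt_card_real F])

theorem minClassFactor_pos (hr : ∀ j, 0 < r j) : 0 < minClassFactor F r :=
  one_div_pos.2 (one_pos.trans_le (one_le_classFactor_denominator hr))

theorem minClassFactor_le_one (hr : ∀ j, 0 < r j) : minClassFactor F r ≤ 1 :=
  div_le_one_of_le₀ (one_le_classFactor_denominator hr)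
    (zero_le_one.trans (one_le_classFactor_denominator hr))

theorem minClassFactor_le_classFactor (hr : ∀ j, 0 < r j) (b : RClass r) :
    minClassFactor F r ≤ classFactor F hr b := by
  have hden := zero_le_one.trans (one_le_classFactor_denominator (F := F) hr)
  rw [classFactor]
  split_ifs
  · exact div_le_div_of_nonneg_right (one_lt_card_real F).le hden
  · refine div_le_div_of_nonneg_right (Nat.one_le_cast.2 (Nat.totient_pos.2 ?_)) hden
    induction b using Quotient.inductionOn with
    | h β => exact pow_pos (ramIndex_pos hr β) 2

theorem minClassFactor_pow_le_prod (hr : ∀ j, 0 < r j) {k : ℕ} {x : Fin k → F}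
    (hx : Function.Injective x) (b : Fin k → RClass r) :
    minClassFactor F r ^ Fintype.card F ≤ ∏ i, classFactor F hr (b i) := by
  have hk : k ≤ Fintype.card F := (Fintype.card_fin k).symm.trans_le
    (Fintype.card_le_of_injective x hx)
  calc minClassFactor F r ^ Fintype.card F ≤ minClassFactor F r ^ k :=
        pow_le_pow_of_le_one (minClassFactor_pos hr).le (minClassFactor_le_one hr) hk
    _ = ∏ _i : Fin k, minClassFactor F r := (Fin.prod_const k _).symm
    _ ≤ ∏ i, classFactor F hr (b i) := prod_le_prod (fun _ _ => (minClassFactor_pos hr).le)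
        fun i _ => minClassFactor_le_classFactor hr (b i)

theorem prod_valueDensity_prescription (hr : ∀ j, 0 < r j) {χ : ℕ → MulChar F ℂ}
    {D : CharacterSystem r χ} {k : ℕ} {x : Fin k → F} (hx : Function.Injective x)
    {ε : Fin k → PairIndex r → ℂ} {β : Fin k → RFull r} {h : Fin k → CoverGroup r}
    (hε : ∀ i, D.HasStandardForm (ε i) (β i) (h i)) :
    ∏ y, valueDensity univ (Prescription χ x ε y) /
        goodDensity (Fintype.card (RNonzero r)) (Fintype.card F) =
      ∏ i, classFactor F hr ⟦β i⟧ := by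
  refine (Fintype.prod_of_injective x hx _ _ (fun y hy => ?_) fun i => ?_).symm
  · have htrue : Prescription χ x ε y = fun _ => True :=
      funext fun a => eq_true fun i hi => absurd ⟨i, hi⟩ hy
    rw [htrue, valueDensity_true (mem_univ 0), card_univ]
    exact div_self (goodDensity_pos _ (one_lt_card_real F)).ne'
  · have hvalues : Prescription χ x ε (x i) = fun a => ∀ p, charValue χ a p = ε i p :=
      funext fun a => propext ⟨fun ha => ha i rfl, fun ha i' hi' => hx hi' ▸ ha⟩
    rw [hvalues, (hε i).valueDensity_div_goodDensity hr]

theorem invSqrt_pow (N : ℕ) : invSqrt F ^ N = (Fintype.card F : ℝ) ^ (-(N : ℝ) / 2) := by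
  have hq := (card_pos_real F).le
  rw [invSqrt, Real.sqrt_eq_rpow, ← Real.rpow_neg hq, ← Real.rpow_natCast, ← Real.rpow_mul hq]
  congr 1
  ring

theorem mainTerm_ge (hr : ∀ j, 0 < r j) {χ : ℕ → MulChar F ℂ} {d : RNonzero r → ℕ} {k : ℕ}
    {x : Fin k → F} (hx : Function.Injective x) {ε : Fin k → PairIndex r → ℂ} {b : Fin k → RClass r}
    (hb : ∀ i c, IsClassAdmissible χ d (ε i) c ↔ b i = c) :
    limitDensity F (Fintype.card (RNonzero r)) * minClassFactor F r ^ Fintype.card F *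
      (Fintype.card F : ℝ) ^ ∑ α, d α ≤ mainTerm hr χ d ε := by
  rw [mainTerm_eq hr hb]
  have hL := limitDensity_pos (F := F) (Fintype.card (RNonzero r))
  gcongr
  exact minClassFactor_pow_le_prod hr hx b

theorem abs_ncard_valueSet_sub_mainTerm_le (hr : ∀ j, 0 < r j) {χ : ℕ → MulChar F ℂ}
    {D : CharacterSystem r χ} {k : ℕ} {x : Fin k → F} (hx : Function.Injective x)
    {d : RNonzero r → ℕ} {ε : Fin k → PairIndex r → ℂ} (ha : ∀ i, IsAdmissible χ d (ε i))
    {β : Fin k → RFull r} {h : Fin k → CoverGroup r}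
    (hε : ∀ i, D.HasStandardForm (ε i) (β i) (h i)) :
    |((valueSet χ d x ε).ncard : ℝ) - mainTerm hr χ d ε| ≤
      errorConst F (Fintype.card (RNonzero r)) * invSqrt F ^ (⨅ α, d α) *
        (Fintype.card F : ℝ) ^ ∑ α, d α := by
  have hlimit := tendsto_prod_localDensity (Prescription χ x ε)
  rw [prod_valueDensity_prescription hr hx hε] at hlimit
  have hX : (0 : ℝ) < (Fintype.card F : ℝ) ^ ∑ α, d α := pow_pos (card_pos_real F) _
  rw [mainTerm_eq hr fun i => (hε i).isClassAdmissible_iff (ha i), ncard_valueSet, ← sub_mul,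
    abs_mul, abs_of_pos hX]
  exact mul_le_mul_of_nonneg_right (abs_sieveDensity_sub_le_of_tendsto hlimit fun α =>
    ciInf_le (OrderBot.bddBelow (Set.range d)) α) hX.le

end MainTerm

end

end AbelianCovers

theorem proposition5p3_general {F : Type*} [Field F] [Fintype F] {n : ℕ} (r : Fin n → ℕ)
    (hr : ∀ j, 0 < r j) (hq : ∀ j, Fintype.card F ≡ 1 [MOD r j]) :
    ∃ K : ℝ, ∀ χ : ℕ → MulChar F ℂ, (∀ m, m ∣ ell r → orderOf (χ m) = m) →
      ∀ (k : ℕ) (x : Fin k → F), Function.Injective x →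
      ∀ (d : RNonzero r → ℕ) (ε : Fin k → PairIndex r → ℂ),
        (∀ i, IsAdmissible χ d (ε i)) →
        |((valueSet χ d x ε).ncard : ℝ) - mainTerm hr χ d ε|
          ≤ K * mainTerm hr χ d ε
              * (Fintype.card F : ℝ) ^ (-((⨅ α, d α : ℕ) : ℝ) / 2) := by
  have (j : Fin n) : NeZero (r j) := ⟨(hr j).ne'⟩
  set E := errorConst F (Fintype.card (RNonzero r))
  set c := limitDensity F (Fintype.card (RNonzero r)) * minClassFactor F r ^ Fintype.card F
  have hE : 0 ≤ E := errorConst_nonneg _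
  have hc : 0 < c := mul_pos (limitDensity_pos _) (pow_pos (minClassFactor_pos hr) _)
  refine ⟨E / c, fun χ hχ k x hx d ε hε => ?_⟩
  obtain ⟨D⟩ := nonempty_characterSystem hq hχ
  choose β h hβ using fun i => D.exists_hasStandardForm (hε i)
  have hmain : c * (Fintype.card F : ℝ) ^ (∑ α, d α) ≤ mainTerm hr χ d ε :=
    mainTerm_ge hr hx fun i => (hβ i).isClassAdmissible_iff (hε i)
  have hs := invSqrt_pos F
  rw [← invSqrt_pow]
  calc |((valueSet χ d x ε).ncard : ℝ) - mainTerm hr χ d ε|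
      ≤ E * invSqrt F ^ (⨅ α, d α) * (Fintype.card F : ℝ) ^ (∑ α, d α) :=
        abs_ncard_valueSet_sub_mainTerm_le hr hx hε hβ
    _ = E / c * (c * (Fintype.card F : ℝ) ^ (∑ α, d α)) * invSqrt F ^ (⨅ α, d α) := by
        field_simp
    _ ≤ E / c * mainTerm hr χ d ε * invSqrt F ^ (⨅ α, d α) := by gcongr

theorem proposition5p3 {F : Type*} [Field F] [Fintype F] {n : ℕ} (r : Fin (n + 1) → ℕ)
    (hr : ∀ j, 0 < r j) (hdvd : ∀ i j, i ≤ j → r i ∣ r j) (hG : 1 < groupOrder r)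
    (hq : Fintype.card F ≡ 1 [MOD r (Fin.last n)]) :
    ∃ K : ℝ, ∀ χ : ℕ → MulChar F ℂ, (∀ m, m ∣ r (Fin.last n) → orderOf (χ m) = m) →
      ∀ (k : ℕ) (x : Fin k → F), Function.Injective x →
      ∀ (d : RNonzero r → ℕ) (ε : Fin k → PairIndex r → ℂ),
        (∀ i, IsAdmissible χ d (ε i)) →
        |((valueSet χ d x ε).ncard : ℝ) - mainTerm hr χ d ε|
          ≤ K * mainTerm hr χ d ε
              * (Fintype.card F : ℝ) ^ (-((⨅ α, d α : ℕ) : ℝ) / 2) := by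
  obtain ⟨K, hK⟩ := proposition5p3_general r hr fun j => hq.of_dvd (hdvd j _ (Fin.le_last j))
  exact ⟨K, fun χ hχ => hK χ fun m hm =>
    hχ m (hm.trans (Finset.lcm_dvd fun j _ => hdvd j _ (Fin.le_last j)))⟩
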